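/- **Setting.** Let $C$ be a field, $G$ a monoid and $D^1$ a cocommutative Hopf algebra over $C$ of Birkhoff–Witt type, i.e. as a coalgebra $D^1$ is isomorphic to the cofree pointed irreducible cocommutative coalgebra $B(U)$ on a $C$-vector space $U$ (for a basis of $U$ indexed by $\iota$, $B(U)$ has a basis $(b_\alpha)_{\alpha\in\mathbb N^{(\iota)}}$ with $\Delta(b_\alpha)=\sum_{\beta+\gamma=\alpha}b_\beta\otimes b_\gamma$ and $\varepsilon(b_\alpha)=\delta_{\alpha,0}$). Let $G$ act on $D^1$ by bialgebra endomorphisms and let $D=D^1\#CG$ be the smash product bialgebra. A commutative $D$-module algebra is *Artinian simple* if it is a nonzero Artinian ring without $D$-stable ideals other than the two trivial ones. Let $L|K$ be an extension of Artinian simple commutative $D$-module algebras such that every $g\in G\subseteq D$ acts injectively on $L$. Assume that for every minimal prime ideal $Q$ of $L$ the field extension $L/Q$ of $K/(K\cap Q)$ is separable and finitely generated, with transcendence degree $n$ independent of $Q$. Then there are tuples $u=(u_1,\dots,u_n)\in L^n$ whose image in $L/Q$ is, for every $Q$, a separating transcendence basis over $K/(K\cap Q)$. Fix any such $u$. There is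 a unique $n$-variate iterative derivation $\theta_u\colon L\to L[[w]]$, $w=(w_1,\dots,w_n)$, $\theta_u(a)=\sum_m\theta_u^{(m)}(a)w^m$, of $L$ over $K$ with $\theta_u(u_i)=u_i+w_i$ for all $i$. **Umemura functor.** Let $\mathcal M=\operatorname{Hom}_C(D,L)$ with the convolution product, with $\rho_0(a)(d)=\varepsilon(d)a$ and $\rho(a)(d)=d(a)$ for $a\in L$, with the $D$-action $(d.f)(e)=f(ed)$, and with the iterative derivation $f\mapsto\theta_u^{(m)}\circ f$. Let $\mathcal L\subseteq\mathcal M$ be the smallest subalgebra that contains $\rho_0(L)$ and $\rho(L)$ and is stable under all $\theta_u^{(m)}$, and let $\mathcal K=\rho_0(L)[\rho(K)]$. For a commutative $L$-algebra $A$ let $\mathcal L\hat\otimes_LA[[w]]$ be the $(w)$-adic completion of $\mathcal L\otimes_LA[[w]]$, where $A[[w]]$ is an $L$-algebra through $\theta_u$ and $\mathcal L$ through $\rho_0$; $D$ acts on it through $\mathcal L$, and it carries the iterative derivation $\theta$ induced by $\theta_u$ on $\mathcal L$ and by $\theta_w\colon f(w)\mapsto f(w+t)$ on $A[[w]]$.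 Then $\operatorname{Ume}(L|K)(A)$ is the group of ring automorphisms $\varphi$ of $\mathcal L\hat\otimes_LA[[w]]$ that commute with the action of $D$ and with all $\theta^{(m)}$, fix $\mathcal K\hat\otimes_LA[[w]]$ and induce the identity on $\mathcal L\hat\otimes_L(A/N(A))[[w]]$, where $N(A)$ is the nilradical. A homomorphism $A\to B$ of $L$-algebras is sent to $\varphi\mapsto\varphi\hat\otimes_{A[[w]]}\mathrm{id}_{B[[w]]}$. **Lie–Ritt functors.** Let $\Gamma_n(A)$ be the set of $\Phi=(\varphi_1,\dots,\varphi_n)\in A[[w]]^n$ with $\varphi_i\equiv w_i$ modulo $N(A)[[w]]$, with the multiplication $\Phi\cdot\Psi=(\varphi_1(\Psi),\dots,\varphi_n(\Psi))$. Let $L[[w]]\{L[[Y]]\}_\theta$ be the iterative differential subring generated by $L[[w,Y]]$, $Y=(Y_1^{(0)},\dots,Y_n^{(0)})$, in $L[[w]][[Y_i^{(k)}\mid 1\le i\le n,\ k\in\mathbb N^n]]$, where $\theta=\theta_w$ on $L[[w]]$ and $\theta^{(l)}(Y_i^{(k)})=\binom{k+l}{k}Y_i^{(k+l)}$; it is the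 polynomial ring over $L[[w,Y]]$ in the $Y_i^{(k)}$ with $k\neq0$. For $F$ in this ring, $F|_{Y=\Phi}\in A[[w]]$ is obtained by $Y_i^{(k)}\mapsto\theta_w^{(k)}(\varphi_i)$. For an ideal $I$ put $Z(I)(A)=\{\Phi\in\Gamma_n(A)\mid F|_{Y=\Phi}=0\text{ for all }F\in I\}$. A functor $\mathcal G$ from commutative $L$-algebras to groups is a *Lie–Ritt functor* in $n$ variables if there are an ideal $I$ of $L[[w]]\{L[[Y]]\}_\theta$ and injective maps $\mathcal G(A)\to\Gamma_n(A)$ with image $Z(I)(A)$, multiplicative and natural in $A$. **Theorem.** For every such $u$, $\operatorname{Ume}(L|K)$ (formed with $\theta_u$) is a Lie–Ritt functor over $L$, in $n$ variables. -/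

import Mathlib

open scoped TensorProduct
universe v w
namespace UmemuraGalois
noncomputable section


/-- The monoid `G` acts on the bialgebra `H` by bialgebra endomorphisms (it acts by ring
endomorphisms through `MulSemiringAction`, `C`-linearly through `SMulCommClass`).  This is what makes
the smash product `H # CG` a bialgebra. -/
class BialgebraAction (C G H : Type*) [CommRing C] [Monoid G] [Ring H] [Bialgebra C H]
    [MulSemiringAction G H] [SMulCommClass G C H] : Prop where
  counit_smul : ∀ (g : G) (h : H), Coalgebra.counit (R := C) (g • h) = Coalgebra.counit (R := C) h
  comul_smul : ∀ (g : G) (h : H), Coalgebra.comul (R := C) (g • h) =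
    TensorProduct.map (DistribSMul.toLinearMap C H g) (DistribSMul.toLinearMap C H g)
      (Coalgebra.comul (R := C) h)

/-- The smash product `H # CG` is the skew monoid algebra, with `h # g = SkewMonoidAlgebra.single g h`
and multiplication `(h # g)(h' # g') = h (g • h') # g g'`.  Its comultiplication and counit are those
of the tensor product of coalgebras `H ⊗ CG`, where the elements of `G` are grouplike:
`Δ(h # g) = ∑ (h₁ # g) ⊗ (h₂ # g)` and `ε(h # g) = ε(h)`. -/
instance smashCoalgebraStruct (C G H : Type*) [CommRing C] [Ring H] [Bialgebra C H] :
    CoalgebraStruct C (SkewMonoidAlgebra H G) where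
  comul := TensorProduct.map (SkewMonoidAlgebra.coeffLinearEquiv (S := C)).symm.toLinearMap
      (SkewMonoidAlgebra.coeffLinearEquiv (S := C)).symm.toLinearMap ∘ₗ
    Coalgebra.comul ∘ₗ (SkewMonoidAlgebra.coeffLinearEquiv (S := C) (k := H) (G := G)).toLinearMap
  counit := Coalgebra.counit ∘ₗ
    (SkewMonoidAlgebra.coeffLinearEquiv (S := C) (k := H) (G := G)).toLinearMap

theorem smash_comul_single {C G H : Type*} [CommRing C] [Ring H] [Bialgebra C H] (g : G) (h : H) :
    Coalgebra.comul (R := C) (SkewMonoidAlgebra.single g h) =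
      TensorProduct.map (SkewMonoidAlgebra.lsingle C g) (SkewMonoidAlgebra.lsingle C g)
        (Coalgebra.comul (R := C) h) := by
  have h1 : Coalgebra.comul (R := C) (SkewMonoidAlgebra.single g h) =
    TensorProduct.map (SkewMonoidAlgebra.coeffLinearEquiv (S := C)).symm.toLinearMap
      (SkewMonoidAlgebra.coeffLinearEquiv (S := C)).symm.toLinearMap
      (Coalgebra.comul (R := C) (Finsupp.single g h : G →₀ H)) := rfl
  rw [h1, Finsupp.comul_single, TensorProduct.map_map]
  rfl

theorem smash_counit_single {C G H : Type*} [CommRing C] [Ring H] [Bialgebra C H] (g : G) (h : H) :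
    Coalgebra.counit (R := C) (SkewMonoidAlgebra.single g h) = Coalgebra.counit (R := C) h := by
  have h1 : Coalgebra.counit (R := C) (SkewMonoidAlgebra.single g h) =
    Coalgebra.counit (R := C) (Finsupp.single g h : G →₀ H) := rfl
  rw [h1, Finsupp.counit_single]

instance smashCoalgebra (C G H : Type*) [CommRing C] [Ring H] [Bialgebra C H] :
    Coalgebra C (SkewMonoidAlgebra H G) := by
  have h1 : ∀ g : G, Coalgebra.comul (R := C) (A := SkewMonoidAlgebra H G) ∘ₗ
      SkewMonoidAlgebra.lsingle C g = TensorProduct.map (SkewMonoidAlgebra.lsingle C g)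
        (SkewMonoidAlgebra.lsingle C g) ∘ₗ Coalgebra.comul (R := C) (A := H) :=
    fun g => LinearMap.ext fun h => smash_comul_single g h
  have h2 : ∀ g : G, Coalgebra.counit (R := C) (A := SkewMonoidAlgebra H G) ∘ₗ
      SkewMonoidAlgebra.lsingle C g = Coalgebra.counit (R := C) (A := H) :=
    fun g => LinearMap.ext fun h => smash_counit_single g h
  refine { coassoc := ?_, rTensor_counit_comp_comul := ?_, lTensor_counit_comp_comul := ?_ }
  · refine SkewMonoidAlgebra.lhom_ext' fun g => ?_
    have hr : ∀ x : H ⊗[C] H, LinearMap.rTensor (SkewMonoidAlgebra H G)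
        (Coalgebra.comul (R := C) (A := SkewMonoidAlgebra H G))
        (TensorProduct.map (SkewMonoidAlgebra.lsingle C g) (SkewMonoidAlgebra.lsingle C g) x) =
        TensorProduct.map (TensorProduct.map (SkewMonoidAlgebra.lsingle C g)
          (SkewMonoidAlgebra.lsingle C g)) (SkewMonoidAlgebra.lsingle C g)
          (LinearMap.rTensor H (Coalgebra.comul (R := C) (A := H)) x) := by
      intro x
      have := LinearMap.congr_fun (h1 g)
      simp only [LinearMap.comp_apply] at this
      induction x with
      | zero => simp
      | add a b ha hb => rw [map_add, map_add, ha, hb, map_add, map_add]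
      | tmul a b => simp [this]
    have hl : ∀ x : H ⊗[C] H, LinearMap.lTensor (SkewMonoidAlgebra H G)
        (Coalgebra.comul (R := C) (A := SkewMonoidAlgebra H G))
        (TensorProduct.map (SkewMonoidAlgebra.lsingle C g) (SkewMonoidAlgebra.lsingle C g) x) =
        TensorProduct.map (SkewMonoidAlgebra.lsingle C g) (TensorProduct.map
          (SkewMonoidAlgebra.lsingle C g) (SkewMonoidAlgebra.lsingle C g))
          (LinearMap.lTensor H (Coalgebra.comul (R := C) (A := H)) x) := by
      intro x
      have := LinearMap.congr_fun (h1 g)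
      simp only [LinearMap.comp_apply] at this
      induction x with
      | zero => simp
      | add a b ha hb => rw [map_add, map_add, ha, hb, map_add, map_add]
      | tmul a b => simp [this]
    have ha : ∀ x : (H ⊗[C] H) ⊗[C] H, TensorProduct.assoc C _ _ _
        (TensorProduct.map (TensorProduct.map (SkewMonoidAlgebra.lsingle C g)
          (SkewMonoidAlgebra.lsingle C g)) (SkewMonoidAlgebra.lsingle C g) x) =
        TensorProduct.map (SkewMonoidAlgebra.lsingle C g) (TensorProduct.map
          (SkewMonoidAlgebra.lsingle C g) (SkewMonoidAlgebra.lsingle C g))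
          (TensorProduct.assoc C _ _ _ x) := by
      intro x
      rw [TensorProduct.map_map_assoc]
    refine LinearMap.ext fun h => ?_
    have := LinearMap.congr_fun (h1 g)
    simp only [LinearMap.comp_apply] at this
    simp only [LinearMap.comp_apply, LinearEquiv.coe_coe]
    rw [this, hr, ha, hl, Coalgebra.coassoc_apply]
  · refine SkewMonoidAlgebra.lhom_ext' fun g => ?_
    rw [LinearMap.comp_assoc, h1, ← LinearMap.comp_assoc, LinearMap.rTensor_comp_map, h2,
      ← LinearMap.lTensor_comp_rTensor, LinearMap.comp_assoc, Coalgebra.rTensor_counit_comp_comul,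
      LinearMap.lTensor_comp_mk]
  · refine SkewMonoidAlgebra.lhom_ext' fun g => ?_
    rw [LinearMap.comp_assoc, h1, ← LinearMap.comp_assoc, LinearMap.lTensor_comp_map, h2,
      ← LinearMap.rTensor_comp_lTensor, LinearMap.comp_assoc, Coalgebra.lTensor_counit_comp_comul,
      LinearMap.rTensor_comp_flip_mk]

instance smashIsCocomm (C G H : Type*) [CommRing C] [Ring H] [Bialgebra C H]
    [Coalgebra.IsCocomm C H] : Coalgebra.IsCocomm C (SkewMonoidAlgebra H G) where
  comm_comp_comul := by
    refine SkewMonoidAlgebra.lhom_ext fun g h => ?_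
    simp only [LinearMap.comp_apply, smash_comul_single]
    have := TensorProduct.map_comm (R := C) (SkewMonoidAlgebra.lsingle C g)
      (SkewMonoidAlgebra.lsingle C g) (Coalgebra.comul (R := C) h)
    simp only [LinearEquiv.coe_coe]
    rw [← this, Coalgebra.comm_comul]

instance smashBialgebra (C G H : Type*) [CommRing C] [Monoid G] [Ring H] [Bialgebra C H]
    [MulSemiringAction G H] [SMulCommClass G C H] [BialgebraAction C G H] :
    Bialgebra C (SkewMonoidAlgebra H G) := by
  refine Bialgebra.mk' C _ ?_ ?_ ?_ ?_
  · rw [SkewMonoidAlgebra.one_def, smash_counit_single, Bialgebra.counit_one]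
  · intro a b
    induction a using SkewMonoidAlgebra.induction_on with
    | zero => simp
    | add a a' ha ha' => rw [add_mul, map_add, ha, ha', map_add, add_mul]
    | single g h =>
      induction b using SkewMonoidAlgebra.induction_on with
      | zero => simp
      | add a a' ha ha' => rw [mul_add, map_add, ha, ha', map_add, mul_add]
      | single g' h' =>
        rw [SkewMonoidAlgebra.single_mul_single, smash_counit_single, smash_counit_single,
          smash_counit_single, Bialgebra.counit_mul, BialgebraAction.counit_smul]
  · rw [SkewMonoidAlgebra.one_def, smash_comul_single, Bialgebra.comul_one,
      Algebra.TensorProduct.one_def, TensorProduct.map_tmul]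
    rfl
  · have key : ∀ (g g' : G) (x y : H ⊗[C] H),
      TensorProduct.map (SkewMonoidAlgebra.lsingle C (g * g')) (SkewMonoidAlgebra.lsingle C (g * g'))
        (x * TensorProduct.map (DistribSMul.toLinearMap C H g) (DistribSMul.toLinearMap C H g) y) =
      TensorProduct.map (SkewMonoidAlgebra.lsingle C g) (SkewMonoidAlgebra.lsingle C g) x *
      TensorProduct.map (SkewMonoidAlgebra.lsingle C g') (SkewMonoidAlgebra.lsingle C g') y := by
      intro g g' x y
      induction x with
      | zero => simp
      | add a a' ha ha' => rw [add_mul, map_add, ha, ha', map_add, add_mul]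
      | tmul a b =>
        induction y with
        | zero => simp
        | add a a' ha ha' => rw [map_add, mul_add, map_add, ha, ha', map_add, mul_add]
        | tmul a' b' =>
          simp [Algebra.TensorProduct.tmul_mul_tmul, SkewMonoidAlgebra.lsingle_apply,
            SkewMonoidAlgebra.single_mul_single]
    intro a b
    induction a using SkewMonoidAlgebra.induction_on with
    | zero => simp
    | add a a' ha ha' => rw [add_mul, map_add, ha, ha', map_add, add_mul]
    | single g h =>
      induction b using SkewMonoidAlgebra.induction_on with
      | zero => simp
      | add a a' ha ha' => rw [mul_add, map_add, ha, ha', map_add, mul_add]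
      | single g' h' =>
        rw [SkewMonoidAlgebra.single_mul_single, smash_comul_single, smash_comul_single,
          smash_comul_single, Bialgebra.comul_mul, BialgebraAction.comul_smul, key]

open Classical in
/-- `H` is of Birkhoff-Witt type: as a coalgebra it is the cofree pointed irreducible cocommutative
coalgebra `B(U)` on a vector space `U`.  For a basis of `U` indexed by `ι`, the coalgebra `B(U)` has
the basis of divided powers `b α`, `α ∈ ℕ^(ι)`, with `Δ(b α) = ∑_{β + γ = α} b β ⊗ b γ` and
`ε(b α) = δ_{α, 0}`. -/
def IsBirkhoffWitt (C : Type*) (H : Type v) [CommRing C] [Ring H] [Bialgebra C H] : Prop :=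
  ∃ (ι : Type v) (b : Module.Basis (ι →₀ ℕ) C H),
    (∀ α, Coalgebra.comul (R := C) (b α) =
      ∑ p ∈ Finset.HasAntidiagonal.antidiagonal α, b p.1 ⊗ₜ[C] b p.2) ∧
    ∀ α, Coalgebra.counit (R := C) (b α) = if α = 0 then 1 else 0


section Completion

variable {R S T : Type*} [CommRing R] [CommRing S] [CommRing T]

/-- Continuity of a map between adic completions, for the topologies given by the kernels of the
projections to `R ⧸ I ^ m` and `S ⧸ J ^ m`. -/
def HatCont (I : Ideal R) (J : Ideal S) (F : AdicCompletion I R →+ AdicCompletion J S) : Prop :=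
  ∀ m, ∃ M, ∀ x, AdicCompletion.evalₐ I M x = 0 → AdicCompletion.evalₐ J m (F x) = 0

theorem evala_algebraMap (I : Ideal R) (m : ℕ) (r : R) :
    AdicCompletion.evalₐ I m (algebraMap R (AdicCompletion I R) r) = Ideal.Quotient.mk (I ^ m) r :=
  AlgHom.commutes _ r

theorem exists_rep (I : Ideal R) (m : ℕ) (x : AdicCompletion I R) : ∃ r : R,
    AdicCompletion.evalₐ I m (x - algebraMap R (AdicCompletion I R) r) = 0 := by
  obtain ⟨r, hr⟩ := Ideal.Quotient.mk_surjective (AdicCompletion.evalₐ I m x)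
  exact ⟨r, by rw [map_sub, evala_algebraMap, hr, sub_self]⟩

theorem evala_of_le (I : Ideal R) {m M : ℕ} (h : m ≤ M) {x : AdicCompletion I R}
    (hx : AdicCompletion.evalₐ I M x = 0) : AdicCompletion.evalₐ I m x = 0 := by
  induction x using AdicCompletion.induction_on with
  | _ x =>
    rw [AdicCompletion.evalₐ_mk] at hx ⊢
    rw [← AdicCompletion.Ideal.mk_eq_mk I h]
    exact Ideal.Quotient.eq_zero_iff_mem.2 (Ideal.pow_le_pow_right h
      (Ideal.Quotient.eq_zero_iff_mem.1 hx))

theorem HatCont.comp {I : Ideal R} {J : Ideal S} {K : Ideal T}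
    {G : AdicCompletion J S →+ AdicCompletion K T} {F : AdicCompletion I R →+ AdicCompletion J S}
    (hG : HatCont J K G) (hF : HatCont I J F) : HatCont I K (G.comp F) := by
  intro m
  obtain ⟨M, hM⟩ := hG m
  obtain ⟨N, hN⟩ := hF M
  exact ⟨N, fun x hx => hM _ (hN x hx)⟩

theorem HatCont.add {I : Ideal R} {J : Ideal S} {F G : AdicCompletion I R →+ AdicCompletion J S}
    (hF : HatCont I J F) (hG : HatCont I J G) : HatCont I J (F + G) := by
  intro m
  obtain ⟨M, hM⟩ := hF m
  obtain ⟨N, hN⟩ := hG m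
  refine ⟨max M N, fun x hx => ?_⟩
  rw [AddMonoidHom.add_apply, map_add, hM x (evala_of_le I (le_max_left _ _) hx),
    hN x (evala_of_le I (le_max_right _ _) hx), add_zero]

theorem HatCont.sum {I : Ideal R} {J : Ideal S} {α : Type*} (s : Finset α)
    {F : α → AdicCompletion I R →+ AdicCompletion J S}
    (hF : ∀ i, HatCont I J (F i)) : HatCont I J (∑ i ∈ s, F i) := by
  classical
  induction s using Finset.induction_on with
  | empty => exact fun m => ⟨0, fun x _ => by simp⟩
  | insert i s hi ih => rw [Finset.sum_insert hi]; exact (hF i).add ih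

theorem HatCont.mulRight {I : Ideal R} {J : Ideal S}
    {F : AdicCompletion I R →+ AdicCompletion J S}
    (hF : HatCont I J F) (y : AdicCompletion J S) :
    HatCont I J ((AddMonoidHom.mulRight y).comp F) := by
  intro m
  obtain ⟨M, hM⟩ := hF m
  exact ⟨M, fun x hx => by simp [hM x hx]⟩

theorem HatCont.mulLeft {I : Ideal R} {J : Ideal S}
    {F : AdicCompletion I R →+ AdicCompletion J S}
    (hF : HatCont I J F) (y : AdicCompletion J S) :
    HatCont I J ((AddMonoidHom.mulLeft y).comp F) := by
  intro m
  obtain ⟨M, hM⟩ := hF m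
  exact ⟨M, fun x hx => by simp [hM x hx]⟩

theorem HatCont.id (I : Ideal R) : HatCont I I (AddMonoidHom.id _) :=
  fun m => ⟨m, fun _ hx => hx⟩

/-- Continuous additive maps that agree on the dense image of `R` are equal. -/
theorem HatCont.ext {I : Ideal R} {J : Ideal S} {F G : AdicCompletion I R →+ AdicCompletion J S}
    (hF : HatCont I J F) (hG : HatCont I J G)
    (h : ∀ r, F (algebraMap R _ r) = G (algebraMap R _ r)) : F = G := by
  refine AddMonoidHom.ext fun x => AdicCompletion.ext_evalₐ fun m => ?_
  obtain ⟨M, hM⟩ := hF m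
  obtain ⟨N, hN⟩ := hG m
  obtain ⟨r, hr⟩ := exists_rep I (max M N) x
  have h1 := hM _ (evala_of_le I (le_max_left _ _) hr)
  have h2 := hN _ (evala_of_le I (le_max_right _ _) hr)
  rw [map_sub, map_sub, sub_eq_zero] at h1 h2
  rw [h1, h2, h r]

theorem extAdd_aux (I : Ideal R) (J : Ideal S) (f : R →+ AdicCompletion J S) (c : ℕ)
    (h : ∀ m, ∀ x ∈ I ^ (m + c), AdicCompletion.evalₐ J m (f x) = 0)
    (x : AdicCompletion I R) (m M : ℕ) (r : R) (hm : m ≤ M)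
    (hr : AdicCompletion.evalₐ I (m + c) x = Ideal.Quotient.mk _ r) :
    AdicCompletion.evalₐ J m (f (Quotient.out (AdicCompletion.evalₐ I (M + c) x))) =
      AdicCompletion.evalₐ J m (f r) := by
  rw [← sub_eq_zero, ← map_sub, ← map_sub]
  refine h m _ (Ideal.Quotient.eq_zero_iff_mem.1 ?_)
  have h1 : AdicCompletion.evalₐ I (M + c) (x - algebraMap R _
      (Quotient.out (AdicCompletion.evalₐ I (M + c) x))) = 0 := by
    rw [map_sub, evala_algebraMap, sub_eq_zero]
    exact (Ideal.Quotient.mk_out _).symm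
  have h2 := evala_of_le I (Nat.add_le_add_right hm c) h1
  rw [map_sub, evala_algebraMap, hr, sub_eq_zero] at h2
  rw [map_sub, ← h2, sub_self]

/-- The value at `x` of the extension of `f` to the completion. -/
def extAddFun (I : Ideal R) (J : Ideal S) (f : R →+ AdicCompletion J S) (c : ℕ)
    (h : ∀ m, ∀ x ∈ I ^ (m + c), AdicCompletion.evalₐ J m (f x) = 0)
    (x : AdicCompletion I R) : AdicCompletion J S :=
  AdicCompletion.mk J S (AdicCompletion.AdicCauchySequence.mk J S
    (fun m => Quotient.out (AdicCompletion.evalₐ J m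
      (f (Quotient.out (AdicCompletion.evalₐ I (m + c) x))))) (by
    intro m
    rw [smul_eq_mul, Ideal.mul_top, SModEq.def, Ideal.Quotient.mk_eq_mk, Ideal.Quotient.mk_eq_mk]
    have e1 : Ideal.Quotient.mk (J ^ m) (Quotient.out (AdicCompletion.evalₐ J m
        (f (Quotient.out (AdicCompletion.evalₐ I (m + c) x))))) = _ := Ideal.Quotient.mk_out _
    rw [e1, ← extAdd_aux I J f c h x m (m + 1) _ m.le_succ (Ideal.Quotient.mk_out _).symm]
    set y := f (Quotient.out (AdicCompletion.evalₐ I (m + 1 + c) x))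
    have h1 : AdicCompletion.evalₐ J (m + 1) (y - algebraMap S _
        (Quotient.out (AdicCompletion.evalₐ J (m + 1) y))) = 0 := by
      rw [map_sub, evala_algebraMap, sub_eq_zero]
      exact (Ideal.Quotient.mk_out _).symm
    have h2 := evala_of_le J m.le_succ h1
    rwa [map_sub, evala_algebraMap, sub_eq_zero] at h2))

theorem extAddFun_spec (I : Ideal R) (J : Ideal S) (f : R →+ AdicCompletion J S) (c : ℕ)
    (h : ∀ m, ∀ x ∈ I ^ (m + c), AdicCompletion.evalₐ J m (f x) = 0)
    (x : AdicCompletion I R) (m : ℕ) (r : R)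
    (hr : AdicCompletion.evalₐ I (m + c) x = Ideal.Quotient.mk _ r) :
    AdicCompletion.evalₐ J m (extAddFun I J f c h x) = AdicCompletion.evalₐ J m (f r) := by
  rw [extAddFun, AdicCompletion.evalₐ_mk, ← extAdd_aux I J f c h x m m r le_rfl hr]
  exact Ideal.Quotient.mk_out _

/-- The extension to completions of an additive map that is continuous for the adic topologies:
`f` maps `I ^ (m + c)` to the kernel of the projection to `S ⧸ J ^ m`. -/
def extAdd (I : Ideal R) (J : Ideal S) (f : R →+ AdicCompletion J S) (c : ℕ)
    (h : ∀ m, ∀ x ∈ I ^ (m + c), AdicCompletion.evalₐ J m (f x) = 0) :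
    AdicCompletion I R →+ AdicCompletion J S :=
  AddMonoidHom.mk' (extAddFun I J f c h) (by
    intro x y
    refine AdicCompletion.ext_evalₐ fun m => ?_
    obtain ⟨r, hr⟩ := Ideal.Quotient.mk_surjective (AdicCompletion.evalₐ I (m + c) x)
    obtain ⟨s, hs⟩ := Ideal.Quotient.mk_surjective (AdicCompletion.evalₐ I (m + c) y)
    rw [map_add, extAddFun_spec I J f c h x m r hr.symm, extAddFun_spec I J f c h y m s hs.symm,
      extAddFun_spec I J f c h (x + y) m (r + s) (by rw [map_add, map_add, hr, hs]), map_add,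
      map_add])

theorem extAdd_algebraMap (I : Ideal R) (J : Ideal S) (f : R →+ AdicCompletion J S) (c : ℕ)
    (h : ∀ m, ∀ x ∈ I ^ (m + c), AdicCompletion.evalₐ J m (f x) = 0) (r : R) :
    extAdd I J f c h (algebraMap R _ r) = f r :=
  AdicCompletion.ext_evalₐ fun m => extAddFun_spec I J f c h _ m r (evala_algebraMap I _ r)

theorem extAdd_cont (I : Ideal R) (J : Ideal S) (f : R →+ AdicCompletion J S) (c : ℕ)
    (h : ∀ m, ∀ x ∈ I ^ (m + c), AdicCompletion.evalₐ J m (f x) = 0) :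
    HatCont I J (extAdd I J f c h) := fun m => ⟨m + c, fun x hx => by
  have := extAddFun_spec I J f c h x m 0 (by rw [hx, map_zero])
  rw [map_zero, map_zero] at this
  exact this⟩

theorem evala_eq_zero_of_mem_map (J : Ideal S) (m : ℕ) (y : AdicCompletion J S)
    (hy : y ∈ (J ^ m).map (algebraMap S (AdicCompletion J S))) :
    AdicCompletion.evalₐ J m y = 0 := by
  have : (J ^ m).map (algebraMap S (AdicCompletion J S)) ≤
      RingHom.ker (AdicCompletion.evalₐ J m) := by
    rw [Ideal.map_le_iff_le_comap]
    intro s hs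
    rw [Ideal.mem_comap, RingHom.mem_ker, evala_algebraMap]
    exact Ideal.Quotient.eq_zero_iff_mem.2 hs
  exact this hy

theorem ringHom_cont_aux {I : Ideal R} {J : Ideal S} (f : R →+* AdicCompletion J S)
    (h : I.map f ≤ J.map (algebraMap S (AdicCompletion J S))) (m : ℕ) (x : R) (hx : x ∈ I ^ m) :
    AdicCompletion.evalₐ J m (f x) = 0 := by
  refine evala_eq_zero_of_mem_map J m _ ?_
  rw [Ideal.map_pow]
  refine Ideal.pow_right_mono h m ?_
  rw [← Ideal.map_pow]
  exact Ideal.mem_map_of_mem f hx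

/-- The extension to completions of a continuous ring homomorphism. -/
def extRing (I : Ideal R) (J : Ideal S) (f : R →+* AdicCompletion J S)
    (h : I.map f ≤ J.map (algebraMap S (AdicCompletion J S))) :
    AdicCompletion I R →+* AdicCompletion J S :=
  { extAdd I J (f : R →+ AdicCompletion J S) 0 (ringHom_cont_aux f h) with
    map_one' := by
      have := extAdd_algebraMap I J (f : R →+ AdicCompletion J S) 0 (ringHom_cont_aux f h) 1
      rw [map_one] at this
      exact this.trans f.map_one
    map_mul' := by
      intro x y
      have hc := extAdd_cont I J (f : R →+ AdicCompletion J S) 0 (ringHom_cont_aux f h)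
      have ha := extAdd_algebraMap I J (f : R →+ AdicCompletion J S) 0 (ringHom_cont_aux f h)
      set F := extAdd I J (f : R →+ AdicCompletion J S) 0 (ringHom_cont_aux f h)
      have h1 : ∀ r : R, F.comp (AddMonoidHom.mulRight (algebraMap R _ r)) =
          (AddMonoidHom.mulRight (f r)).comp F := by
        intro r
        refine HatCont.ext (hc.comp ((HatCont.id I).mulRight _)) (hc.mulRight _) fun s => ?_
        simp only [AddMonoidHom.comp_apply, AddMonoidHom.coe_mulRight]
        rw [← map_mul, ha, ha]
        exact f.map_mul s r
      have h2 : F.comp (AddMonoidHom.mulLeft x) = (AddMonoidHom.mulLeft (F x)).comp F := by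
        refine HatCont.ext (hc.comp ((HatCont.id I).mulLeft _)) (hc.mulLeft _) fun s => ?_
        simp only [AddMonoidHom.comp_apply, AddMonoidHom.coe_mulLeft]
        rw [ha]
        exact DFunLike.congr_fun (h1 s) x
      exact DFunLike.congr_fun h2 y }

theorem extRing_algebraMap (I : Ideal R) (J : Ideal S) (f : R →+* AdicCompletion J S)
    (h : I.map f ≤ J.map (algebraMap S (AdicCompletion J S))) (r : R) :
    extRing I J f h (algebraMap R _ r) = f r :=
  extAdd_algebraMap I J (f : R →+ AdicCompletion J S) 0 (ringHom_cont_aux f h) r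

theorem extRing_cont (I : Ideal R) (J : Ideal S) (f : R →+* AdicCompletion J S)
    (h : I.map f ≤ J.map (algebraMap S (AdicCompletion J S))) :
    HatCont I J (extRing I J f h : AdicCompletion I R →+ AdicCompletion J S) :=
  extAdd_cont I J (f : R →+ AdicCompletion J S) 0 (ringHom_cont_aux f h)

/-- A ring homomorphism between completions that maps `I` into the extension of `J` is
continuous if `I` is finitely generated. -/
theorem ringHom_cont {I : Ideal R} {J : Ideal S} (hI : I.FG)
    (F : AdicCompletion I R →+* AdicCompletion J S)
    (h : I.map (F.comp (algebraMap R (AdicCompletion I R))) ≤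
      J.map (algebraMap S (AdicCompletion J S))) :
    HatCont I J (F : AdicCompletion I R →+ AdicCompletion J S) := by
  intro m
  refine ⟨m, fun x hx => ?_⟩
  have hx' : x ∈ (AdicCompletion.eval I R m).ker := by
    rw [LinearMap.mem_ker]
    have e : (I ^ m • ⊤ : Ideal R) = I ^ m := by simp
    apply (Ideal.quotientEquivAlgOfEq R e).injective
    rw [map_zero]
    exact hx
  rw [← AdicCompletion.pow_smul_top_eq_ker_eval hI] at hx'
  have hF := ringHom_cont_aux (F.comp (algebraMap R (AdicCompletion I R))) h m
  refine Submodule.smul_induction_on hx' (fun r hr n _ => ?_) (fun a b ha hb => ?_)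
  · have : F (r • n) = F (algebraMap R _ r) * F n := by
      rw [← map_mul, Algebra.smul_def]
    change AdicCompletion.evalₐ J m (F (r • n)) = 0
    rw [this, map_mul]
    have h0 := hF r hr
    rw [RingHom.comp_apply] at h0
    rw [h0, zero_mul]
  · rw [map_add, map_add, ha, hb, add_zero]

end Completion


section ModuleAlgebras

/-- The structure of a commutative `D`-module algebra on `A`, for a `C`-bialgebra `D`: a `D`-module
structure with `d(1) = ε(d)` and `d(ab) = ∑ d₁(a) d₂(b)`. -/
structure ModuleAlgebra (C D A : Type*) [CommRing C] [Ring D] [Bialgebra C D]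
    [CommRing A] [Algebra C A] where
  act : D →ₗ[C] A →ₗ[C] A
  one_act : ∀ a, act 1 a = a
  mul_act : ∀ d e a, act (d * e) a = act d (act e a)
  act_one : ∀ d, act d 1 = algebraMap C A (Coalgebra.counit (R := C) d)
  act_mul : ∀ d a b, act d (a * b) =
    LinearMap.mul' C A (TensorProduct.map (act.flip a) (act.flip b) (Coalgebra.comul (R := C) d))

variable {C D A : Type*} [CommRing C] [Ring D] [Bialgebra C D] [CommRing A] [Algebra C A]

/-- The restriction of a module algebra structure to a stable subalgebra. -/
def ModuleAlgebra.restrict (M : ModuleAlgebra C D A) (K : Subalgebra C A)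
    (hK : ∀ d, ∀ a ∈ K, M.act d a ∈ K) : ModuleAlgebra C D K where
  act := LinearMap.mk₂ C (fun d a => ⟨M.act d a, hK d a a.2⟩)
    (fun d e a => Subtype.ext (by simp)) (fun c d a => Subtype.ext (by simp))
    (fun d a b => Subtype.ext (by simp)) (fun c d a => Subtype.ext (by simp))
  one_act a := Subtype.ext (M.one_act a)
  mul_act d e a := Subtype.ext (M.mul_act d e a)
  act_one d := Subtype.ext (M.act_one d)
  act_mul d a b := Subtype.ext (by
    refine (M.act_mul d a b).trans ?_
    generalize Coalgebra.comul (R := C) d = x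
    induction x with
    | zero => simp
    | add x y hx hy => rw [map_add, map_add, map_add, map_add, hx, hy]; rfl
    | tmul x y => simp)

/-- The ideal `I` is `D`-stable. -/
def ModuleAlgebra.IsStableIdeal (M : ModuleAlgebra C D A) (I : Ideal A) : Prop :=
  ∀ d, ∀ a ∈ I, M.act d a ∈ I

/-- A commutative module algebra is simple if it is nonzero and has no stable ideals except the
two trivial ones.  (It is Artinian simple if moreover it is an Artinian ring.) -/
def ModuleAlgebra.IsSimple (M : ModuleAlgebra C D A) : Prop :=
  Nontrivial A ∧ ∀ I : Ideal A, M.IsStableIdeal I → I = ⊥ ∨ I = ⊤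

variable (C D A) in
/-- The `A`-algebra `Hom_C(D, A)` with the convolution product.  Its structure map `ρ₀ : A → Hom_C(D, A)`
sends `a` to `d ↦ ε(d) a`. -/
abbrev Conv := WithConv (D →ₗ[C] A)

/-- The homomorphism `ρ : A → Hom_C(D, A)`, `ρ(a)(d) = d(a)`. -/
def ModuleAlgebra.rho (M : ModuleAlgebra C D A) : A →ₐ[C] Conv C D A where
  toFun a := WithConv.toConv (M.act.flip a)
  map_one' := WithConv.ext (LinearMap.ext fun d => M.act_one d)
  map_mul' a b := WithConv.ext (LinearMap.ext fun d => M.act_mul d a b)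
  map_zero' := WithConv.ext (LinearMap.ext fun d => (M.act d).map_zero)
  map_add' a b := WithConv.ext (LinearMap.ext fun d => (M.act d).map_add a b)
  commutes' c := WithConv.ext (LinearMap.ext fun d => by
    change M.act d (algebraMap C A c) = c • algebraMap C A (Coalgebra.counit (R := C) d)
    rw [Algebra.algebraMap_eq_smul_one, map_smul, M.act_one])

variable (A) in
/-- The internal action of `D` on `Hom_C(D, A)`: `(d f)(e) = f(e d)`. -/
def actInt (d : D) : Conv C D A →ₗ[A] Conv C D A where
  toFun f := WithConv.toConv (f.ofConv ∘ₗ LinearMap.mulRight C d)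
  map_add' _ _ := rfl
  map_smul' _ _ := rfl

theorem actInt_apply (d e : D) (f : Conv C D A) : actInt A d f e = f (e * d) := rfl

theorem actInt_rho (M : ModuleAlgebra C D A) (d : D) (a : A) :
    actInt A d (M.rho a) = M.rho (M.act d a) :=
  WithConv.ext (LinearMap.ext fun e => M.mul_act e d a)

theorem actInt_one (d : D) :
    actInt A d (1 : Conv C D A) = Coalgebra.counit (R := C) d • (1 : Conv C D A) :=
  WithConv.ext (LinearMap.ext fun e => by
    change algebraMap C A (Coalgebra.counit (R := C) (e * d)) =
      Coalgebra.counit (R := C) d • algebraMap C A (Coalgebra.counit (R := C) e)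
    rw [Bialgebra.counit_mul, map_mul, Algebra.smul_def, mul_comm])

theorem actInt_mul {ι : Type*} {d : D} (r : Coalgebra.Repr C d ι) (f g : Conv C D A) :
    actInt A d (f * g) = ∑ i ∈ r.index, actInt A (r.left i) f * actInt A (r.right i) g := by
  refine WithConv.ext (LinearMap.ext fun e => ?_)
  rw [WithConv.ofConv_sum, LinearMap.sum_apply]
  change LinearMap.mul' C A (TensorProduct.map f.ofConv g.ofConv
    (Coalgebra.comul (R := C) (e * d))) = ∑ i ∈ r.index, LinearMap.mul' C A (TensorProduct.map
      (actInt A (r.left i) f).ofConv (actInt A (r.right i) g).ofConv (Coalgebra.comul (R := C) e))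
  rw [Bialgebra.comul_mul, ← r.eq, Finset.mul_sum, map_sum, map_sum]
  refine Finset.sum_congr rfl fun i _ => ?_
  generalize Coalgebra.comul (R := C) e = x
  induction x with
  | zero => simp
  | add x y hx hy => rw [add_mul, map_add, map_add, map_add, map_add, hx, hy]
  | tmul x y => simp; rfl

theorem actInt_algebraMap (d : D) (a : A) :
    actInt A d (algebraMap A (Conv C D A) a) =
      algebraMap A (Conv C D A) (algebraMap C A (Coalgebra.counit (R := C) d) * a) :=
  WithConv.ext (LinearMap.ext fun e => by
    change a * algebraMap C A (Coalgebra.counit (R := C) (e * d)) =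
      (algebraMap C A (Coalgebra.counit (R := C) d) * a) *
        algebraMap C A (Coalgebra.counit (R := C) e)
    rw [Bialgebra.counit_mul, map_mul]
    ring)

end ModuleAlgebras

section IterDer

/-- An `n`-variate iterative derivation of `R` over `k`: a homomorphism `θ : R → R[[w₁, …, wₙ]]` of
`k`-algebras, `θ(a) = ∑ θ^{(m)}(a) w^m`, such that `θ^{(0)} = id` and
`θ^{(i)} θ^{(j)} = ((i + j) choose i) θ^{(i + j)}`. -/
structure IterativeDerivation (k R : Type*) [CommRing k] [CommRing R] [Algebra k R] (n : ℕ) where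
  hom : R →ₐ[k] MvPowerSeries (Fin n) R
  coeff_zero : ∀ a, MvPowerSeries.coeff 0 (hom a) = a
  iter : ∀ (i j : Fin n →₀ ℕ) (a : R),
    MvPowerSeries.coeff i (hom (MvPowerSeries.coeff j (hom a))) =
      (∏ s, (i s + j s).choose (i s)) • MvPowerSeries.coeff (i + j) (hom a)

variable {k R : Type*} [CommRing k] [CommRing R] [Algebra k R] {n : ℕ}

/-- The component `θ^{(m)}`. -/
def IterativeDerivation.op (θ : IterativeDerivation k R n) (m : Fin n →₀ ℕ) : R →ₗ[k] R where
  toFun a := MvPowerSeries.coeff m (θ.hom a)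
  map_add' a b := by rw [map_add, map_add]
  map_smul' c a := by
    rw [map_smul, RingHom.id_apply, Algebra.smul_def, MvPowerSeries.algebraMap_apply,
      MvPowerSeries.coeff_C_mul, Algebra.smul_def]

theorem IterativeDerivation.op_mul (θ : IterativeDerivation k R n) (m : Fin n →₀ ℕ) (a b : R) :
    θ.op m (a * b) = ∑ p ∈ Finset.HasAntidiagonal.antidiagonal m, θ.op p.1 a * θ.op p.2 b := by
  change MvPowerSeries.coeff m (θ.hom (a * b)) = _
  rw [map_mul, MvPowerSeries.coeff_mul]
  rfl

variable {C D : Type*} [CommRing C] [Ring D] [Bialgebra C D] [Algebra C k] [Algebra C R]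
  [IsScalarTower C k R]

variable (C D) in
/-- The extension of `θ^{(m)}` to `Hom_C(D, R)`, by composition `f ↦ θ^{(m)} ∘ f`. -/
def IterativeDerivation.convOp (θ : IterativeDerivation k R n) (m : Fin n →₀ ℕ) :
    Conv C D R →ₗ[C] Conv C D R where
  toFun f := WithConv.toConv ((θ.op m).restrictScalars C ∘ₗ f.ofConv)
  map_add' _ _ := WithConv.ext (LinearMap.ext fun _ => (θ.op m).map_add _ _)
  map_smul' c f := WithConv.ext (LinearMap.ext fun d =>
    ((θ.op m).restrictScalars C).map_smul c (f.ofConv d))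

theorem IterativeDerivation.convOp_mul (θ : IterativeDerivation k R n) (m : Fin n →₀ ℕ)
    (f g : Conv C D R) : θ.convOp C D m (f * g) =
      ∑ p ∈ Finset.HasAntidiagonal.antidiagonal m, θ.convOp C D p.1 f * θ.convOp C D p.2 g := by
  refine WithConv.ext (LinearMap.ext fun e => ?_)
  rw [WithConv.ofConv_sum, LinearMap.sum_apply]
  change θ.op m (LinearMap.mul' C R (TensorProduct.map f.ofConv g.ofConv
    (Coalgebra.comul (R := C) e))) = ∑ p ∈ Finset.HasAntidiagonal.antidiagonal m, LinearMap.mul' C R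
      (TensorProduct.map (θ.convOp C D p.1 f).ofConv (θ.convOp C D p.2 g).ofConv
        (Coalgebra.comul (R := C) e))
  generalize Coalgebra.comul (R := C) e = x
  induction x with
  | zero => simp
  | add x y hx hy =>
    simp only [map_add, Finset.sum_add_distrib]
    rw [hx, hy]
  | tmul x y =>
    simp only [TensorProduct.map_tmul, LinearMap.mul'_apply, IterativeDerivation.op_mul]
    rfl

theorem IterativeDerivation.convOp_algebraMap (θ : IterativeDerivation k R n) (m : Fin n →₀ ℕ)
    (a : R) : θ.convOp C D m (algebraMap R (Conv C D R) a) =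
      algebraMap R (Conv C D R) (θ.op m a) := by
  refine WithConv.ext (LinearMap.ext fun e => ?_)
  change θ.op m (a * algebraMap C R (Coalgebra.counit (R := C) e)) =
    θ.op m a * algebraMap C R (Coalgebra.counit (R := C) e)
  rw [mul_comm, ← Algebra.smul_def, mul_comm _ (algebraMap C R _), ← Algebra.smul_def]
  exact ((θ.op m).restrictScalars C).map_smul _ a

theorem IterativeDerivation.convOp_one (θ : IterativeDerivation k R n) (m : Fin n →₀ ℕ) :
    θ.convOp C D m (1 : Conv C D R) = if m = 0 then 1 else 0 := by
  classical
  rw [← map_one (algebraMap R (Conv C D R)), θ.convOp_algebraMap]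
  have : θ.op m (1 : R) = if m = 0 then 1 else 0 := by
    change MvPowerSeries.coeff m (θ.hom 1) = _
    rw [map_one, MvPowerSeries.coeff_one]
  rw [this]
  split_ifs <;> simp

theorem IterativeDerivation.convOp_zero (θ : IterativeDerivation k R n) (f : Conv C D R) :
    θ.convOp C D 0 f = f := WithConv.ext (LinearMap.ext fun _ => θ.coeff_zero _)

theorem actInt_convOp (θ : IterativeDerivation k R n) (m : Fin n →₀ ℕ) (d : D) (f : Conv C D R) :
    actInt R d (θ.convOp C D m f) = θ.convOp C D m (actInt R d f) := rfl

end IterDer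


section Taylor

variable {n : ℕ} {S : Type*} [CommRing S]

theorem multi_vandermonde (p q j : Fin n →₀ ℕ) :
    ∑ x ∈ Finset.HasAntidiagonal.antidiagonal j,
      (∏ s, (p s).choose (x.1 s)) * (∏ s, (q s).choose (x.2 s)) =
    ∏ s, (p s + q s).choose (j s) := by
  classical
  simp_rw [Nat.add_choose_eq, Finset.prod_univ_sum, ← Finset.prod_mul_distrib]
  refine Finset.sum_nbij' (fun x s => (x.1 s, x.2 s))
    (fun k => (Finsupp.equivFunOnFinite.symm fun s => (k s).1,
      Finsupp.equivFunOnFinite.symm fun s => (k s).2)) ?_ ?_ ?_ ?_ ?_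
  · intro x hx
    rw [Finset.HasAntidiagonal.mem_antidiagonal] at hx
    simp [Fintype.mem_piFinset, ← hx]
  · intro k hk
    rw [Fintype.mem_piFinset] at hk
    rw [Finset.HasAntidiagonal.mem_antidiagonal]
    ext s
    simpa using hk s
  · intro x _
    ext <;> simp
  · intro k _
    ext <;> simp
  · intro x _
    rfl

/-- The Hasse derivative `θ_w^{(j)}` of power series, `w^m ↦ (m choose j) w^{m - j}`, i.e. the component
of index `j` of the iterative derivation `f(w) ↦ f(w + t)`. -/
def hasse (j : Fin n →₀ ℕ) (f : MvPowerSeries (Fin n) S) : MvPowerSeries (Fin n) S :=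
  fun m => (∏ s, (m s + j s).choose (j s)) • MvPowerSeries.coeff (m + j) f

theorem coeff_hasse (j m : Fin n →₀ ℕ) (f : MvPowerSeries (Fin n) S) :
    MvPowerSeries.coeff m (hasse j f) =
      (∏ s, (m s + j s).choose (j s)) • MvPowerSeries.coeff (m + j) f := rfl

theorem hasse_zero (f : MvPowerSeries (Fin n) S) : hasse 0 f = f := by
  ext m
  simp [coeff_hasse]

theorem hasse_mul (j : Fin n →₀ ℕ) (f g : MvPowerSeries (Fin n) S) :
    hasse j (f * g) =
      ∑ x ∈ Finset.HasAntidiagonal.antidiagonal j, hasse x.1 f * hasse x.2 g := by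
  classical
  ext m
  rw [coeff_hasse, map_sum, MvPowerSeries.coeff_mul, Finset.smul_sum]
  have h1 : ∀ y ∈ Finset.HasAntidiagonal.antidiagonal (m + j),
      (∏ s, (m s + j s).choose (j s)) • (MvPowerSeries.coeff y.1 f * MvPowerSeries.coeff y.2 g) =
      ∑ x ∈ Finset.HasAntidiagonal.antidiagonal j,
        ((∏ s, (y.1 s).choose (x.1 s)) * (∏ s, (y.2 s).choose (x.2 s))) •
          (MvPowerSeries.coeff y.1 f * MvPowerSeries.coeff y.2 g) := by
    intro y hy
    rw [← Finset.sum_smul, multi_vandermonde]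
    congr 1
    refine Finset.prod_congr rfl fun s _ => ?_
    rw [Finset.HasAntidiagonal.mem_antidiagonal] at hy
    rw [← Finsupp.add_apply, ← hy, Finsupp.add_apply]
  rw [Finset.sum_congr rfl h1, Finset.sum_comm]
  refine Finset.sum_congr rfl fun x hx => ?_
  rw [MvPowerSeries.coeff_mul]
  symm
  rw [Finset.HasAntidiagonal.mem_antidiagonal] at hx
  refine Finset.sum_of_injOn (fun y => (y.1 + x.1, y.2 + x.2)) ?_ ?_ ?_ ?_
  · intro a _ b _ h
    simpa [Prod.ext_iff] using h
  · intro y hy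
    simp only [Finset.mem_coe, Finset.HasAntidiagonal.mem_antidiagonal] at hy ⊢
    rw [← hy, ← hx]
    abel
  · intro y hy hy'
    rw [Finset.HasAntidiagonal.mem_antidiagonal] at hy
    by_cases hle : x.1 ≤ y.1 ∧ x.2 ≤ y.2
    · exfalso
      apply hy'
      refine ⟨(y.1 - x.1, y.2 - x.2), ?_, ?_⟩
      · simp only [Finset.mem_coe, Finset.HasAntidiagonal.mem_antidiagonal]
        have e1 := tsub_add_cancel_of_le hle.1
        have e2 := tsub_add_cancel_of_le hle.2
        have : (y.1 - x.1 + (y.2 - x.2)) + j = m + j := by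
          rw [← hy, ← hx]
          calc y.1 - x.1 + (y.2 - x.2) + (x.1 + x.2)
              = (y.1 - x.1 + x.1) + (y.2 - x.2 + x.2) := add_add_add_comm _ _ _ _
            _ = y.1 + y.2 := by rw [e1, e2]
        exact add_right_cancel this
      · exact Prod.ext (tsub_add_cancel_of_le hle.1) (tsub_add_cancel_of_le hle.2)
    · have : (∏ s, (y.1 s).choose (x.1 s)) * (∏ s, (y.2 s).choose (x.2 s)) = 0 := by
        rw [not_and_or, Finsupp.le_def, Finsupp.le_def] at hle
        push Not at hle
        rcases hle with ⟨s, hs⟩ | ⟨s, hs⟩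
        · rw [Finset.prod_eq_zero (Finset.mem_univ s) (Nat.choose_eq_zero_of_lt hs), zero_mul]
        · rw [Finset.prod_eq_zero (f := fun s => (y.2 s).choose (x.2 s)) (Finset.mem_univ s)
            (Nat.choose_eq_zero_of_lt hs), mul_zero]
      rw [this, zero_smul]
  · intro y _
    simp only [coeff_hasse, Finsupp.add_apply, smul_mul_smul_comm]

/-- The underlying function of `taylor`. -/
def taylorFun (f : MvPowerSeries (Fin n) S) :
    MvPowerSeries (Fin n) (MvPowerSeries (Fin n) S) := fun j => hasse j f

theorem coeff_taylorFun (j : Fin n →₀ ℕ) (f : MvPowerSeries (Fin n) S) :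
    MvPowerSeries.coeff j (taylorFun f) = hasse j f := rfl

/-- The homomorphism `θ_w : S[[w]] → S[[w]][[t]]`, `f(w) ↦ f(w + t)`. -/
def taylor : MvPowerSeries (Fin n) S →+* MvPowerSeries (Fin n) (MvPowerSeries (Fin n) S) where
  toFun := taylorFun
  map_one' := by
    classical
    ext j m
    rw [coeff_taylorFun, coeff_hasse, MvPowerSeries.coeff_one, MvPowerSeries.coeff_one]
    by_cases hj : j = 0
    · subst hj
      simp [MvPowerSeries.coeff_one]
    · have : m + j ≠ 0 := fun h => hj (by simpa using (add_eq_zero.1 h).2)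
      simp [hj, this]
  map_mul' f g := by
    classical
    ext1 j
    rw [MvPowerSeries.coeff_mul, coeff_taylorFun, hasse_mul]
    rfl
  map_zero' := by
    ext j m
    rw [coeff_taylorFun, coeff_hasse]
    simp
  map_add' f g := by
    ext j m
    rw [map_add, map_add]
    simp only [coeff_taylorFun, coeff_hasse, map_add, smul_add]

theorem coeff_taylor (j : Fin n →₀ ℕ) (f : MvPowerSeries (Fin n) S) :
    MvPowerSeries.coeff j (taylor f) = hasse j f := rfl

theorem map_hasse {T : Type*} [CommRing T] (g : S →+* T) (j : Fin n →₀ ℕ)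
    (f : MvPowerSeries (Fin n) S) :
    MvPowerSeries.map g (hasse j f) = hasse j (MvPowerSeries.map g f) := by
  ext m
  simp only [MvPowerSeries.coeff_map, coeff_hasse, map_nsmul]

end Taylor


section Hull

variable {C D k L : Type*} [CommRing C] [Ring D] [Bialgebra C D]
  [CommRing k] [CommRing L] [Algebra C k] [Algebra C L] [Algebra k L] [IsScalarTower C k L] {n : ℕ}

/-- The algebra `𝓛 = ρ₀(L){ρ(L)}_θ` in `Hom_C(D, L)`: the smallest subalgebra that contains `ρ₀(L)` and
`ρ(L)` and is closed under the operators `θ^{(m)}`. -/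
def galoisHull (M : ModuleAlgebra C D L) (θ : IterativeDerivation k L n) :
    Subalgebra L (Conv C D L) :=
  sInf {S | (∀ a, M.rho a ∈ S) ∧ ∀ m, ∀ f ∈ S, θ.convOp C D m f ∈ S}

variable (k) in
/-- The algebra `𝓚 = ρ₀(L)[ρ(k)]` in `Hom_C(D, L)`, generated by `ρ₀(L)` and `ρ(k)`. -/
def galoisBase (M : ModuleAlgebra C D L) : Subalgebra L (Conv C D L) :=
  Algebra.adjoin L (Set.range fun a : k => M.rho (algebraMap k L a))

variable (M : ModuleAlgebra C D L) (θ : IterativeDerivation k L n)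

theorem rho_mem_galoisHull (a : L) : M.rho a ∈ galoisHull M θ :=
  Algebra.mem_sInf.2 fun _ hS => hS.1 a

theorem convOp_mem_galoisHull (m : Fin n →₀ ℕ) {f : Conv C D L} (hf : f ∈ galoisHull M θ) :
    θ.convOp C D m f ∈ galoisHull M θ :=
  Algebra.mem_sInf.2 fun S hS => hS.2 m f (Algebra.mem_sInf.1 hf S hS)

theorem galoisBase_le : galoisBase k M ≤ galoisHull M θ := by
  refine Algebra.adjoin_le ?_
  rintro _ ⟨a, rfl⟩
  exact rho_mem_galoisHull M θ _

theorem actInt_mem_galoisHull (d : D) {f : Conv C D L} (hf : f ∈ galoisHull M θ) :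
    actInt L d f ∈ galoisHull M θ := by
  let T : Subalgebra L (Conv C D L) :=
    { carrier := {f | ∀ d, actInt L d f ∈ galoisHull M θ}
      add_mem' := fun {a b} ha hb d => by
        rw [map_add]
        exact add_mem (ha d) (hb d)
      mul_mem' := fun {a b} ha hb d => by
        rw [actInt_mul (Coalgebra.Repr.arbitrary C d)]
        exact sum_mem fun i _ => mul_mem (ha _) (hb _)
      algebraMap_mem' := fun a d => by
        rw [actInt_algebraMap]
        exact (galoisHull M θ).algebraMap_mem _ }
  have hT : f ∈ T := Algebra.mem_sInf.1 hf T ⟨fun a d => by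
      rw [actInt_rho]
      exact rho_mem_galoisHull M θ _, fun m f hf d => by
      rw [actInt_convOp]
      exact convOp_mem_galoisHull M θ m (hf d)⟩
  exact hT d

/-- The internal action of `d ∈ D` on `𝓛`. -/
def hullAct (d : D) : galoisHull M θ →ₗ[L] galoisHull M θ where
  toFun f := ⟨actInt L d f, actInt_mem_galoisHull M θ d f.2⟩
  map_add' f g := Subtype.ext ((actInt L d).map_add f.1 g.1)
  map_smul' a f := Subtype.ext ((actInt L d).map_smul a f.1)

/-- The operator `θ^{(m)}` on `𝓛`. -/
def hullOp (m : Fin n →₀ ℕ) (f : galoisHull M θ) : galoisHull M θ :=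
  ⟨θ.convOp C D m f, convOp_mem_galoisHull M θ m f.2⟩

end Hull

section Twisted

variable {k L : Type*} [CommRing k] [CommRing L] [Algebra k L] {n : ℕ}

/-- The ring `S[[w]]` as an `L`-algebra through `θ : L → L[[w]] → S[[w]]`. -/
def Tw (_θ : IterativeDerivation k L n) (S : Type*) [CommRing S] [Algebra L S] : Type _ :=
  MvPowerSeries (Fin n) S

variable (θ : IterativeDerivation k L n) (S : Type*) [CommRing S] [Algebra L S]

instance : CommRing (Tw θ S) := inferInstanceAs (CommRing (MvPowerSeries (Fin n) S))

instance : Algebra L (Tw θ S) :=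
  ((MvPowerSeries.map (algebraMap L S)).comp (θ.hom : L →+* MvPowerSeries (Fin n) L)).toAlgebra

/-- The identity, as an isomorphism to the copy of `S[[w]]` with the twisted `L`-algebra structure. -/
def Tw.equiv : MvPowerSeries (Fin n) S ≃+* Tw θ S := RingEquiv.refl _

variable {S} in
theorem Tw.coeff_symm_algebraMap (m : Fin n →₀ ℕ) (a : L) :
    MvPowerSeries.coeff m ((Tw.equiv θ S).symm (algebraMap L (Tw θ S) a)) =
      algebraMap L S (θ.op m a) := rfl

theorem Tw.equiv_symm_algebraMap (a : L) :
    (Tw.equiv θ S).symm (algebraMap L (Tw θ S) a) =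
      MvPowerSeries.map (algebraMap L S) (θ.hom a) := rfl

variable {S} {T : Type*} [CommRing T] [Algebra L T]

/-- The homomorphism `g[[w]] : S[[w]] → T[[w]]`, `g` applied to all coefficients. -/
def Tw.map (g : S →ₐ[L] T) : Tw θ S →ₐ[L] Tw θ T where
  toRingHom := (Tw.equiv θ T : MvPowerSeries (Fin n) T →+* Tw θ T).comp
    ((MvPowerSeries.map (g : S →+* T)).comp ((Tw.equiv θ S).symm : Tw θ S →+* _))
  commutes' a := by
    change MvPowerSeries.map (g : S →+* T) (MvPowerSeries.map (algebraMap L S) (θ.hom a)) =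
      MvPowerSeries.map (algebraMap L T) (θ.hom a)
    rw [← RingHom.comp_apply, ← MvPowerSeries.map_comp, AlgHom.comp_algebraMap]

theorem Tw.map_id (b : Tw θ S) : Tw.map θ (AlgHom.id L S) b = b :=
  DFunLike.congr_fun (MvPowerSeries.map_id (σ := Fin n) (R := S)) ((Tw.equiv θ S).symm b)

/-- The operator `θ_w^{(j)}` on `S[[w]]`. -/
def Tw.hasse (j : Fin n →₀ ℕ) (b : Tw θ S) : Tw θ S :=
  Tw.equiv θ S (UmemuraGalois.hasse j ((Tw.equiv θ S).symm b))

theorem Tw.hasse_algebraMap (j : Fin n →₀ ℕ) (a : L) :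
    Tw.hasse θ j (algebraMap L (Tw θ S) a) = algebraMap L (Tw θ S) (θ.op j a) := by
  apply (Tw.equiv θ S).symm.injective
  ext m
  have h := θ.iter m j a
  rw [Tw.hasse, RingEquiv.symm_apply_apply, coeff_hasse, Tw.coeff_symm_algebraMap,
    Tw.coeff_symm_algebraMap]
  change _ = algebraMap L S (MvPowerSeries.coeff m (θ.hom (MvPowerSeries.coeff j (θ.hom a))))
  rw [h, map_nsmul]
  congr 1
  refine Finset.prod_congr rfl fun s _ => ?_
  rw [← Nat.choose_symm_add]

theorem Tw.map_hasse (g : S →ₐ[L] T) (j : Fin n →₀ ℕ) (b : Tw θ S) :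
    Tw.map θ g (Tw.hasse θ j b) = Tw.hasse θ j (Tw.map θ g b) :=
  UmemuraGalois.map_hasse (g : S →+* T) j ((Tw.equiv θ S).symm b)

end Twisted


section TwistedTensor

variable {k L : Type*} [CommRing k] [CommRing L] [Algebra k L] {n : ℕ}

/-- The tensor product `P ⊗_L A[[w]]`, where `A[[w]]` is an `L`-algebra through `θ`. -/
def TwT (θ : IterativeDerivation k L n) (P A : Type*) [CommRing P] [Algebra L P]
    [CommRing A] [Algebra L A] : Type _ :=
  P ⊗[L] Tw θ A

section TwTBasic

variable (θ : IterativeDerivation k L n) (P A : Type*) [CommRing P] [Algebra L P]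
  [CommRing A] [Algebra L A]

instance : CommRing (TwT θ P A) := inferInstanceAs (CommRing (P ⊗[L] Tw θ A))

instance : Algebra L (TwT θ P A) := inferInstanceAs (Algebra L (P ⊗[L] Tw θ A))

/-- The homomorphism `f ↦ f ⊗ 1`. -/
def TwT.left : P →ₐ[L] TwT θ P A :=
  (Algebra.TensorProduct.includeLeft : P →ₐ[L] P ⊗[L] Tw θ A)

/-- The homomorphism `b ↦ 1 ⊗ b`. -/
def TwT.right : Tw θ A →ₐ[L] TwT θ P A :=
  (Algebra.TensorProduct.includeRight : Tw θ A →ₐ[L] P ⊗[L] Tw θ A)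

variable {P A}

theorem TwT.tmul_eq (p : P) (b : Tw θ A) :
    (p ⊗ₜ[L] b : P ⊗[L] Tw θ A) = (TwT.left θ P A p * TwT.right θ P A b : TwT θ P A) := by
  change _ = ((p ⊗ₜ[L] (1 : Tw θ A)) * ((1 : P) ⊗ₜ[L] b) : P ⊗[L] Tw θ A)
  rw [Algebra.TensorProduct.tmul_mul_tmul, one_mul, mul_one]

theorem TwT.induction {p : TwT θ P A → Prop} (h0 : p 0) (ha : ∀ x y, p x → p y → p (x + y))
    (ht : ∀ f b, p (TwT.left θ P A f * TwT.right θ P A b)) (x : TwT θ P A) : p x :=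
  TensorProduct.induction_on (motive := p) (x : P ⊗[L] Tw θ A) h0
    (fun f b => (congrArg p (TwT.tmul_eq θ f b)).mpr (ht f b)) (fun x y hx hy => ha x y hx hy)

variable {R : Type*} [CommRing R] [Algebra L R]

/-- The homomorphism on the tensor product given by homomorphisms on the factors. -/
def TwT.lift (f : P →ₐ[L] R) (g : Tw θ A →ₐ[L] R) : TwT θ P A →ₐ[L] R :=
  (Algebra.TensorProduct.lift f g fun _ _ => Commute.all _ _ : P ⊗[L] Tw θ A →ₐ[L] R)

theorem TwT.lift_left (f : P →ₐ[L] R) (g : Tw θ A →ₐ[L] R) (p : P) :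
    TwT.lift θ f g (TwT.left θ P A p) = f p := by
  refine (Algebra.TensorProduct.lift_tmul f g (fun _ _ => Commute.all _ _) p 1).trans ?_
  rw [map_one, mul_one]

theorem TwT.lift_right (f : P →ₐ[L] R) (g : Tw θ A →ₐ[L] R) (b : Tw θ A) :
    TwT.lift θ f g (TwT.right θ P A b) = g b := by
  refine (Algebra.TensorProduct.lift_tmul f g (fun _ _ => Commute.all _ _) 1 b).trans ?_
  rw [map_one, one_mul]

/-- `f ⊗ id` for an `L`-linear map `f`. -/
def TwT.lin (f : P →ₗ[L] P) : TwT θ P A →+ TwT θ P A :=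
  (LinearMap.rTensor (Tw θ A) f : P ⊗[L] Tw θ A →ₗ[L] P ⊗[L] Tw θ A).toAddMonoidHom

theorem TwT.lin_apply (f : P →ₗ[L] P) (p : P) (b : Tw θ A) :
    TwT.lin θ f (TwT.left θ P A p * TwT.right θ P A b) =
      TwT.left θ P A (f p) * TwT.right θ P A b := by
  refine ((congrArg (TwT.lin θ f) (TwT.tmul_eq θ p b)).symm).trans ?_
  exact (LinearMap.rTensor_tmul (Tw θ A) f b p).trans (TwT.tmul_eq θ (f p) b)

theorem TwT.lin_mul (f : P →ₗ[L] P) (y : TwT θ P A) (b : Tw θ A) :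
    TwT.lin θ f (y * TwT.right θ P A b) = TwT.lin θ f y * TwT.right θ P A b := by
  refine TwT.induction θ (p := fun y => TwT.lin θ f (y * TwT.right θ P A b) =
    TwT.lin θ f y * TwT.right θ P A b) ?_ (fun y z hy hz => ?_) (fun p c => ?_) y
  · rw [zero_mul, map_zero, zero_mul]
  · rw [add_mul, map_add, map_add, hy, hz, add_mul]
  · rw [mul_assoc, ← map_mul, TwT.lin_apply, TwT.lin_apply, mul_assoc, ← map_mul]

end TwTBasic

/-- The ideal `(w)` of `P ⊗_L A[[w]]`, generated by the elements `1 ⊗ wᵢ`. -/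
def wIdeal (θ : IterativeDerivation k L n) (P A : Type*) [CommRing P] [Algebra L P]
    [CommRing A] [Algebra L A] : Ideal (TwT θ P A) :=
  (Ideal.span (Set.range fun i => Tw.equiv θ A (MvPowerSeries.X i))).map (TwT.right θ P A)

/-- The completion `P ⊗̂_L A[[w]]` of `P ⊗_L A[[w]]` for the `(w)`-adic topology. -/
abbrev Hat (θ : IterativeDerivation k L n) (P A : Type*) [CommRing P] [Algebra L P]
    [CommRing A] [Algebra L A] : Type _ :=
  AdicCompletion (wIdeal θ P A) (TwT θ P A)

variable (θ : IterativeDerivation k L n) {P Q U A B E : Type*} [CommRing P] [Algebra L P]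
  [CommRing Q] [Algebra L Q] [CommRing U] [Algebra L U]
  [CommRing A] [Algebra L A] [CommRing B] [Algebra L B] [CommRing E] [Algebra L E]

theorem wIdeal_fg : (wIdeal θ P A).FG :=
  Ideal.FG.map (Submodule.fg_span (Set.finite_range _)) _

/-- The image of `f ⊗ 1` in the completion. -/
def hatLeft (P A : Type*) [CommRing P] [Algebra L P] [CommRing A] [Algebra L A] :
    P →ₐ[L] Hat θ P A :=
  (Algebra.ofId (TwT θ P A) (Hat θ P A)).restrictScalars L |>.comp
    (TwT.left θ P A)

/-- The image of `1 ⊗ b` in the completion. -/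
def hatRight (P A : Type*) [CommRing P] [Algebra L P] [CommRing A] [Algebra L A] :
    Tw θ A →ₐ[L] Hat θ P A :=
  (Algebra.ofId (TwT θ P A) (Hat θ P A)).restrictScalars L |>.comp
    (TwT.right θ P A)

theorem algebraMap_tmul (f : P) (b : Tw θ A) :
    algebraMap (TwT θ P A) (Hat θ P A) (TwT.left θ P A f * TwT.right θ P A b) =
      hatLeft θ P A f * hatRight θ P A b := by
  rw [map_mul]
  rfl

/-- Continuous additive maps are determined by the values at `f ⊗ b`. -/
theorem hat_ext {R : Type*} [CommRing R] {J : Ideal R} {F G : Hat θ P A →+ AdicCompletion J R}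
    (hF : HatCont _ J F) (hG : HatCont _ J G)
    (h : ∀ f b, F (hatLeft θ P A f * hatRight θ P A b) =
      G (hatLeft θ P A f * hatRight θ P A b)) : F = G := by
  refine hF.ext hG fun r => ?_
  refine TwT.induction θ (p := fun r => F (algebraMap _ _ r) = G (algebraMap _ _ r)) ?_
    (fun x y hx hy => ?_) (fun f b => ?_) r
  · rw [map_zero, map_zero, map_zero]
  · rw [map_add, map_add, map_add, hx, hy]
  · rw [algebraMap_tmul, h]

theorem map_wIdeal_le {R : Type*} [CommRing R] (J : Ideal R)
    (F : TwT θ P A →+* AdicCompletion J R)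
    (h : ∀ i, F (TwT.right θ P A (Tw.equiv θ A (MvPowerSeries.X i))) ∈ J.map (algebraMap R _)) :
    (wIdeal θ P A).map F ≤ J.map (algebraMap R (AdicCompletion J R)) := by
  rw [Ideal.map_le_iff_le_comap, wIdeal, Ideal.map_le_iff_le_comap, Ideal.span_le]
  rintro _ ⟨i, rfl⟩
  exact h i

theorem hatRight_X_mem (i : Fin n) : hatRight θ P A (Tw.equiv θ A (MvPowerSeries.X i)) ∈
    (wIdeal θ P A).map (algebraMap (TwT θ P A) (Hat θ P A)) :=
  Ideal.mem_map_of_mem _ (Ideal.mem_map_of_mem _ (Ideal.subset_span ⟨i, rfl⟩))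

theorem Tw.map_X (g : A →ₐ[L] B) (i : Fin n) :
    Tw.map θ g (Tw.equiv θ A (MvPowerSeries.X i)) = Tw.equiv θ B (MvPowerSeries.X i) :=
  MvPowerSeries.map_X (g : A →+* B) i

/-- A continuous homomorphism from its values on `P` and on `A[[w]]`. -/
def hatLift (f : P →ₐ[L] Hat θ Q B) (g : A →ₐ[L] B) : Hat θ P A →+* Hat θ Q B :=
  extRing _ _ (TwT.lift θ f ((hatRight θ Q B).comp (Tw.map θ g)) :
    TwT θ P A →ₐ[L] Hat θ Q B).toRingHom (by
      refine map_wIdeal_le θ _ _ fun i => ?_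
      have := hatRight_X_mem θ (P := Q) (A := B) i
      rw [← Tw.map_X θ g] at this
      change TwT.lift θ f ((hatRight θ Q B).comp (Tw.map θ g)) _ ∈ _
      rwa [TwT.lift_right])

theorem hatLift_left (f : P →ₐ[L] Hat θ Q B) (g : A →ₐ[L] B) (x : P) :
    hatLift θ f g (hatLeft θ P A x) = f x :=
  (extRing_algebraMap _ _ _ _ _).trans (TwT.lift_left θ f _ x)

theorem hatLift_right (f : P →ₐ[L] Hat θ Q B) (g : A →ₐ[L] B) (b : Tw θ A) :
    hatLift θ f g (hatRight θ P A b) = hatRight θ Q B (Tw.map θ g b) :=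
  (extRing_algebraMap _ _ _ _ _).trans (TwT.lift_right θ f _ b)

theorem hatLift_cont (f : P →ₐ[L] Hat θ Q B) (g : A →ₐ[L] B) :
    HatCont _ _ (hatLift θ f g : Hat θ P A →+ Hat θ Q B) := extRing_cont _ _ _ _

/-- The homomorphism `f ⊗̂ g[[w]] : P ⊗̂_L A[[w]] → Q ⊗̂_L B[[w]]`. -/
def hatMap (f : P →ₐ[L] Q) (g : A →ₐ[L] B) : Hat θ P A →+* Hat θ Q B :=
  hatLift θ ((hatLeft θ Q B).comp f) g

theorem hatMap_left (f : P →ₐ[L] Q) (g : A →ₐ[L] B) (x : P) :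
    hatMap θ f g (hatLeft θ P A x) = hatLeft θ Q B (f x) := hatLift_left θ _ g x

theorem hatMap_right (f : P →ₐ[L] Q) (g : A →ₐ[L] B) (b : Tw θ A) :
    hatMap θ f g (hatRight θ P A b) = hatRight θ Q B (Tw.map θ g b) := hatLift_right θ _ g b

theorem hatMap_cont (f : P →ₐ[L] Q) (g : A →ₐ[L] B) :
    HatCont _ _ (hatMap θ f g : Hat θ P A →+ Hat θ Q B) := hatLift_cont θ _ g

theorem Tw.map_comp_apply (g : A →ₐ[L] B) (h : B →ₐ[L] E) (b : Tw θ A) :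
    Tw.map θ h (Tw.map θ g b) = Tw.map θ (h.comp g) b := by
  exact (DFunLike.congr_fun (MvPowerSeries.map_comp (σ := Fin n) (g : A →+* B) (h : B →+* E))
    ((Tw.equiv θ A).symm b)).symm

theorem hatMap_hatMap (f : P →ₐ[L] Q) (g : A →ₐ[L] B) (f' : Q →ₐ[L] U) (g' : B →ₐ[L] E)
    (x : Hat θ P A) : hatMap θ f' g' (hatMap θ f g x) = hatMap θ (f'.comp f) (g'.comp g) x := by
  have := hat_ext θ ((hatMap_cont θ f' g').comp (hatMap_cont θ f g))
    (hatMap_cont θ (f'.comp f) (g'.comp g)) (fun p b => by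
      simp only [AddMonoidHom.comp_apply, AddMonoidHom.coe_coe, map_mul, hatMap_left,
        hatMap_right, Tw.map_comp_apply, AlgHom.comp_apply])
  exact DFunLike.congr_fun this x

/-- The continuous extension of `f ⊗ id` to `P ⊗̂_L A[[w]]`, for an `L`-linear map `f`. -/
def hatLin (f : P →ₗ[L] P) : Hat θ P A →+ Hat θ P A :=
  extAdd _ _ ((algebraMap (TwT θ P A) (Hat θ P A) : TwT θ P A →+ Hat θ P A).comp
    (TwT.lin θ f)) 0 (by
      intro m x hx
      change AdicCompletion.evalₐ _ m (algebraMap _ _ (TwT.lin θ f x)) = 0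
      rw [evala_algebraMap, Ideal.Quotient.eq_zero_iff_mem]
      have hx' : x ∈ Ideal.map (TwT.right θ P A)
          ((Ideal.span (Set.range fun i => Tw.equiv θ A (MvPowerSeries.X i))) ^ m) := by
        rw [Ideal.map_pow]
        exact hx
      have key : ∀ y : TwT θ P A, TwT.lin θ f (y * x) ∈ wIdeal θ P A ^ m := by
        refine Submodule.span_induction (p := fun x _ => ∀ y : TwT θ P A,
          TwT.lin θ f (y * x) ∈ wIdeal θ P A ^ m) ?_ ?_ ?_ ?_ hx'
        · rintro _ ⟨b, hb, rfl⟩ y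
          have := TwT.lin_mul θ f y b
          refine (congrArg (· ∈ wIdeal θ P A ^ m) this).mpr ?_
          refine Ideal.mul_mem_left _ _ ?_
          rw [wIdeal, ← Ideal.map_pow]
          exact Ideal.mem_map_of_mem _ hb
        · intro y
          rw [mul_zero, map_zero]
          exact zero_mem _
        · intro a b _ _ ha hb y
          rw [mul_add, map_add]
          exact add_mem (ha y) (hb y)
        · intro r a _ ha y
          rw [smul_eq_mul, ← mul_assoc]
          exact ha _
      have := key 1
      rwa [one_mul] at this)

theorem hatLin_mul (f : P →ₗ[L] P) (p : P) (b : Tw θ A) :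
    hatLin θ f (hatLeft θ P A p * hatRight θ P A b) =
      hatLeft θ P A (f p) * hatRight θ P A b := by
  rw [← algebraMap_tmul, ← algebraMap_tmul, ← TwT.lin_apply]
  exact extAdd_algebraMap _ _ _ _ _ _

theorem hatLin_left (f : P →ₗ[L] P) (p : P) :
    hatLin θ f (hatLeft θ P A p) = hatLeft θ P A (f p) := by
  have := hatLin_mul θ f p (1 : Tw θ A)
  rwa [map_one, mul_one, mul_one] at this

theorem hatLin_cont (f : P →ₗ[L] P) : HatCont _ _ (hatLin θ f : Hat θ P A →+ Hat θ P A) :=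
  extAdd_cont _ _ _ _ _

theorem hatLin_hatMap (f : P →ₗ[L] P) (g : A →ₐ[L] B) (x : Hat θ P A) :
    hatLin θ f (hatMap θ (AlgHom.id L P) g x) = hatMap θ (AlgHom.id L P) g (hatLin θ f x) := by
  have := hat_ext θ ((hatLin_cont θ f).comp (hatMap_cont θ (AlgHom.id L P) g))
    ((hatMap_cont θ (AlgHom.id L P) g).comp (hatLin_cont θ f)) (fun p b => by
      simp only [AddMonoidHom.comp_apply, AddMonoidHom.coe_coe, map_mul, hatMap_left,
        hatMap_right, hatLin_mul, AlgHom.id_apply])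
  exact DFunLike.congr_fun this x

theorem hatLin_mul_right (f : P →ₗ[L] P) (x : Hat θ P A) (b : Tw θ A) :
    hatLin θ f (x * hatRight θ P A b) = hatLin θ f x * hatRight θ P A b := by
  have := hat_ext θ ((hatLin_cont θ f).comp ((HatCont.id _).mulRight (hatRight θ P A b)))
    ((hatLin_cont θ f).mulRight (hatRight θ P A b)) (fun p c => by
      simp only [AddMonoidHom.comp_apply, AddMonoidHom.coe_mulRight, AddMonoidHom.id_apply]
      rw [mul_assoc, ← map_mul, hatLin_mul, hatLin_mul, mul_assoc, ← map_mul])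
  exact DFunLike.congr_fun this x

end TwistedTensor


section TensorTheta

variable {k L : Type*} [CommRing k] [CommRing L] [Algebra k L] {n : ℕ}
variable (θ : IterativeDerivation k L n) {P Q A B : Type*} [CommRing P] [Algebra L P]
  [CommRing Q] [Algebra L Q] [CommRing A] [Algebra L A] [CommRing B] [Algebra L B]

/-- The homomorphism `A[[w]] → (P ⊗_L A[[w]])[[t]]`, `b ↦ ∑ (1 ⊗ θ_w^{(j)}(b)) t^j`. -/
def twTaylor (P A : Type*) [CommRing P] [Algebra L P] [CommRing A] [Algebra L A] :
    Tw θ A →ₐ[L] Tw θ (TwT θ P A) where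
  toRingHom := (Tw.equiv θ (TwT θ P A) : MvPowerSeries (Fin n) (TwT θ P A) →+* _).comp
    ((MvPowerSeries.map ((TwT.right θ P A : Tw θ A →+* TwT θ P A).comp (Tw.equiv θ A : MvPowerSeries (Fin n) A →+* Tw θ A))).comp
      (taylor.comp ((Tw.equiv θ A).symm : Tw θ A →+* MvPowerSeries (Fin n) A)))
  commutes' a := by
    apply (Tw.equiv θ (TwT θ P A)).symm.injective
    ext j
    rw [Tw.coeff_symm_algebraMap]
    change TwT.right θ P A (Tw.hasse θ j (algebraMap L (Tw θ A) a)) = _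
    rw [Tw.hasse_algebraMap, AlgHom.commutes]

theorem coeff_twTaylor (j : Fin n →₀ ℕ) (b : Tw θ A) :
    MvPowerSeries.coeff j ((Tw.equiv θ (TwT θ P A)).symm (twTaylor θ P A b)) =
      TwT.right θ P A (Tw.hasse θ j b) := rfl

/-- The homomorphism `P ⊗_L A[[w]] → (P ⊗_L A[[w]])[[t]]` given by `δ : P → P[[t]]` and by
`θ_w : A[[w]] → A[[w]][[t]]`. -/
def twTheta (δ : P →ₐ[L] Tw θ P) : TwT θ P A →ₐ[L] Tw θ (TwT θ P A) :=
  TwT.lift θ ((Tw.map θ (TwT.left θ P A)).comp δ) (twTaylor θ P A)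

/-- The operator `θ^{(m)}` on `P ⊗_L A[[w]]`, `f ⊗ b ↦ ∑_{i + j = m} δ^{(i)}(f) ⊗ θ_w^{(j)}(b)`. -/
def twOp (δ : P →ₐ[L] Tw θ P) (m : Fin n →₀ ℕ) : TwT θ P A →+ TwT θ P A where
  toFun x := MvPowerSeries.coeff m ((Tw.equiv θ (TwT θ P A)).symm (twTheta θ δ x))
  map_zero' := by simp
  map_add' x y := by simp

theorem twOp_mul (δ : P →ₐ[L] Tw θ P) (m : Fin n →₀ ℕ) (x y : TwT θ P A) :
    twOp θ δ m (x * y) =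
      ∑ p ∈ Finset.HasAntidiagonal.antidiagonal m, twOp θ δ p.1 x * twOp θ δ p.2 y := by
  classical
  change MvPowerSeries.coeff m ((Tw.equiv θ (TwT θ P A)).symm (twTheta θ δ (x * y))) = _
  rw [map_mul, map_mul, MvPowerSeries.coeff_mul]
  rfl

theorem twOp_left (δ : P →ₐ[L] Tw θ P) (m : Fin n →₀ ℕ) (p : P) :
    twOp θ δ m (TwT.left θ P A p) =
      TwT.left θ P A (MvPowerSeries.coeff m ((Tw.equiv θ P).symm (δ p))) := by
  change MvPowerSeries.coeff m ((Tw.equiv θ (TwT θ P A)).symm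
    (twTheta θ δ (TwT.left θ P A p))) = _
  rw [twTheta, TwT.lift_left]
  rfl

theorem twOp_right (δ : P →ₐ[L] Tw θ P) (m : Fin n →₀ ℕ) (b : Tw θ A) :
    twOp θ δ m (TwT.right θ P A b) = TwT.right θ P A (Tw.hasse θ m b) := by
  change MvPowerSeries.coeff m ((Tw.equiv θ (TwT θ P A)).symm
    (twTheta θ δ (TwT.right θ P A b))) = _
  rw [twTheta, TwT.lift_right]
  rfl

/-- The degree `|m|` of a multi-index. -/
def deg (m : Fin n →₀ ℕ) : ℕ := ∑ s, m s

theorem deg_add (a b : Fin n →₀ ℕ) : deg (a + b) = deg a + deg b := by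
  simp [deg, Finset.sum_add_distrib]

theorem twOp_mem (δ : P →ₐ[L] Tw θ P) (N : ℕ) (x : TwT θ P A)
    (hx : x ∈ wIdeal θ P A ^ N) (m : Fin n →₀ ℕ) :
    twOp θ δ m x ∈ wIdeal θ P A ^ (N - deg m) := by
  have hmul : ∀ (N M : ℕ) (x y : TwT θ P A),
      (∀ m, twOp θ δ m x ∈ wIdeal θ P A ^ (N - deg m)) →
      (∀ m, twOp θ δ m y ∈ wIdeal θ P A ^ (M - deg m)) →
      ∀ m, twOp θ δ m (x * y) ∈ wIdeal θ P A ^ (N + M - deg m) := by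
    intro N M x y hx hy m
    rw [twOp_mul]
    refine sum_mem fun p hp => ?_
    have h := Ideal.mul_mem_mul (hx p.1) (hy p.2)
    rw [← pow_add] at h
    rw [Finset.HasAntidiagonal.mem_antidiagonal] at hp
    refine Ideal.pow_le_pow_right ?_ h
    rw [← hp, deg_add]
    omega
  have h0 : ∀ (y : TwT θ P A) m, twOp θ δ m y ∈ wIdeal θ P A ^ (0 - deg m) := by
    intro y m
    rw [Nat.zero_sub, pow_zero, Ideal.one_eq_top]
    trivial
  have h1 : ∀ y ∈ wIdeal θ P A, ∀ m, twOp θ δ m y ∈ wIdeal θ P A ^ (1 - deg m) := by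
    intro y hy
    rw [wIdeal, Ideal.map_span] at hy
    refine Submodule.span_induction (p := fun y _ => ∀ m,
      twOp θ δ m y ∈ wIdeal θ P A ^ (1 - deg m)) ?_ ?_ ?_ ?_ hy
    · rintro _ ⟨_, ⟨i, rfl⟩, rfl⟩ m
      by_cases hm : deg m = 0
      · have : m = 0 := by
          ext s
          exact (Finset.sum_eq_zero_iff.1 hm) s (Finset.mem_univ s)
        subst this
        have e := twOp_right θ δ (A := A) 0 (Tw.equiv θ A (MvPowerSeries.X i))
        rw [Tw.hasse, RingEquiv.symm_apply_apply, hasse_zero] at e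
        rw [hm, Nat.sub_zero, pow_one]
        refine Eq.mpr (congrArg (· ∈ wIdeal θ P A) e) ?_
        exact Ideal.mem_map_of_mem _ (Ideal.subset_span ⟨i, rfl⟩)
      · rw [Nat.sub_eq_zero_of_le (Nat.one_le_iff_ne_zero.2 hm), pow_zero, Ideal.one_eq_top]
        trivial
    · intro m
      rw [map_zero]
      exact zero_mem _
    · intro a b _ _ ha hb m
      rw [map_add]
      exact add_mem (ha m) (hb m)
    · intro r a _ ha m
      have := hmul 0 1 r a (h0 r) ha m
      rwa [zero_add] at this
  induction N generalizing x m with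
  | zero => exact h0 x m
  | succ N ih =>
    rw [pow_succ] at hx
    refine Submodule.mul_induction_on hx (fun a ha b hb => ?_) (fun a b ha hb => ?_)
    · exact hmul N 1 a b (ih a ha) (h1 b hb) m
    · rw [map_add]
      exact add_mem ha hb

/-- The continuous extension of the operator `θ^{(m)}` to `P ⊗̂_L A[[w]]`. -/
def hatOp (δ : P →ₐ[L] Tw θ P) (m : Fin n →₀ ℕ) : Hat θ P A →+ Hat θ P A :=
  extAdd _ _ ((algebraMap (TwT θ P A) (Hat θ P A) : TwT θ P A →+ Hat θ P A).comp
    (twOp θ δ m)) (deg m) (by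
      intro N x hx
      change AdicCompletion.evalₐ _ N (algebraMap _ _ (twOp θ δ m x)) = 0
      rw [evala_algebraMap, Ideal.Quotient.eq_zero_iff_mem]
      have := twOp_mem θ δ _ x hx m
      rwa [Nat.add_sub_cancel] at this)

theorem hatOp_cont (δ : P →ₐ[L] Tw θ P) (m : Fin n →₀ ℕ) :
    HatCont _ _ (hatOp θ δ m : Hat θ P A →+ Hat θ P A) := extAdd_cont _ _ _ _ _

theorem hatOp_algebraMap (δ : P →ₐ[L] Tw θ P) (m : Fin n →₀ ℕ) (x : TwT θ P A) :
    hatOp θ δ m (algebraMap _ (Hat θ P A) x) = algebraMap _ _ (twOp θ δ m x) :=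
  extAdd_algebraMap _ _ _ _ _ _

theorem hatOp_left (δ : P →ₐ[L] Tw θ P) (m : Fin n →₀ ℕ) (p : P) :
    hatOp θ δ m (hatLeft θ P A p) =
      hatLeft θ P A (MvPowerSeries.coeff m ((Tw.equiv θ P).symm (δ p))) := by
  refine (hatOp_algebraMap θ δ m _).trans ?_
  exact congrArg _ (twOp_left θ δ m p)

theorem hatOp_mul (δ : P →ₐ[L] Tw θ P) (m : Fin n →₀ ℕ) (x : Hat θ P A) (b : Tw θ A) :
    hatOp θ δ m (x * hatRight θ P A b) = ∑ p ∈ Finset.HasAntidiagonal.antidiagonal m,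
      hatOp θ δ p.1 x * hatRight θ P A (Tw.hasse θ p.2 b) := by
  have := HatCont.ext ((hatOp_cont θ δ m).comp ((HatCont.id _).mulRight (hatRight θ P A b)))
    (HatCont.sum (Finset.HasAntidiagonal.antidiagonal m) fun p =>
      (hatOp_cont θ δ p.1).mulRight (hatRight θ P A (Tw.hasse θ p.2 b))) (fun r => by
      simp only [AddMonoidHom.comp_apply, AddMonoidHom.coe_mulRight, AddMonoidHom.id_apply,
        AddMonoidHom.finsetSum_apply]
      have e : ∀ c, hatRight θ P A c = algebraMap _ (Hat θ P A) (TwT.right θ P A c) := fun _ => rfl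
      rw [e, ← map_mul, hatOp_algebraMap, twOp_mul, map_sum]
      refine Finset.sum_congr rfl fun p _ => ?_
      rw [hatOp_algebraMap, e, ← map_mul, twOp_right])
  refine (DFunLike.congr_fun this x).trans ?_
  simp only [AddMonoidHom.comp_apply, AddMonoidHom.coe_mulRight, AddMonoidHom.finsetSum_apply]

theorem hatOp_hatMap (δ : P →ₐ[L] Tw θ P) (m : Fin n →₀ ℕ) (g : A →ₐ[L] B) (x : Hat θ P A) :
    hatOp θ δ m (hatMap θ (AlgHom.id L P) g x) =
      hatMap θ (AlgHom.id L P) g (hatOp θ δ m x) := by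
  have := hat_ext θ ((hatOp_cont θ δ m).comp (hatMap_cont θ (AlgHom.id L P) g))
    ((hatMap_cont θ (AlgHom.id L P) g).comp (hatOp_cont θ δ m)) (fun p b => by
      simp only [AddMonoidHom.comp_apply, AddMonoidHom.coe_coe, map_mul, hatMap_left,
        hatMap_right, hatOp_mul, hatOp_left, AlgHom.id_apply, map_sum, Tw.map_hasse])
  exact DFunLike.congr_fun this x

end TensorTheta


section Automorphisms

variable {k L : Type*} [CommRing k] [CommRing L] [Algebra k L] {n : ℕ}
  (θ : IterativeDerivation k L n) {P Q ι : Type*} [CommRing P] [Algebra L P]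
  [CommRing Q] [Algebra L Q] (δ : P →ₐ[L] Tw θ P) (act : ι → P →ₗ[L] P) (inc : Q →ₐ[L] P)

/-- The group of the automorphisms `φ` of the ring `P ⊗̂_L A[[w]]` which commute with the operators
`act d ⊗̂ id` and with all `θ^{(m)}`, fix (the image of) `Q ⊗̂_L A[[w]]` and are compatible with the
projection `id ⊗̂ π_A[[w]]` to `P ⊗̂_L (A/N(A))[[w]]`. -/
def AutGroup (A : Type*) [CommRing A] [Algebra L A] : Subgroup (RingAut (Hat θ P A)) where
  carrier := {φ | (∀ d x, φ (hatLin θ (act d) x) = hatLin θ (act d) (φ x)) ∧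
    (∀ m x, φ (hatOp θ δ m x) = hatOp θ δ m (φ x)) ∧
    (∀ y : Hat θ Q A, φ (hatMap θ inc (AlgHom.id L A) y) = hatMap θ inc (AlgHom.id L A) y) ∧
    ∀ x, hatMap θ (AlgHom.id L P) (Ideal.Quotient.mkₐ L (nilradical A)) (φ x) =
      hatMap θ (AlgHom.id L P) (Ideal.Quotient.mkₐ L (nilradical A)) x}
  one_mem' := ⟨fun _ _ => rfl, fun _ _ => rfl, fun _ => rfl, fun _ => rfl⟩
  mul_mem' := fun {φ ψ} hφ hψ => ⟨fun d x => by
      rw [RingAut.mul_apply, RingAut.mul_apply, hψ.1, hφ.1], fun m x => by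
      rw [RingAut.mul_apply, RingAut.mul_apply, hψ.2.1, hφ.2.1], fun y => by
      rw [RingAut.mul_apply, hψ.2.2.1, hφ.2.2.1], fun x => by
      rw [RingAut.mul_apply, hφ.2.2.2, hψ.2.2.2]⟩
  inv_mem' := fun {φ} hφ => by
    have h1 : ∀ x, φ (φ⁻¹ x) = x := fun x => RingEquiv.apply_symm_apply φ x
    have h2 : ∀ x, φ⁻¹ (φ x) = x := fun x => RingEquiv.symm_apply_apply φ x
    refine ⟨fun d x => ?_, fun m x => ?_, fun y => ?_, fun x => ?_⟩
    · apply φ.injective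
      rw [h1, hφ.1, h1]
    · apply φ.injective
      rw [h1, hφ.2.1, h1]
    · apply φ.injective
      rw [h1, hφ.2.2.1]
    · rw [← hφ.2.2.2 (φ⁻¹ x), h1]

variable {A B E : Type*} [CommRing A] [Algebra L A] [CommRing B] [Algebra L B] [CommRing E] [Algebra L E]
variable {θ δ act inc}

theorem AutGroup.fix_right (φ : AutGroup θ δ act inc A) (b : Tw θ A) :
    φ.1 (hatRight θ _ A b) = hatRight θ _ A b := by
  have := φ.2.2.2.1 (hatRight θ _ A b)
  rw [hatMap_right] at this
  rwa [Tw.map_id] at this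

theorem AutGroup.fix_base (φ : AutGroup θ δ act inc A) (q : Q) :
    φ.1 (hatLeft θ P A (inc q)) = hatLeft θ P A (inc q) := by
  have := φ.2.2.2.1 (hatLeft θ Q A q)
  rwa [hatMap_left] at this

theorem AutGroup.cont (φ : AutGroup θ δ act inc A) :
    HatCont _ _ ((φ.1 : Hat θ P A →+* Hat θ P A) : Hat θ P A →+ Hat θ P A) := by
  refine ringHom_cont (wIdeal_fg θ) _ (map_wIdeal_le θ _ _ fun i => ?_)
  have := hatRight_X_mem θ (P := P) (A := A) i
  rw [← AutGroup.fix_right φ] at this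
  exact this

/-- The homomorphism `P → P ⊗̂_L B[[w]]`, `f ↦ (id ⊗̂ g[[w]])(φ(f ⊗ 1))`. -/
def autLeft (g : A →ₐ[L] B) (φ : AutGroup θ δ act inc A) : P →ₐ[L] Hat θ P B where
  toRingHom := (hatMap θ (AlgHom.id L P) g).comp
    ((φ.1 : Hat θ P A →+* Hat θ P A).comp
      ((hatLeft θ P A : P →+* Hat θ P A)))
  commutes' a := by
    change hatMap θ (AlgHom.id L P) g (φ.1 (hatLeft θ _ A (algebraMap L _ a))) = _
    rw [← AlgHom.commutes inc, AutGroup.fix_base, hatMap_left, AlgHom.id_apply, AlgHom.commutes,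
      AlgHom.commutes]

/-- The endomorphism `φ ⊗̂_{A[[w]]} id` of `P ⊗̂_L B[[w]]`, where `B[[w]]` is an `A[[w]]`-algebra through
`g[[w]]`: the continuous homomorphism of `B[[w]]`-algebras that sends `f ⊗ 1` to
`(id ⊗̂ g[[w]])(φ(f ⊗ 1))`. -/
def autExt (g : A →ₐ[L] B) (φ : AutGroup θ δ act inc A) : Hat θ P B →+* Hat θ P B :=
  hatLift θ (autLeft g φ) (AlgHom.id L B)

theorem autExt_cont (g : A →ₐ[L] B) (φ : AutGroup θ δ act inc A) :
    HatCont _ _ (autExt g φ : Hat θ P B →+ Hat θ P B) := hatLift_cont θ _ _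

theorem autExt_left (g : A →ₐ[L] B) (φ : AutGroup θ δ act inc A) (f : P) :
    autExt g φ (hatLeft θ _ B f) = hatMap θ (AlgHom.id L P) g (φ.1 (hatLeft θ _ A f)) :=
  hatLift_left θ _ _ f

theorem autExt_right (g : A →ₐ[L] B) (φ : AutGroup θ δ act inc A) (b : Tw θ B) :
    autExt g φ (hatRight θ _ B b) = hatRight θ _ B b := by
  refine (hatLift_right θ _ _ b).trans (congrArg _ ?_)
  exact Tw.map_id θ b

theorem autExt_hatMap (g : A →ₐ[L] B) (φ : AutGroup θ δ act inc A) (x : Hat θ P A) :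
    autExt g φ (hatMap θ (AlgHom.id L P) g x) = hatMap θ (AlgHom.id L P) g (φ.1 x) := by
  have := hat_ext θ ((autExt_cont g φ).comp (hatMap_cont θ (AlgHom.id L P) g))
    ((hatMap_cont θ (AlgHom.id L P) g).comp (AutGroup.cont φ)) (fun p b => by
      simp only [AddMonoidHom.comp_apply, AddMonoidHom.coe_coe, map_mul, hatMap_left,
        hatMap_right, AlgHom.id_apply, autExt_left, autExt_right, RingHom.coe_coe,
        AutGroup.fix_right])
  exact DFunLike.congr_fun this x

/-- `autExt g φ` is the only continuous endomorphism that is compatible with `φ`. -/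
theorem autExt_unique (g : A →ₐ[L] B) (φ : AutGroup θ δ act inc A) (F : Hat θ P B →+ Hat θ P B)
    (hF : HatCont _ _ F)
    (h : ∀ f b, F (hatLeft θ _ B f * hatRight θ _ B b) =
      hatMap θ (AlgHom.id L P) g (φ.1 (hatLeft θ _ A f)) * hatRight θ _ B b) (x : Hat θ P B) :
    autExt g φ x = F x := by
  have := hat_ext θ hF (autExt_cont g φ) (fun p b => by
      rw [h, AddMonoidHom.coe_coe, map_mul, autExt_left, autExt_right])
  exact (DFunLike.congr_fun this x).symm

theorem autExt_one (g : A →ₐ[L] B) (x : Hat θ P B) : autExt g (1 : AutGroup θ δ act inc A) x = x := by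
  refine autExt_unique g (1 : AutGroup θ δ act inc A) (AddMonoidHom.id _) (HatCont.id _) (fun f b => ?_) x
  rw [OneMemClass.coe_one, RingAut.one_apply, hatMap_left, AlgHom.id_apply, AddMonoidHom.id_apply]

theorem autExt_mul (g : A →ₐ[L] B) (φ ψ : AutGroup θ δ act inc A) (x : Hat θ P B) :
    autExt g (φ * ψ) x = autExt g φ (autExt g ψ x) := by
  refine autExt_unique g (φ * ψ) ((autExt g φ : Hat θ P B →+ Hat θ P B).comp
    (autExt g ψ : Hat θ P B →+ Hat θ P B)) ((autExt_cont g φ).comp (autExt_cont g ψ))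
    (fun f b => ?_) x
  rw [AddMonoidHom.comp_apply, AddMonoidHom.coe_coe, AddMonoidHom.coe_coe, map_mul, map_mul,
    autExt_left, autExt_right, autExt_right, autExt_hatMap, Subgroup.coe_mul, RingAut.mul_apply]

/-- `φ ⊗̂_{A[[w]]} id` as an automorphism. -/
def autEquiv (g : A →ₐ[L] B) (φ : AutGroup θ δ act inc A) : RingAut (Hat θ P B) :=
  RingEquiv.ofRingHom (autExt g φ) (autExt g φ⁻¹)
    (RingHom.ext fun x => by
      rw [RingHom.comp_apply, ← autExt_mul, mul_inv_cancel, autExt_one, RingHom.id_apply])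
    (RingHom.ext fun x => by
      rw [RingHom.comp_apply, ← autExt_mul, inv_mul_cancel, autExt_one, RingHom.id_apply])

theorem autEquiv_apply (g : A →ₐ[L] B) (φ : AutGroup θ δ act inc A) (x : Hat θ P B) :
    autEquiv g φ x = autExt g φ x := rfl

theorem autEquiv_mem (g : A →ₐ[L] B) (φ : AutGroup θ δ act inc A) : autEquiv g φ ∈ AutGroup θ δ act inc B := by
  refine ⟨fun d x => ?_, fun m x => ?_, fun y => ?_, fun x => ?_⟩
  · have := hat_ext θ ((autExt_cont g φ).comp (hatLin_cont θ (act d)))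
      ((hatLin_cont θ (act d)).comp (autExt_cont g φ)) (fun p b => by
        simp only [AddMonoidHom.comp_apply, AddMonoidHom.coe_coe, map_mul, hatLin_left,
          autExt_left, autExt_right, hatLin_mul_right, hatLin_hatMap]
        rw [← φ.2.1, hatLin_left])
    exact DFunLike.congr_fun this x
  · have := hat_ext θ ((autExt_cont g φ).comp (hatOp_cont θ δ m))
      ((hatOp_cont θ δ m).comp (autExt_cont g φ)) (fun p b => by
        simp only [AddMonoidHom.comp_apply, AddMonoidHom.coe_coe, hatOp_mul, map_mul, map_sum,
          autExt_left, autExt_right, hatOp_left, hatOp_hatMap]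
        refine Finset.sum_congr rfl fun q _ => ?_
        rw [← φ.2.2.1, hatOp_left])
    exact DFunLike.congr_fun this x
  · have := hat_ext θ ((autExt_cont g φ).comp (hatMap_cont θ
        inc (AlgHom.id L B)))
      (hatMap_cont θ inc (AlgHom.id L B)) (fun p b => by
        simp only [AddMonoidHom.comp_apply, AddMonoidHom.coe_coe, map_mul, hatMap_left,
          hatMap_right, autExt_left, autExt_right]
        rw [AutGroup.fix_base, hatMap_left, AlgHom.id_apply])
    exact DFunLike.congr_fun this y
  · have := hat_ext θ ((hatMap_cont θ (AlgHom.id L P)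
        (Ideal.Quotient.mkₐ L (nilradical B))).comp (autExt_cont g φ))
      (hatMap_cont θ (AlgHom.id L P)
        (Ideal.Quotient.mkₐ L (nilradical B))) (fun p b => by
        have hle : nilradical A ≤ (nilradical B).comap g := fun a ha =>
          mem_nilradical.2 ((mem_nilradical.1 ha).map g)
        have hg : (Ideal.Quotient.mkₐ L (nilradical B)).comp g =
            (Ideal.quotientMapₐ (nilradical B) g hle).comp
              (Ideal.Quotient.mkₐ L (nilradical A)) := rfl
        have hπ := congrArg (hatMap θ (AlgHom.id L P)
          (Ideal.quotientMapₐ (nilradical B) g hle)) (φ.2.2.2.2 (hatLeft θ _ A p))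
        rw [hatMap_hatMap, hatMap_left, hatMap_left, AlgHom.comp_id, ← hg] at hπ
        simp only [AddMonoidHom.comp_apply, AddMonoidHom.coe_coe, map_mul, hatMap_left,
          autExt_left, autExt_right, hatMap_hatMap, AlgHom.comp_id]
        rw [hπ]
        rfl)
    exact DFunLike.congr_fun this x

variable (δ act inc) in
/-- The homomorphism `φ ↦ φ ⊗̂_{A[[w]]} id` of automorphism groups. -/
def autMap (g : A →ₐ[L] B) : AutGroup θ δ act inc A →* AutGroup θ δ act inc B where
  toFun φ := ⟨autEquiv g φ, autEquiv_mem g φ⟩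
  map_one' := Subtype.ext (RingEquiv.ext fun x => autExt_one g x)
  map_mul' φ ψ := Subtype.ext (RingEquiv.ext fun x => autExt_mul g φ ψ x)

theorem autMap_id (φ : AutGroup θ δ act inc A) : autMap δ act inc (AlgHom.id L A) φ = φ := by
  refine Subtype.ext (RingEquiv.ext fun x => ?_)
  have e : ∀ y : Hat θ P A, hatMap θ (AlgHom.id L P) (AlgHom.id L A) y = y := by
    intro y
    refine DFunLike.congr_fun (hat_ext θ (hatMap_cont θ (AlgHom.id L P) (AlgHom.id L A))
      (HatCont.id _) fun p b => ?_) y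
    rw [AddMonoidHom.coe_coe, map_mul, hatMap_left, hatMap_right, AlgHom.id_apply,
      AddMonoidHom.id_apply, Tw.map_id]
  refine autExt_unique (AlgHom.id L A) φ
    ((φ.1 : Hat θ P A →+* Hat θ P A) : Hat θ P A →+ Hat θ P A) (AutGroup.cont φ) (fun f b => ?_) x
  rw [e, AddMonoidHom.coe_coe, RingHom.coe_coe, map_mul, AutGroup.fix_right]

theorem autMap_comp (g : A →ₐ[L] B) (h : B →ₐ[L] E) (φ : AutGroup θ δ act inc A) :
    autMap δ act inc (h.comp g) φ = autMap δ act inc h (autMap δ act inc g φ) := by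
  refine Subtype.ext (RingEquiv.ext fun x => ?_)
  refine autExt_unique (h.comp g) φ
    ((autExt h (autMap δ act inc g φ) : Hat θ P E →+* Hat θ P E) : Hat θ P E →+ Hat θ P E)
    (autExt_cont h (autMap δ act inc g φ)) (fun f b => ?_) x
  have : (autMap δ act inc g φ).1 (hatLeft θ _ B f) = autExt g φ (hatLeft θ _ B f) := rfl
  rw [AddMonoidHom.coe_coe, map_mul, autExt_left, autExt_right, this, autExt_left, hatMap_hatMap,
    AlgHom.comp_id]

end Automorphisms


section Umemura

open CategoryTheory

variable {C D k L : Type*} [CommRing C] [Ring D] [Bialgebra C D]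
  [CommRing k] [CommRing L] [Algebra C k] [Algebra C L] [Algebra k L] [IsScalarTower C k L] {n : ℕ}
  (M : ModuleAlgebra C D L) (θ : IterativeDerivation k L n)

/-- The power series `∑ θ^{(m)}(f) t^m` over `𝓛`. -/
def hullSeries (f : galoisHull M θ) : MvPowerSeries (Fin n) (galoisHull M θ) :=
  fun m => hullOp M θ m f

theorem coeff_hullSeries (f : galoisHull M θ) (m : Fin n →₀ ℕ) :
    MvPowerSeries.coeff m (hullSeries M θ f) = hullOp M θ m f := rfl

variable [Coalgebra.IsCocomm C D]

/-- The homomorphism `𝓛 → 𝓛[[t]]`, `f ↦ ∑ θ^{(m)}(f) t^m`. -/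
def hullTheta : galoisHull M θ →ₐ[L] Tw θ (galoisHull M θ) where
  toFun f := Tw.equiv θ _ (hullSeries M θ f)
  map_one' := by
    classical
    rw [← map_one (Tw.equiv θ _)]
    congr 1
    ext1 m
    rw [coeff_hullSeries, MvPowerSeries.coeff_one]
    refine Subtype.ext ((θ.convOp_one m).trans ?_)
    split_ifs <;> rfl
  map_mul' f g := by
    classical
    rw [← map_mul (Tw.equiv θ _)]
    congr 1
    ext1 m
    rw [MvPowerSeries.coeff_mul]
    refine Subtype.ext ((θ.convOp_mul m _ _).trans ?_)
    rw [AddSubmonoidClass.coe_finsetSum]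
    rfl
  map_zero' := by
    rw [← map_zero (Tw.equiv θ _)]
    congr 1
    ext1 m
    exact Subtype.ext (map_zero (θ.convOp C D m))
  map_add' f g := by
    rw [← map_add (Tw.equiv θ _)]
    congr 1
    ext1 m
    exact Subtype.ext (map_add (θ.convOp C D m) _ _)
  commutes' a := by
    apply (Tw.equiv θ _).symm.injective
    ext1 m
    rw [RingEquiv.symm_apply_apply, coeff_hullSeries, Tw.coeff_symm_algebraMap]
    exact Subtype.ext (θ.convOp_algebraMap m a)


end Umemura

section Functor

open CategoryTheory

variable {C D : Type*} {k : Type*} {L : Type w} [CommRing C] [Ring D] [Bialgebra C D]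
  [Coalgebra.IsCocomm C D] [CommRing k] [CommRing L] [Algebra C k] [Algebra C L] [Algebra k L]
  [IsScalarTower C k L] {n : ℕ}

/-- The Umemura functor of `L` over `k`, from commutative `L`-algebras to groups.  To `A` it assigns the
group of the automorphisms `φ` of `𝓛 ⊗̂_L A[[w]]` that commute with the action of `D` and with the
iterative derivation, leave `𝓚 ⊗̂_L A[[w]]` fixed and induce the identity modulo the nilradical of
`A`; to a homomorphism `A → B` it assigns `φ ↦ φ ⊗̂_{A[[w]]} id_{B[[w]]}`. -/
def Ume (M : ModuleAlgebra C D L) (θ : IterativeDerivation k L n) : CommAlgCat.{v} L ⥤ GrpCat where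
  obj A := GrpCat.of (AutGroup θ (hullTheta M θ) (hullAct M θ)
    (Subalgebra.inclusion (galoisBase_le M θ)) A)
  map f := GrpCat.ofHom (autMap (hullTheta M θ) (hullAct M θ)
    (Subalgebra.inclusion (galoisBase_le M θ)) f.hom)
  map_id A := by
    apply GrpCat.hom_ext
    exact MonoidHom.ext fun φ => autMap_id φ
  map_comp f g := by
    apply GrpCat.hom_ext
    exact MonoidHom.ext fun φ => autMap_comp f.hom g.hom φ

end Functor


section LieRitt

variable (n : ℕ) (A : Type*) [CommRing A]

/-- The infinitesimal coordinate transformations of `n` variables over `A`: the `n`-tuples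
`Φ = (φ₁, …, φₙ)` in `A[[w]]` with `φᵢ ≡ wᵢ` modulo `N(A)[[w]]`, where `N(A)` is the nilradical. -/
def Gamma : Type _ :=
  {Φ : Fin n → MvPowerSeries (Fin n) A //
    ∀ i m, MvPowerSeries.coeff m (Φ i - MvPowerSeries.X i) ∈ nilradical A}

variable {n A}

theorem mem_gamma_iff (Φ : Fin n → MvPowerSeries (Fin n) A) :
    (∀ i m, MvPowerSeries.coeff m (Φ i - MvPowerSeries.X i) ∈ nilradical A) ↔
      ∀ i, MvPowerSeries.map (Ideal.Quotient.mk (nilradical A)) (Φ i) = MvPowerSeries.X i := by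
  refine forall_congr' fun i => ?_
  rw [← sub_eq_zero, ← MvPowerSeries.map_X (Ideal.Quotient.mk (nilradical A)) i, ← map_sub,
    MvPowerSeries.ext_iff]
  refine forall_congr' fun m => ?_
  rw [MvPowerSeries.coeff_map, map_zero, Ideal.Quotient.eq_zero_iff_mem]

theorem Gamma.hasSubst (Φ : Gamma n A) : MvPowerSeries.HasSubst Φ.1 := by
  refine MvPowerSeries.hasSubst_of_constantCoeff_nilpotent fun i => ?_
  have := Φ.2 i 0
  rw [map_sub, MvPowerSeries.coeff_zero_X, sub_zero] at this
  exact this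

theorem Gamma.ext {Φ Ψ : Gamma n A} (h : ∀ i, Φ.1 i = Ψ.1 i) : Φ = Ψ :=
  Subtype.ext (funext h)

instance : One (Gamma n A) := ⟨⟨MvPowerSeries.X, fun i m => by
  rw [sub_self, map_zero]
  exact zero_mem _⟩⟩

/-- The composition `Φ · Ψ = (φ₁(Ψ), …, φₙ(Ψ))`. -/
instance : Mul (Gamma n A) := ⟨fun Φ Ψ => ⟨fun i => MvPowerSeries.subst Ψ.1 (Φ.1 i),
  (mem_gamma_iff _).2 fun i => by
    rw [MvPowerSeries.map_subst Ψ.hasSubst, (mem_gamma_iff _).1 Φ.2 i]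
    have : (fun j => MvPowerSeries.map (Ideal.Quotient.mk (nilradical A)) (Ψ.1 j)) =
        MvPowerSeries.X := funext fun j => (mem_gamma_iff _).1 Ψ.2 j
    rw [this, MvPowerSeries.subst_self, id]⟩⟩

theorem Gamma.one_val (i : Fin n) : (1 : Gamma n A).1 i = MvPowerSeries.X i := rfl

theorem Gamma.mul_val (Φ Ψ : Gamma n A) (i : Fin n) :
    (Φ * Ψ).1 i = MvPowerSeries.subst Ψ.1 (Φ.1 i) := rfl

instance : Monoid (Gamma n A) where
  mul_assoc Φ Ψ X := Gamma.ext fun i => by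
    rw [Gamma.mul_val, Gamma.mul_val, Gamma.mul_val,
      MvPowerSeries.subst_comp_subst_apply Ψ.hasSubst X.hasSubst]
    rfl
  one_mul Φ := Gamma.ext fun i => MvPowerSeries.subst_X Φ.hasSubst i
  mul_one Φ := Gamma.ext fun i => congrFun MvPowerSeries.subst_self (Φ.1 i)

variable {B : Type*} [CommRing B]

/-- The map `Γ_n(A) → Γ_n(B)` induced by a ring homomorphism `A → B`, applied to all coefficients. -/
def Gamma.map (g : A →+* B) (Φ : Gamma n A) : Gamma n B :=
  ⟨fun i => MvPowerSeries.map g (Φ.1 i), fun i m => by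
    rw [← MvPowerSeries.map_X g i, ← map_sub, MvPowerSeries.coeff_map, mem_nilradical]
    exact IsNilpotent.map (Φ.2 i m) g⟩

variable (n) (L : Type*) [CommRing L]

/-- The ring `L[[w]]{L[[Y]]}_θ` of iterative differential power series in the differential
indeterminates `Y₁, …, Yₙ`, i.e. the iterative differential subring generated by `L[[w, Y]]` inside
`L[[w]][[Y_i^{(k)} | 1 ≤ i ≤ n, k ∈ ℕⁿ]]`, where `θ` acts on `L[[w]]` by the Hasse derivatives and
`θ^{(l)}(Y_i^{(k)}) = ((k + l) choose k) Y_i^{(k + l)}`, `Y_i = Y_i^{(0)}`.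

By the chain rule, `θ^{(l)}(F)`, for `F ∈ L[[w, Y]]`, is the coefficient of `t^l` in
`F(w + t, Y + ∑_{k ≠ 0} Y^{(k)} t^k)`, a polynomial in the `Y_i^{(k)}` with `k ≠ 0` whose
coefficients lie in `L[[w, Y]]`.  Hence this subring is the polynomial ring over `L[[w, Y]]` in the
algebraically independent elements `Y_i^{(k)}`, `k ≠ 0`, and this is how it is written down here;
the variables `Sum.inl i` and `Sum.inr i` of the power series ring are `wᵢ` and `Yᵢ`. -/
abbrev DiffPowerSeries : Type _ :=
  MvPolynomial {p : Fin n × (Fin n →₀ ℕ) // p.2 ≠ 0} (MvPowerSeries (Fin n ⊕ Fin n) L)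

variable {n L} [Algebra L A]

theorem Gamma.hasSubst_elim (Φ : Gamma n A) :
    MvPowerSeries.HasSubst (Sum.elim MvPowerSeries.X Φ.1 :
      Fin n ⊕ Fin n → MvPowerSeries (Fin n) A) := by
  refine MvPowerSeries.hasSubst_of_constantCoeff_nilpotent ?_
  rintro (i | i)
  · rw [Sum.elim_inl, MvPowerSeries.constantCoeff_X]
    exact IsNilpotent.zero
  · exact Φ.hasSubst.const_coeff i

variable (L) in
/-- The evaluation `F ↦ F|_{Y = Φ}`, which maps the coefficients from `L` to `A`, fixes each `wᵢ`
and sends `Y_i^{(k)}` to `θ^{(k)}(φᵢ)`, the `k`-th Hasse derivative of `φᵢ`. -/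
def Gamma.eval (Φ : Gamma n A) : DiffPowerSeries n L →+* MvPowerSeries (Fin n) A :=
  MvPolynomial.eval₂Hom
    (MvPowerSeries.substAlgHom (R := L) Φ.hasSubst_elim :
      MvPowerSeries (Fin n ⊕ Fin n) L →+* MvPowerSeries (Fin n) A)
    (fun p => hasse p.1.2 (Φ.1 p.1.1))

/-- The set `Z(I)(A)` of the transformations `Φ ∈ Γ_n(A)` that solve all iterative differential
equations in the ideal `I`. -/
def zeroLocus (I : Ideal (DiffPowerSeries n L)) (A : Type*) [CommRing A] [Algebra L A] :
    Set (Gamma n A) :=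
  {Φ | ∀ F ∈ I, Φ.eval L F = 0}

end LieRitt

section LieRittFunctor

open CategoryTheory

variable {L : Type*} [CommRing L]

/-- A group functor `G` on commutative `L`-algebras is a Lie-Ritt functor, in `n` variables, if there
is an ideal `I` of `L[[w]]{L[[Y]]}_θ` such that `G(A)` is identified with `Z(I)(A)`, compatibly with
the group law, which is the composition of transformations in `Γ_n(A)`, and naturally in `A`. -/
def IsLieRittFunctor (n : ℕ) (G : CommAlgCat.{v} L ⥤ GrpCat.{w}) : Prop :=
  ∃ (I : Ideal (DiffPowerSeries n L)) (η : ∀ A : CommAlgCat.{v} L, G.obj A →* Gamma n A),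
    (∀ A, Function.Injective (η A)) ∧ (∀ A, Set.range (η A) = zeroLocus I A) ∧
    ∀ (A B : CommAlgCat.{v} L) (f : A ⟶ B) (x : G.obj A),
      η B ((G.map f).hom x) = Gamma.map (f.hom : A →+* B) (η A x)

end LieRittFunctor


section ResidueFields

/-- A family `x` is a separating transcendence basis of the field extension `E | F`. -/
def IsSeparatingTranscendenceBasis (F E : Type*) [Field F] [Field E] [Algebra F E] {ι : Type*}
    (x : ι → E) : Prop :=
  IsTranscendenceBasis F x ∧ Algebra.IsSeparable (IntermediateField.adjoin F (Set.range x)) E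

variable {L : Type*} [CommRing L] [IsArtinianRing L] (K : Type*) [CommRing K] [IsArtinianRing K]
  [Algebra K L] {n : ℕ}

attribute [local instance] Ideal.Quotient.field

/-- All residue field extensions `L/Q` over `K/(K ∩ Q)` are separable (i.e. geometrically reduced)
and finitely generated, and their transcendence degree is `n`.  In an Artinian ring every prime
ideal is minimal and maximal. -/
def HasResidueExtensions (L : Type*) [CommRing L] [IsArtinianRing L] [Algebra K L] (n : ℕ) : Prop :=
  ∀ (Q : Ideal L) [Q.IsPrime],
    Algebra.IsGeometricallyReduced (K ⧸ Q.under K) (L ⧸ Q) ∧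
    (⊤ : IntermediateField (K ⧸ Q.under K) (L ⧸ Q)).FG ∧
    Algebra.trdeg (K ⧸ Q.under K) (L ⧸ Q) = n

/-- The tuple `u` in `L ≅ ∏ L/Q` is made up of separating transcendence bases `u^Q` of `L/Q` over
`K/(K ∩ Q)`, for all `Q`. -/
def IsResidueBasis (u : Fin n → L) : Prop :=
  ∀ (Q : Ideal L) [Q.IsPrime], IsSeparatingTranscendenceBasis (K ⧸ Q.under K) (L ⧸ Q)
    (fun i => Ideal.Quotient.mk Q (u i))

/-- `θ` is the iterative derivation `θ_u` over `K` that satisfies `θ_u(uᵢ) = uᵢ + wᵢ`. -/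
def IterativeDerivation.IsAssociated {k R : Type*} [CommRing k] [CommRing R] [Algebra k R] {n : ℕ}
    (θ : IterativeDerivation k R n) (u : Fin n → R) : Prop :=
  ∀ i, θ.hom (u i) = MvPowerSeries.C (u i) + MvPowerSeries.X i

end ResidueFields

end
end UmemuraGalois

/-!
# The Umemura functor is a Lie–Ritt functor

Simple module algebras over `D = H # CG` are reduced: the divided powers of the Birkhoff–Witt
coalgebra `H` act as the coefficients of a homomorphism `a ↦ ∑ b_α(a) x^α` to a power series ring,
and elements of `G` act by ring endomorphisms, so the nilradical is `D`-stable.  Hence `K` and `L` are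
finite products of fields.  Separating transcendence bases of the residue fields exist by MacLane's
criterion, and a residue basis `u` makes `L` formally étale, and essentially of finite type, over the
polynomial ring `K[X₁, …, Xₙ]`.  This gives `θ_u`, as a lift of `L → L[[w]] / (w)`, and the rigidity
statement `ringHom_ext_of_isResidueBasis`: two homomorphisms on `L` that agree on `K` and `u` and are
congruent modulo the Jacobson radical of the target are equal.

The completed tensor product `𝓛 ⊗̂_L A[[w]]` is studied through the continuous maps
`f ⊗ b ↦ θ(f(d)) b` to `A[[w]]`, for `d ∈ D` (`evalHat`).  Since `L` is semisimple, all `L`-modules are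
projective, so these maps are jointly injective (`hat_ext_of_evalHat`).  To an automorphism `φ` one
attaches the transformation `Φ` with components `φ(ρ(uᵢ))(1) - uᵢ` (`gammaOfAut`).  By rigidity
`φ(ρ(a))(1) = θ(a)(Φ)` for all `a ∈ L`, and this determines `φ` on `ρ(L)`: `φ(ρ(a))` is the Taylor
expansion `∑ θ^{(m)}(ρ(a)) ⊗ (Φ - w)^m` (`aut_hullRho`).  It follows that `φ ↦ Φ` is injective,
multiplicative and natural.

For the image, the polynomial relations between the generators `θ^{(m)}(ρ(a))` of `𝓛` have to be
preserved when `ρ(a)` is replaced by its Taylor expansion along `Φ`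
(`Gamma.IsCompatible`).  In terms of the evaluations these conditions are iterative differential
equations for `Φ` (`exists_eval_eq_evalHat_hatPres`).  Conversely, a compatible `Φ` defines an
endomorphism of `𝓛 ⊗̂_L A[[w]]` that is the identity modulo the nilradical of `A`, and therefore
injective (`eq_zero_of_hatLift_eq_zero`).  Applying it to the relations shows that the inverse
transformation, which exists in `Γ_n(A)` (`Gamma.exists_mul_eq_one`), is compatible as well, so
that the endomorphism is an automorphism (`Gamma.IsCompatible.exists_aut`).  The ideal of all
equations satisfied by the transformations of automorphisms thus cuts out exactly the image.
-/

namespace UmemuraGalois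
noncomputable section

/-! ### Power series in finitely many variables and the adic topology -/

section PowerSeries

open MvPowerSeries

variable {n : ℕ} {R : Type*} [CommRing R]

variable (n R) in
/-- The ideal `(w₁, …, wₙ)` of `R[[w]]`. -/
abbrev varIdeal : Ideal (MvPowerSeries (Fin n) R) := Ideal.span (Set.range X)

theorem coeff_mem_of_mem_pow {σ B : Type*} [CommRing B] (I : Ideal B) (J : Ideal (MvPowerSeries σ B))
    (hJ : ∀ x ∈ J, constantCoeff x ∈ I) (N : ℕ) (x : MvPowerSeries σ B) (hx : x ∈ J ^ N)
    (m : σ →₀ ℕ) : coeff m x ∈ I ^ (N - m.degree) := by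
  classical
  induction N generalizing x m with
  | zero => simp
  | succ N ih =>
    rw [pow_succ] at hx
    refine Submodule.mul_induction_on hx (fun a ha b hb => ?_) fun a b ha hb => ?_
    · rw [coeff_mul]
      refine sum_mem fun p hp => ?_
      rw [Finset.HasAntidiagonal.mem_antidiagonal] at hp
      have hb' : coeff p.2 b ∈ I ^ (1 - p.2.degree) := by
        by_cases h0 : p.2 = 0
        · rw [h0]
          simpa using hJ b hb
        · have : 1 ≤ p.2.degree := Nat.one_le_iff_ne_zero.2 fun h => h0 ((Finsupp.degree_eq_zero_iff _).1 h)
          simp [Nat.sub_eq_zero_of_le this]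
      have h := Ideal.mul_mem_mul (ih a ha p.1) hb'
      rw [← pow_add] at h
      refine Ideal.pow_le_pow_right ?_ h
      rw [← hp, map_add]
      omega
    · rw [map_add]
      exact add_mem ha hb

theorem constantCoeff_mem_span {σ B ι : Type*} [CommRing B] (b : ι → MvPowerSeries σ B)
    (x : MvPowerSeries σ B) (hx : x ∈ Ideal.span (Set.range b)) :
    constantCoeff x ∈ Ideal.span (Set.range fun i => constantCoeff (b i)) := by
  have := Ideal.mem_map_of_mem (constantCoeff (σ := σ) (R := B)) hx
  rwa [Ideal.map_span, ← Set.range_comp] at this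

/-- For the nontrivial implication, `R[[w]]` is identified with the completion of the polynomial ring,
where the kernels of the projections are known. -/
theorem mem_varIdeal_pow_iff (N : ℕ) (g : MvPowerSeries (Fin n) R) :
    g ∈ varIdeal n R ^ N ↔ ∀ m, m.degree < N → coeff m g = 0 := by
  constructor
  · intro hg m hm
    have h := coeff_mem_of_mem_pow (⊥ : Ideal R) (varIdeal n R) (fun x hx => by
      have := constantCoeff_mem_span _ x hx
      refine (Ideal.span_le (I := ⊥)).2 ?_ this
      rintro _ ⟨i, rfl⟩
      simp) N g hg m
    have h0 : N - m.degree ≠ 0 := by omega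
    rw [← Ideal.zero_eq_bot, zero_pow h0] at h
    simpa using h
  · intro h
    let e := toAdicCompletionAlgEquiv (Fin n) R
    have h1 : e g ∈ (AdicCompletion.eval (MvPolynomial.idealOfVars (Fin n) R)
        (MvPolynomial (Fin n) R) N).ker := by
      rw [LinearMap.mem_ker]
      change (toAdicCompletion (Fin n) R g).val N = 0
      rw [toAdicCompletion_apply_eq_mk_truncTotal]
      have : truncTotal N g = 0 := by
        ext m
        by_cases hm : m.degree < N
        · rw [coeff_truncTotal _ hm, h m hm, MvPolynomial.coeff_zero]
        · rw [coeff_truncTotal_eq_zero _ (not_lt.1 hm), MvPolynomial.coeff_zero]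
      rw [this, map_zero]
    rw [← AdicCompletion.pow_smul_top_eq_ker_eval (MvPolynomial.idealOfVars_fg _ _)] at h1
    have h2 : ∀ y ∈ (MvPolynomial.idealOfVars (Fin n) R ^ N • ⊤ : Submodule (MvPolynomial (Fin n) R)
        (AdicCompletion (MvPolynomial.idealOfVars (Fin n) R) (MvPolynomial (Fin n) R))),
        e.symm y ∈ varIdeal n R ^ N := by
      intro y hy
      refine Submodule.smul_induction_on hy (fun r hr z _ => ?_) fun a b ha hb => ?_
      · rw [map_smul, Algebra.smul_def]
        refine Ideal.mul_mem_right _ _ ?_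
        have := Ideal.mem_map_of_mem (algebraMap (MvPolynomial (Fin n) R)
          (MvPowerSeries (Fin n) R)) hr
        rw [Ideal.map_pow, Ideal.map_span, ← Set.range_comp] at this
        have hX : (algebraMap (MvPolynomial (Fin n) R) (MvPowerSeries (Fin n) R)) ∘
            MvPolynomial.X = X := by
          ext1 i
          simp [MvPowerSeries.algebraMap_apply']
        rwa [hX] at this
      · rw [map_add]
        exact add_mem ha hb
    have := h2 _ h1
    rwa [AlgEquiv.symm_apply_apply] at this

theorem exists_polynomial_sub_mem (N : ℕ) (g : MvPowerSeries (Fin n) R) :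
    ∃ p : MvPolynomial (Fin n) R, g - (p : MvPowerSeries (Fin n) R) ∈ varIdeal n R ^ N := by
  refine ⟨truncTotal N g, (mem_varIdeal_pow_iff N _).2 fun m hm => ?_⟩
  rw [map_sub, MvPolynomial.coeff_coe, coeff_truncTotal _ hm, sub_self]

theorem eq_of_forall_sub_mem {g h : MvPowerSeries (Fin n) R}
    (H : ∀ N, g - h ∈ varIdeal n R ^ N) : g = h := by
  ext m
  have := (mem_varIdeal_pow_iff _ _).1 (H (m.degree + 1)) m (Nat.lt_succ_self _)
  rwa [map_sub, sub_eq_zero] at this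

/-- Two ring homomorphisms on `R[[w]]` that agree on the constants and on the variables agree if the
images of the variables generate an ideal for whose adic topology the target is separated.  No
continuity has to be assumed. -/
theorem ringHom_ext_of_iInf {B : Type*} [CommRing B] (F G : MvPowerSeries (Fin n) R →+* B)
    (hC : ∀ r, F (C r) = G (C r)) (hX : ∀ i, F (X i) = G (X i))
    (hB : ∀ b : B, (∀ N, b ∈ Ideal.span (Set.range fun i => F (X i)) ^ N) → b = 0) : F = G := by
  have hp : ∀ p : MvPolynomial (Fin n) R, F p = G p := by
    intro p
    have : F.comp (MvPolynomial.coeToMvPowerSeries.ringHom) =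
        G.comp (MvPolynomial.coeToMvPowerSeries.ringHom) :=
      MvPolynomial.ringHom_ext (fun r => by simpa using hC r) (fun i => by simpa using hX i)
    simpa using RingHom.congr_fun this p
  refine RingHom.ext fun g => sub_eq_zero.1 (hB _ fun N => ?_)
  obtain ⟨p, hg⟩ := exists_polynomial_sub_mem N g
  have h1 := Ideal.mem_map_of_mem F hg
  have h2 := Ideal.mem_map_of_mem G hg
  rw [Ideal.map_pow, Ideal.map_span, ← Set.range_comp, map_sub] at h1 h2
  have e : (⇑G ∘ X : Fin n → B) = fun i => F (X i) := funext fun i => (hX i).symm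
  rw [e, ← hp] at h2
  have := sub_mem h1 h2
  rwa [sub_sub_sub_cancel_right] at this

theorem isNilpotent_span_range {ι : Type*} [Finite ι] {c : ι → R} (hc : ∀ i, IsNilpotent (c i)) :
    ∃ d, Ideal.span (Set.range c) ^ d = ⊥ :=
  (Ideal.FG.isNilpotent_iff_le_nilradical (Submodule.fg_span (Set.finite_range c))).2
    (Ideal.span_le.2 (by rintro _ ⟨i, rfl⟩; exact hc i))

/-- If an ideal of `R[[w]]` has constant coefficients in a nilpotent ideal then its powers tend to
zero. -/
theorem pow_le_varIdeal_pow (I : Ideal R) (J : Ideal (MvPowerSeries (Fin n) R))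
    (hJ : ∀ x ∈ J, constantCoeff x ∈ I) {d : ℕ} (hd : I ^ d = ⊥) (M : ℕ) :
    J ^ (M + d) ≤ varIdeal n R ^ M := by
  intro x hx
  refine (mem_varIdeal_pow_iff M x).2 fun m hm => ?_
  have := coeff_mem_of_mem_pow I J hJ _ x hx m
  have h2 := Ideal.pow_le_pow_right (I := I) (show d ≤ M + d - m.degree by omega) this
  rwa [hd] at h2

theorem exists_pow_le_varIdeal_pow {ι : Type*} [Finite ι] {b : ι → MvPowerSeries (Fin n) R}
    (hb : ∀ i, IsNilpotent (constantCoeff (b i))) :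
    ∃ d, ∀ M, Ideal.span (Set.range b) ^ (M + d) ≤ varIdeal n R ^ M := by
  obtain ⟨d, hd⟩ := isNilpotent_span_range hb
  exact ⟨d, pow_le_varIdeal_pow _ _ (constantCoeff_mem_span b) hd⟩

/-- Homomorphisms between power series rings over `R` that agree on constants and variables are equal
if the images of the variables have nilpotent constant coefficients. -/
theorem ringHom_ext_of_isNilpotent {p : ℕ} {S : Type*} [CommRing S]
    (F G : MvPowerSeries (Fin p) R →+* MvPowerSeries (Fin n) S)
    (hC : ∀ r, F (C r) = G (C r)) (hX : ∀ i, F (X i) = G (X i))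
    (hn : ∀ i, IsNilpotent (constantCoeff (F (X i)))) : F = G := by
  refine ringHom_ext_of_iInf F G hC hX fun b hb => ?_
  obtain ⟨d, hd⟩ := exists_pow_le_varIdeal_pow hn
  exact eq_of_forall_sub_mem fun N => by simpa using hd N (hb (N + d))

/-- The same for the target `S[[w]][[t]]`. -/
theorem ringHom_ext_of_isNilpotent₂ {p q : ℕ} {S : Type*} [CommRing S]
    (F G : MvPowerSeries (Fin p) R →+* MvPowerSeries (Fin q) (MvPowerSeries (Fin n) S))
    (hC : ∀ r, F (C r) = G (C r)) (hX : ∀ i, F (X i) = G (X i))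
    (hn : ∀ i, IsNilpotent (constantCoeff (constantCoeff (F (X i))))) : F = G := by
  refine ringHom_ext_of_iInf F G hC hX fun b hb => ?_
  obtain ⟨d, hd⟩ := exists_pow_le_varIdeal_pow hn
  ext1 m
  refine eq_of_forall_sub_mem fun N => ?_
  have := coeff_mem_of_mem_pow _ _ (constantCoeff_mem_span _) _ b (hb (N + d + m.degree)) m
  rw [Nat.add_sub_cancel] at this
  simpa using hd N this

end PowerSeries

/-! ### Taylor expansion -/

section TaylorExpansion

open MvPowerSeries

variable {n : ℕ} {R : Type*} [CommRing R]

theorem taylor_C (r : R) : taylor (C r : MvPowerSeries (Fin n) R) = C (C r) := by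
  classical
  ext j m
  rw [coeff_taylor, coeff_hasse, coeff_C, coeff_C]
  by_cases hj : j = 0
  · subst hj
    simp [coeff_C]
  · have : m + j ≠ 0 := fun h => hj (by simpa using (add_eq_zero.1 h).2)
    simp [hj, this]

theorem taylor_X (i : Fin n) : taylor (X i : MvPowerSeries (Fin n) R) = C (X i) + X i := by
  classical
  ext1 j
  rw [coeff_taylor, map_add, coeff_C, coeff_X]
  by_cases hj : j = 0
  · subst hj
    have : (0 : Fin n →₀ ℕ) ≠ Finsupp.single i 1 := fun h => by
      simpa using DFunLike.congr_fun h i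
    rw [hasse_zero, if_pos rfl, if_neg this, add_zero]
  · rw [if_neg hj, zero_add]
    ext1 m
    rw [coeff_hasse, coeff_X]
    by_cases h : m + j = Finsupp.single i 1
    · have h1 := congrArg Finsupp.degree h
      rw [map_add, Finsupp.degree_single] at h1
      have h2 : j.degree ≠ 0 := fun h => hj ((Finsupp.degree_eq_zero_iff _).1 h)
      have h3 : m = 0 := (Finsupp.degree_eq_zero_iff _).1 (by omega)
      subst h3
      rw [zero_add] at h
      simp [h]
    · rw [if_neg h, smul_zero]
      split_ifs with h1
      · have : m ≠ 0 := by
          rintro rfl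
          exact h (by rw [zero_add, h1])
        rw [coeff_one, if_neg this]
      · rw [map_zero]

theorem hasse_mem_varIdeal_pow (K : ℕ) (g : MvPowerSeries (Fin n) R) (hg : g ∈ varIdeal n R ^ K)
    (m : Fin n →₀ ℕ) : hasse m g ∈ varIdeal n R ^ (K - m.degree) := by
  rw [mem_varIdeal_pow_iff] at hg ⊢
  intro l hl
  rw [coeff_hasse, hg _ (by rw [map_add]; omega), smul_zero]

/-- A polynomial over `R[[w]]` whose coefficients are the Hasse derivatives of a polynomial. -/
def taylorPoly : MvPolynomial (Fin n) R →+* MvPolynomial (Fin n) (MvPowerSeries (Fin n) R) :=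
  MvPolynomial.eval₂Hom (MvPolynomial.C.comp (C (σ := Fin n)))
    (fun i => MvPolynomial.C (X i) + MvPolynomial.X i)

theorem coeff_taylorPoly (p : MvPolynomial (Fin n) R) (m : Fin n →₀ ℕ) :
    (taylorPoly p).coeff m = hasse m (p : MvPowerSeries (Fin n) R) := by
  have : (MvPolynomial.coeToMvPowerSeries.ringHom.comp taylorPoly :
      MvPolynomial (Fin n) R →+* _) = taylor.comp MvPolynomial.coeToMvPowerSeries.ringHom :=
    MvPolynomial.ringHom_ext (fun r => by simp [taylorPoly, taylor_C])
      (fun i => by simp [taylorPoly, taylor_X])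
  have h2 := congrArg (coeff m) (RingHom.congr_fun this p)
  simpa [coeff_taylor] using h2

theorem prod_pow_mem_span_pow {ι B : Type*} [Fintype ι] [CommRing B] (h : ι → B) (m : ι →₀ ℕ) :
    ∏ i, h i ^ m i ∈ Ideal.span (Set.range h) ^ m.degree := by
  rw [Finsupp.degree_eq_sum, ← Finset.prod_pow_eq_pow_sum]
  exact Ideal.prod_mem_prod fun i _ =>
    Ideal.pow_mem_pow (Ideal.subset_span (Set.mem_range_self i)) _

/-- Taylor's formula `g(Ψ) = ∑ₘ θ^{(m)}(g) (Ψ - w)^m`, in which all but finitely many terms are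
negligible modulo a power of `(w)`. -/
theorem subst_sub_sum_hasse_mem {Ψ : Fin n → MvPowerSeries (Fin n) R}
    (hΨ : ∀ i, IsNilpotent (constantCoeff (Ψ i))) (g : MvPowerSeries (Fin n) R) (M : ℕ)
    (s : Finset (Fin n →₀ ℕ))
    (hs : ∀ m, m ∉ s → ∏ i, (Ψ i - X i) ^ m i ∈ varIdeal n R ^ M) :
    subst Ψ g - ∑ m ∈ s, hasse m g * ∏ i, (Ψ i - X i) ^ m i ∈ varIdeal n R ^ M := by
  classical
  have hsub := hasSubst_of_constantCoeff_nilpotent hΨ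
  obtain ⟨d, hd⟩ := exists_pow_le_varIdeal_pow hΨ
  set K := M + d + s.sup Finsupp.degree with hK
  obtain ⟨p, hp⟩ := exists_polynomial_sub_mem K g
  set r := g - (p : MvPowerSeries (Fin n) R) with hr
  have hg : g = p + r := by rw [hr]; ring
  have h1 : subst Ψ r ∈ varIdeal n R ^ M := by
    have := Ideal.mem_map_of_mem (substAlgHom (R := R) hsub).toRingHom hp
    rw [Ideal.map_pow, Ideal.map_span, ← Set.range_comp] at this
    have e : ((substAlgHom (R := R) hsub).toRingHom ∘ X : Fin n → _) = Ψ :=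
      funext fun i => substAlgHom_X hsub i
    rw [e] at this
    have h := hd M (Ideal.pow_le_pow_right (by omega) this)
    rwa [← coe_substAlgHom hsub]
  have h2 : ∑ m ∈ s, hasse m r * ∏ i, (Ψ i - X i) ^ m i ∈ varIdeal n R ^ M := by
    refine sum_mem fun m hm => Ideal.mul_mem_right _ _ ?_
    have := Finset.le_sup (f := Finsupp.degree) hm
    exact Ideal.pow_le_pow_right (by omega) (hasse_mem_varIdeal_pow K r hp m)
  have h3 : subst Ψ (p : MvPowerSeries (Fin n) R) =
      ∑ m ∈ (taylorPoly p).support ∪ s, hasse m (p : MvPowerSeries (Fin n) R) *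
        ∏ i, (Ψ i - X i) ^ m i := by
    rw [← Finset.sum_subset Finset.subset_union_left (fun m _ hm => by
      rw [← coeff_taylorPoly, MvPolynomial.notMem_support_iff.1 hm, zero_mul])]
    simp_rw [← coeff_taylorPoly]
    rw [← MvPolynomial.eval_eq', subst_coe]
    have : (MvPolynomial.eval (fun i => Ψ i - X i)).comp taylorPoly =
        (MvPolynomial.aeval Ψ : MvPolynomial (Fin n) R →ₐ[R] _).toRingHom :=
      MvPolynomial.ringHom_ext (fun r => by simp [taylorPoly, MvPowerSeries.algebraMap_apply])
        (fun i => by simp [taylorPoly])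
    exact (RingHom.congr_fun this p).symm
  have h4 : ∑ m ∈ (taylorPoly p).support ∪ s, hasse m (p : MvPowerSeries (Fin n) R) *
        ∏ i, (Ψ i - X i) ^ m i - ∑ m ∈ s, hasse m (p : MvPowerSeries (Fin n) R) *
        ∏ i, (Ψ i - X i) ^ m i ∈ varIdeal n R ^ M := by
    rw [← Finset.sum_sdiff (Finset.subset_union_right (s₁ := (taylorPoly p).support)),
      add_sub_cancel_right]
    exact sum_mem fun m hm => Ideal.mul_mem_left _ _ (hs m (Finset.mem_sdiff.1 hm).2)
  have h5 : ∀ m, hasse m g = hasse m (p : MvPowerSeries (Fin n) R) + hasse m r := fun m => by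
    rw [← coeff_taylor, hg, map_add, map_add]
    rfl
  have h6 : subst Ψ g = subst Ψ (p : MvPowerSeries (Fin n) R) + subst Ψ r := by
    rw [hg, subst_add hsub]
  rw [h6, h3]
  simp_rw [h5, add_mul]
  rw [Finset.sum_add_distrib]
  have := add_mem h4 (sub_mem h1 h2)
  convert this using 1
  ring

end TaylorExpansion

/-! ### Inverses in `Γ_n` -/

section Inverse

open MvPowerSeries

variable {n : ℕ} {A : Type*} [CommRing A]

theorem Gamma.isNilpotent_constantCoeff (Φ : Gamma n A) (i : Fin n) :
    IsNilpotent (constantCoeff (Φ.1 i)) := Φ.hasSubst.const_coeff i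

/-- The substitution `f ↦ f(Φ)`. -/
def Gamma.substHom (Φ : Gamma n A) : MvPowerSeries (Fin n) A →ₐ[A] MvPowerSeries (Fin n) A :=
  substAlgHom Φ.hasSubst

theorem Gamma.substHom_apply (Φ : Gamma n A) (f : MvPowerSeries (Fin n) A) :
    Φ.substHom f = subst Φ.1 f := substAlgHom_apply _ f

theorem Gamma.substHom_X (Φ : Gamma n A) (i : Fin n) : Φ.substHom (X i) = Φ.1 i :=
  substAlgHom_X _ i

theorem Gamma.exists_substHom_mem (Φ : Gamma n A) :
    ∃ d, ∀ M, ∀ f ∈ varIdeal n A ^ (M + d), Φ.substHom f ∈ varIdeal n A ^ M := by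
  obtain ⟨d, hd⟩ := exists_pow_le_varIdeal_pow Φ.isNilpotent_constantCoeff
  refine ⟨d, fun M f hf => hd M ?_⟩
  have := Ideal.mem_map_of_mem Φ.substHom hf
  rw [Ideal.map_pow, Ideal.map_span, ← Set.range_comp] at this
  have e : (⇑Φ.substHom ∘ X : Fin n → _) = Φ.1 := funext fun i => Φ.substHom_X i
  rwa [e] at this

/-- The difference of the identity and the substitution `f ↦ f(Φ)` is locally nilpotent.  Modulo the
power `𝔠 ^ M` of the ideal `𝔠` generated by `w` and the constant terms of `Φ`, which is preserved
by the substitution, only finitely many of the nilpotent coefficients of `Φ - w` matter. -/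
theorem Gamma.exists_iterate_mem (Φ : Gamma n A) (M : ℕ) : ∃ J, ∀ y,
    (fun f => f - Φ.substHom f)^[J] y ∈ varIdeal n A ^ M := by
  obtain ⟨d, hd⟩ := isNilpotent_span_range Φ.isNilpotent_constantCoeff
  set a : Ideal A := Ideal.span (Set.range fun i => constantCoeff (Φ.1 i)) with ha
  set c : Ideal (MvPowerSeries (Fin n) A) := varIdeal n A ⊔ a.map C with hc
  have hcM : c ^ (M + d) ≤ varIdeal n A ^ M := by
    refine pow_le_varIdeal_pow a c (fun x hx => ?_) hd M
    have := Ideal.mem_map_of_mem (constantCoeff (σ := Fin n) (R := A)) hx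
    rw [hc, Ideal.map_sup, Ideal.map_span, Ideal.map_map, constantCoeff_comp_C, Ideal.map_id,
      ← Set.range_comp] at this
    have hle : Ideal.span (Set.range (⇑(constantCoeff (σ := Fin n) (R := A)) ∘ X)) ⊔ a ≤ a :=
      sup_le (Ideal.span_le.2 (by
        rintro _ ⟨i, rfl⟩
        simp)) le_rfl
    exact hle this
  set K := M + d
  -- the finitely many coefficients of `Φ - w` of degree less than `K`
  let t : Fin n × {m : Fin n →₀ ℕ // m.degree < K} → A := fun q => coeff q.2.1 (Φ.1 q.1 - X q.1)
  have hfin : Finite {m : Fin n →₀ ℕ // m.degree < K} := by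
    refine Set.Finite.to_subtype (s := {m : Fin n →₀ ℕ | m.degree < K}) ?_
    refine (Set.finite_Iic (Finsupp.equivFunOnFinite.symm fun _ : Fin n => K)).subset fun m hm => ?_
    intro i
    exact (Finsupp.le_degree i m).trans (le_of_lt hm)
  obtain ⟨J, hJ⟩ := isNilpotent_span_range (c := t) fun q => Φ.2 q.1 q.2.1
  set b : Ideal A := Ideal.span (Set.range t) with hb
  set Q : Ideal (MvPowerSeries (Fin n) A) := b.map C ⊔ c ^ K with hQ
  have hΦQ : ∀ i, X i - Φ.substHom (X i) ∈ Q := by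
    intro i
    rw [Φ.substHom_X, ← neg_sub, neg_mem_iff]
    have ht : ∀ m : {m : Fin n →₀ ℕ // m.degree < K}, t (i, m) = coeff m.1 (Φ.1 i - X i) :=
      fun _ => rfl
    generalize Φ.1 i - X i = x at ht ⊢
    obtain ⟨p, hp⟩ : ∃ p : MvPolynomial (Fin n) A, p = truncTotal K x := ⟨_, rfl⟩
    have h1 : (p : MvPowerSeries (Fin n) A) ∈ b.map C := by
      have : p ∈ b.map MvPolynomial.C := by
        rw [MvPolynomial.mem_map_C_iff]
        intro m
        by_cases hm : m.degree < K
        · rw [hp, coeff_truncTotal _ hm]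
          exact Ideal.subset_span ⟨(i, ⟨m, hm⟩), ht ⟨m, hm⟩⟩
        · rw [hp, coeff_truncTotal_eq_zero _ (not_lt.1 hm)]
          exact zero_mem _
      have := Ideal.mem_map_of_mem (MvPolynomial.coeToMvPowerSeries.ringHom) this
      rw [Ideal.map_map] at this
      have e : (MvPolynomial.coeToMvPowerSeries.ringHom (σ := Fin n) (R := A)).comp
          MvPolynomial.C = C := by
        ext1 r
        simp
      rwa [e] at this
    have h2 : x - p ∈ varIdeal n A ^ K := (mem_varIdeal_pow_iff _ _).2 fun m hm => by
      rw [map_sub, MvPolynomial.coeff_coe, hp, coeff_truncTotal _ hm, sub_self]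
    have h3 := Ideal.pow_right_mono (le_sup_left : varIdeal n A ≤ c) K h2
    have := add_mem (Ideal.mem_sup_left (T := c ^ K) h1) (Ideal.mem_sup_right (S := b.map C) h3)
    rwa [add_sub_cancel] at this
  have hCc : ∀ x, (C (constantCoeff x) : MvPowerSeries (Fin n) A) - x ∈ varIdeal n A := by
    intro x
    rw [← pow_one (varIdeal n A), mem_varIdeal_pow_iff]
    intro m hm
    have : m = 0 := (Finsupp.degree_eq_zero_iff _).1 (by omega)
    subst this
    simp
  have hTc : ∀ x ∈ c ^ K, Φ.substHom x ∈ c ^ K := by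
    intro x hx
    have := Ideal.mem_map_of_mem Φ.substHom hx
    rw [Ideal.map_pow] at this
    refine Ideal.pow_right_mono ?_ K this
    rw [hc, Ideal.map_sup, Ideal.map_span]
    refine sup_le (Ideal.span_le.2 ?_) (Ideal.map_le_iff_le_comap.2
      (Ideal.map_le_iff_le_comap.2 fun r hr => ?_))
    · rintro _ ⟨_, ⟨i, rfl⟩, rfl⟩
      rw [Φ.substHom_X, SetLike.mem_coe]
      have h1 := Ideal.mem_sup_left (T := a.map C) (hCc (Φ.1 i))
      have h2 := Ideal.mem_sup_right (S := varIdeal n A) (Ideal.mem_map_of_mem C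
        (show constantCoeff (Φ.1 i) ∈ a from Ideal.subset_span ⟨i, rfl⟩))
      have := sub_mem h2 h1
      rwa [sub_sub_cancel] at this
    · refine Ideal.mem_sup_right ?_
      have : Φ.substHom (C r) = C r := AlgHom.commutes Φ.substHom r
      change Φ.substHom (C r) ∈ _
      rw [this]
      exact Ideal.mem_map_of_mem C hr
  have hTQ : ∀ z, z - Φ.substHom z ∈ Q := by
    intro z
    obtain ⟨p, hp⟩ := exists_polynomial_sub_mem K z
    have h1 := Ideal.pow_right_mono (le_sup_left : varIdeal n A ≤ c) K hp
    have h2 := hTc _ h1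
    have h3 : (p : MvPowerSeries (Fin n) A) - Φ.substHom p ∈ Q := by
      have : ((Ideal.Quotient.mk Q).comp MvPolynomial.coeToMvPowerSeries.ringHom) =
          ((Ideal.Quotient.mk Q).comp ((Φ.substHom : MvPowerSeries (Fin n) A →+* _).comp
            MvPolynomial.coeToMvPowerSeries.ringHom)) := by
        refine MvPolynomial.ringHom_ext (fun r => ?_) (fun i => ?_)
        · have : Φ.substHom (C r) = C r := AlgHom.commutes Φ.substHom r
          simp [this]
        · simpa using Ideal.Quotient.eq.2 (hΦQ i)
      exact Ideal.Quotient.eq.1 (RingHom.congr_fun this p)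
    have := add_mem h3 (Ideal.mem_sup_right (S := b.map C) (sub_mem h1 h2))
    convert this using 1
    rw [map_sub]
    ring
  have key : ∀ j y, (fun f => f - Φ.substHom f)^[j] y ∈ (b ^ j).map C ⊔ c ^ K := by
    intro j
    induction j with
    | zero => intro y; simp [Ideal.map_top]
    | succ j ih =>
      intro y
      rw [Function.iterate_succ_apply']
      obtain ⟨u, hu, v, hv, huv⟩ := Submodule.mem_sup.1 (ih y)
      have h1 : v - Φ.substHom v ∈ (b ^ (j + 1)).map C ⊔ c ^ K :=
        Ideal.mem_sup_right (sub_mem hv (hTc v hv))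
      have h2 : u - Φ.substHom u ∈ (b ^ (j + 1)).map C ⊔ c ^ K := by
        have h3 : ∀ z, z * u - Φ.substHom (z * u) ∈ (b ^ (j + 1)).map C ⊔ c ^ K := by
          refine Submodule.span_induction (p := fun u _ => ∀ z, z * u - Φ.substHom (z * u) ∈
            (b ^ (j + 1)).map C ⊔ c ^ K) ?_ ?_ ?_ ?_ hu
          · rintro _ ⟨r, hr, rfl⟩ z
            have e : Φ.substHom (C r) = C r := AlgHom.commutes Φ.substHom r
            rw [map_mul, e, ← sub_mul]
            have h4 := Ideal.mul_mem_mul (hTQ z) (Ideal.mem_map_of_mem C hr)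
            rw [hQ, Ideal.sup_mul, ← Ideal.map_mul, ← pow_succ'] at h4
            have hle : (b ^ (j + 1)).map C ⊔ c ^ K * (b ^ j).map C ≤ (b ^ (j + 1)).map C ⊔ c ^ K :=
              sup_le_sup_left Ideal.mul_le_left _
            exact hle h4
          · simp
          · intro x y _ _ hx hy z
            have := add_mem (hx z) (hy z)
            convert this using 1
            rw [mul_add, map_add]
            ring
          · intro x y _ hy z
            rw [smul_eq_mul, ← mul_assoc]
            exact hy _
        simpa using h3 1
      have := add_mem h2 h1
      rw [← huv, map_add]
      convert this using 1
      ring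
  refine ⟨J, fun y => hcM ?_⟩
  have := key J y
  rw [hJ] at this
  simpa using this

/-- As `1 - Φ` is locally nilpotent, preimages are given by the geometric series `∑ (1 - Φ)^j y`. -/
theorem Gamma.substHom_surjective (Φ : Gamma n A) : Function.Surjective Φ.substHom := by
  intro y
  choose J hJ using Φ.exists_iterate_mem
  set U : MvPowerSeries (Fin n) A → MvPowerSeries (Fin n) A := fun f => f - Φ.substHom f with hU
  -- the partial sums of the geometric series for the inverse of `1 - U`
  let s : ℕ → MvPowerSeries (Fin n) A := fun k => ∑ j ∈ Finset.range k, U^[j] y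
  have hs : ∀ k, y - Φ.substHom (s k) = U^[k] y := by
    intro k
    induction k with
    | zero => simp [s]
    | succ k ih =>
      rw [Function.iterate_succ_apply', ← ih]
      simp only [s, Finset.sum_range_succ, map_add, hU] at ih ⊢
      rw [← ih, map_sub]
      ring
  have hcauchy : ∀ M k, ∑ m ∈ Finset.range (M + 1), J m ≤ k →
      s k - s (∑ m ∈ Finset.range (M + 1), J m) ∈ varIdeal n A ^ M := by
    intro M k hk
    have : ∀ j, J M ≤ j → U^[j] y ∈ varIdeal n A ^ M := by
      intro j hj
      rw [← Nat.add_sub_cancel' hj, Function.iterate_add_apply]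
      exact hJ M _
    simp only [s]
    rw [← Finset.sum_sdiff (Finset.range_mono hk), add_sub_cancel_right]
    refine sum_mem fun j hj => this j ?_
    rw [Finset.mem_sdiff, Finset.mem_range, Finset.mem_range, not_lt] at hj
    exact (Finset.single_le_sum (f := J) (fun _ _ => Nat.zero_le _)
      (Finset.self_mem_range_succ M)).trans hj.2
  obtain ⟨x, hx⟩ := IsPrecomplete.prec
    (inferInstance : IsPrecomplete (varIdeal n A) (MvPowerSeries (Fin n) A))
    (f := fun M => s (∑ m ∈ Finset.range (M + 1), J m)) (by
      intro M N hMN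
      rw [SModEq.comm, SModEq.sub_mem, smul_eq_mul, Ideal.mul_top]
      exact hcauchy M _ (Finset.sum_le_sum_of_subset (Finset.range_mono (by omega))))
  refine ⟨x, (eq_of_forall_sub_mem fun M => ?_).symm⟩
  obtain ⟨d, hd⟩ := Φ.exists_substHom_mem
  have h1 := hx (M + d)
  rw [SModEq.sub_mem, smul_eq_mul, Ideal.mul_top] at h1
  have h2 := hd M _ h1
  have h3 : y - Φ.substHom (s (∑ m ∈ Finset.range (M + d + 1), J m)) ∈ varIdeal n A ^ M := by
    rw [hs, ← Nat.add_sub_cancel' (Finset.single_le_sum (f := J) (fun _ _ => Nat.zero_le _)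
      (Finset.mem_range.2 (show M < M + d + 1 by omega))), Function.iterate_add_apply]
    exact hJ M _
  have := add_mem h2 h3
  rw [map_sub] at this
  convert this using 1
  ring

/-- All transformations are invertible: a preimage of `wᵢ` under the substitution gives the `i`-th component
of a one-sided inverse. -/
theorem Gamma.exists_mul_eq_one (Φ : Gamma n A) : ∃ Ψ : Gamma n A, Ψ * Φ = 1 ∧ Φ * Ψ = 1 := by
  have key : ∀ Φ : Gamma n A, ∃ Ψ : Gamma n A, Ψ * Φ = 1 := by
    intro Φ
    choose ψ hψ using fun i => Φ.substHom_surjective (X i)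
    have h : ∀ i, MvPowerSeries.map (Ideal.Quotient.mk (nilradical A)) (ψ i) = X i := by
      intro i
      have h1 := congrArg (MvPowerSeries.map (Ideal.Quotient.mk (nilradical A))) (hψ i)
      rw [Φ.substHom_apply, MvPowerSeries.map_subst Φ.hasSubst, MvPowerSeries.map_X] at h1
      have : (fun j => MvPowerSeries.map (Ideal.Quotient.mk (nilradical A)) (Φ.1 j)) =
          X := funext fun j => (mem_gamma_iff _).1 Φ.2 j
      rwa [this, MvPowerSeries.subst_self, id] at h1
    exact ⟨⟨ψ, (mem_gamma_iff _).2 h⟩, Gamma.ext fun i =>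
      (Φ.substHom_apply (ψ i)).symm.trans (hψ i)⟩
  obtain ⟨Ψ, hΨ⟩ := key Φ
  obtain ⟨Ξ, hΞ⟩ := key Ψ
  have : Ξ = Φ := left_inv_eq_right_inv hΞ hΨ
  exact ⟨Ψ, hΨ, this ▸ hΞ⟩

end Inverse

/-! ### Formally étale algebras over polynomial rings -/

section FormallyEtale

open MvPolynomial

/-- Homomorphisms from a formally unramified algebra that is essentially of finite type are determined
modulo the Jacobson radical of the target: the separability idempotent of `L ⊗ L` is sent to a
unit that annihilates their difference. -/
theorem algHom_ext_of_sub_mem_jacobson {S L B : Type*} [CommRing S] [CommRing L] [CommRing B]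
    [Algebra S L] [Algebra S B] [Algebra.EssFiniteType S L] [Algebra.FormallyUnramified S L]
    (f g : L →ₐ[S] B) (h : ∀ a, f a - g a ∈ Ideal.jacobson (⊥ : Ideal B)) : f = g := by
  let Λ := Algebra.TensorProduct.lift f g fun _ _ => Commute.all _ _
  have hΛ : ∀ t, f (Algebra.TensorProduct.lmul' S t) - Λ t ∈ Ideal.jacobson (⊥ : Ideal B) := by
    intro t
    induction t with
    | zero => simp
    | add x y hx hy =>
      have := add_mem hx hy
      rw [map_add, map_add, map_add]
      convert this using 1
      ring
    | tmul x y =>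
      simp only [Λ, Algebra.TensorProduct.lmul'_apply_tmul, Algebra.TensorProduct.lift_tmul, map_mul]
      rw [← mul_sub]
      exact Ideal.mul_mem_left _ _ (h y)
  set ε := Λ (Algebra.FormallyUnramified.elem S L)
  have hε : IsUnit ε := by
    have h1 := hΛ (Algebra.FormallyUnramified.elem S L)
    rw [Algebra.FormallyUnramified.lmul_elem, map_one] at h1
    have := (Ideal.mem_jacobson_bot.1 h1) (-1)
    convert this using 1
    ring
  ext a
  have h1 := congrArg Λ (Algebra.FormallyUnramified.one_tmul_sub_tmul_one_mul_elem (R := S) a)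
  rw [map_mul, map_zero, map_sub] at h1
  simp only [Λ, Algebra.TensorProduct.lift_tmul, map_one, one_mul, mul_one] at h1
  exact (sub_eq_zero.1 ((hε.mul_left_eq_zero).1 h1)).symm

theorem essFiniteType_pi {R ι : Type*} [CommRing R] [Finite ι] {S : ι → Type*}
    [∀ i, CommRing (S i)] [∀ i, Algebra R (S i)] [∀ i, Algebra.EssFiniteType R (S i)] :
    Algebra.EssFiniteType R (∀ i, S i) := by
  classical
  cases nonempty_fintype ι
  have h : ∀ i, ∃ σ : Finset (S i), ∀ s : S i, ∃ t ∈ Algebra.adjoin R (σ : Set (S i)),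
      IsUnit t ∧ s * t ∈ Algebra.adjoin R (σ : Set (S i)) := fun i =>
    (Algebra.essFiniteType_iff R (S i)).1 inferInstance
  choose σ hσ using h
  rw [Algebra.essFiniteType_iff]
  let T : Finset (∀ i, S i) := Finset.univ.biUnion fun i =>
    (insert 1 (σ i)).image (Pi.single (M := S) i)
  have hT : ∀ i, ∀ x ∈ Algebra.adjoin R (σ i : Set (S i)),
      Pi.single (M := S) i x ∈ Algebra.adjoin R (T : Set (∀ i, S i)) := by
    intro i x hx
    have h1 : Pi.single (M := S) i 1 ∈ Algebra.adjoin R (T : Set (∀ i, S i)) :=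
      Algebra.subset_adjoin (by simp only [T, Finset.coe_biUnion, Set.mem_iUnion]; exact
        ⟨i, Finset.mem_coe.2 (Finset.mem_univ i), by simp⟩)
    induction hx using Algebra.adjoin_induction with
    | mem x hx =>
      exact Algebra.subset_adjoin (by simp only [T, Finset.coe_biUnion, Set.mem_iUnion]; exact
        ⟨i, Finset.mem_coe.2 (Finset.mem_univ i), by
          rw [Finset.coe_image]
          exact ⟨x, by simpa using Or.inr hx, rfl⟩⟩)
    | algebraMap r =>
      rw [Algebra.algebraMap_eq_smul_one, Pi.single_smul]
      exact Subalgebra.smul_mem _ h1 r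
    | add x y _ _ hx hy =>
      rw [Pi.single_add]
      exact add_mem hx hy
    | mul x y _ _ hx hy =>
      rw [Pi.single_mul]
      exact mul_mem hx hy
  refine ⟨T, fun s => ?_⟩
  choose t ht1 ht2 ht3 using fun i => hσ i (s i)
  refine ⟨t, ?_, Pi.isUnit_iff.2 ht2, ?_⟩
  · rw [← Finset.univ_sum_single t]
    exact sum_mem fun i _ => hT i _ (ht1 i)
  · rw [← Finset.univ_sum_single (s * t)]
    exact sum_mem fun i _ => hT i _ (ht3 i)

open scoped IntermediateField.algebraAdjoinAdjoin in
/-- The polynomial ring is isomorphic to `F[x]`, the field `F(x)` is a localization of `F[x]`, and `E` is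
separable over `F(x)`. -/
theorem formallyEtale_of_isSeparatingTranscendenceBasis {F E : Type*} [Field F] [Field E]
    [Algebra F E] {n : ℕ} {x : Fin n → E} (hx : IsSeparatingTranscendenceBasis F E x)
    [Algebra (MvPolynomial (Fin n) F) E]
    (h : ∀ p : MvPolynomial (Fin n) F, algebraMap (MvPolynomial (Fin n) F) E p = aeval x p) :
    Algebra.FormallyEtale (MvPolynomial (Fin n) F) E := by
  let e := hx.1.1.aevalEquiv
  let A0 := Algebra.adjoin F (Set.range x)
  let E0 := IntermediateField.adjoin F (Set.range x)
  let : Algebra (MvPolynomial (Fin n) F) A0 := (e : MvPolynomial (Fin n) F →+* A0).toAlgebra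
  let : Algebra (MvPolynomial (Fin n) F) E0 :=
    ((algebraMap A0 E0).comp (e : MvPolynomial (Fin n) F →+* A0)).toAlgebra
  have : IsScalarTower (MvPolynomial (Fin n) F) A0 E0 := .of_algebraMap_eq' rfl
  have : IsScalarTower (MvPolynomial (Fin n) F) E0 E := .of_algebraMap_eq fun p => by
    rw [h]
    rfl
  have : Algebra.FormallyEtale (MvPolynomial (Fin n) F) A0 :=
    .of_equiv (AlgEquiv.ofRingEquiv (f := (e : MvPolynomial (Fin n) F ≃+* A0)) fun _ => rfl)
  have : Algebra.FormallyEtale A0 E0 := .of_isLocalization (nonZeroDivisors _)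
  have : Algebra.FormallyEtale (MvPolynomial (Fin n) F) E0 := .comp _ A0 _
  have := hx.2
  have : Algebra.FormallyEtale E0 E := Algebra.FormallyEtale.of_isSeparable _ E
  exact .comp _ E0 _

/-- The ring `K` is a product of fields, so the projection to the factor `K / P` is étale. -/
theorem isIdempotentElem_of_isReduced {K : Type*} [CommRing K] [IsArtinianRing K] [IsReduced K]
    (P : Ideal K) [P.IsPrime] : IsIdempotentElem P := by
  have h1 : Algebra.FormallyEtale K (∀ I : MaximalSpectrum K, K ⧸ I.asIdeal) :=
    .of_equiv (IsArtinianRing.equivPi K)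
  have h2 : Algebra.FormallyEtale K (K ⧸ P) := by
    have := (Algebra.FormallyEtale.pi_iff (R := K)
      (A := fun I : MaximalSpectrum K => K ⧸ I.asIdeal)).1 h1 ⟨P, inferInstance⟩
    exact this
  have := (Algebra.FormallyEtale.iff_of_surjective (R := K) (S := K ⧸ P)
    Ideal.Quotient.mk_surjective).1 h2
  rwa [Ideal.Quotient.algebraMap_eq, Ideal.mk_ker] at this

end FormallyEtale

section ResidueBasis

open MvPolynomial

attribute [local instance] Ideal.Quotient.field

variable {K L : Type*} [CommRing K] [IsArtinianRing K] [CommRing L] [IsArtinianRing L] [Algebra K L]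
  {n : ℕ} {u : Fin n → L}

/-- The homomorphism `K[X] → L / Q` factors through `(K / (K ∩ Q))[X]`, over which `L / Q` is étale. -/
theorem formallyEtale_residueField [IsReduced K] (hu : IsResidueBasis K u)
    [Algebra (MvPolynomial (Fin n) K) L]
    (h : ∀ p : MvPolynomial (Fin n) K, algebraMap (MvPolynomial (Fin n) K) L p = aeval u p)
    (Q : Ideal L) [Q.IsPrime] : Algebra.FormallyEtale (MvPolynomial (Fin n) K) (L ⧸ Q) := by
  let F := K ⧸ Q.under K
  let : Algebra (MvPolynomial (Fin n) K) (MvPolynomial (Fin n) F) := MvPolynomial.algebraMvPolynomial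
  let : Algebra (MvPolynomial (Fin n) F) (L ⧸ Q) :=
    (aeval (R := F) fun i => Ideal.Quotient.mk Q (u i)).toRingHom.toAlgebra
  have : IsScalarTower (MvPolynomial (Fin n) K) (MvPolynomial (Fin n) F) (L ⧸ Q) := by
    refine .of_algebraMap_eq' (MvPolynomial.ringHom_ext (fun r => ?_) fun i => ?_)
    · have e : algebraMap (MvPolynomial (Fin n) K) (L ⧸ Q) (C r) =
          Ideal.Quotient.mk Q (algebraMap (MvPolynomial (Fin n) K) L (C r)) := rfl
      have e2 : algebraMap (MvPolynomial (Fin n) K) (MvPolynomial (Fin n) F) (C r) =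
          C (algebraMap K F r) := by
        rw [MvPolynomial.algebraMap_def, MvPolynomial.map_C]
      rw [e, h, RingHom.comp_apply, e2]
      change _ = aeval (R := F) (fun i => Ideal.Quotient.mk Q (u i)) (C (algebraMap K F r))
      rw [aeval_C, aeval_C]
      rfl
    · have e : algebraMap (MvPolynomial (Fin n) K) (L ⧸ Q) (X i) =
          Ideal.Quotient.mk Q (algebraMap (MvPolynomial (Fin n) K) L (X i)) := rfl
      have e2 : algebraMap (MvPolynomial (Fin n) K) (MvPolynomial (Fin n) F) (X i) = X i := by
        rw [MvPolynomial.algebraMap_def, MvPolynomial.map_X]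
      rw [e, h, RingHom.comp_apply, e2]
      change _ = aeval (R := F) (fun i => Ideal.Quotient.mk Q (u i)) (X i)
      rw [aeval_X, aeval_X]
  have : Algebra.FormallyEtale (MvPolynomial (Fin n) K) (MvPolynomial (Fin n) F) := by
    have hs : Function.Surjective (algebraMap (MvPolynomial (Fin n) K) (MvPolynomial (Fin n) F)) :=
      MvPolynomial.map_surjective _ Ideal.Quotient.mk_surjective
    rw [Algebra.FormallyEtale.iff_of_surjective hs]
    have : RingHom.ker (algebraMap (MvPolynomial (Fin n) K) (MvPolynomial (Fin n) F)) =
        (Q.under K).map C := by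
      rw [MvPolynomial.algebraMap_def, MvPolynomial.ker_map, Ideal.Quotient.algebraMap_eq,
        Ideal.mk_ker]
    rw [this]
    have h2 := isIdempotentElem_of_isReduced (Q.under K)
    unfold IsIdempotentElem at h2 ⊢
    rw [← Ideal.map_mul, h2]
  have : Algebra.FormallyEtale (MvPolynomial (Fin n) F) (L ⧸ Q) :=
    formallyEtale_of_isSeparatingTranscendenceBasis (hu Q) fun _ => rfl
  exact .comp _ (MvPolynomial (Fin n) F) _

theorem formallyEtale_of_isResidueBasis [IsReduced K] [IsReduced L] (hu : IsResidueBasis K u)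
    [Algebra (MvPolynomial (Fin n) K) L]
    (h : ∀ p : MvPolynomial (Fin n) K, algebraMap (MvPolynomial (Fin n) K) L p = aeval u p) :
    Algebra.FormallyEtale (MvPolynomial (Fin n) K) L := by
  have h1 := fun I : MaximalSpectrum L => formallyEtale_residueField hu h I.asIdeal
  have h2 : Algebra.FormallyEtale (MvPolynomial (Fin n) K) (∀ I : MaximalSpectrum L, L ⧸ I.asIdeal) :=
    (Algebra.FormallyEtale.pi_iff (A := fun I : MaximalSpectrum L => L ⧸ I.asIdeal)).2 h1
  exact .of_equiv ((IsArtinianRing.equivPi L).restrictScalars (MvPolynomial (Fin n) K)).symm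

theorem essFiniteType_of_hasResidueExtensions [IsReduced L] (hL : HasResidueExtensions K L n) :
    Algebra.EssFiniteType K L := by
  have h1 : ∀ I : MaximalSpectrum L, Algebra.EssFiniteType K (L ⧸ I.asIdeal) := by
    intro I
    have h2 : Algebra.EssFiniteType (K ⧸ I.asIdeal.under K) (L ⧸ I.asIdeal) :=
      IntermediateField.fg_top_iff.1 (hL I.asIdeal).2.1
    exact .comp K (K ⧸ I.asIdeal.under K) _
  have h2 : Algebra.EssFiniteType K (∀ I : MaximalSpectrum L, L ⧸ I.asIdeal) := essFiniteType_pi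
  exact (Algebra.EssFiniteType.iff_of_algEquiv
    ((IsArtinianRing.equivPi L).restrictScalars K)).2 h2

/-- Homomorphisms on `L` that agree on `K` and on a residue basis, and are congruent modulo the
Jacobson radical of the target, are equal. -/
theorem ringHom_ext_of_isResidueBasis [IsReduced K] [IsReduced L] (hL : HasResidueExtensions K L n)
    (hu : IsResidueBasis K u) {B : Type*} [CommRing B] (f g : L →+* B)
    (hK : ∀ a : K, f (algebraMap K L a) = g (algebraMap K L a)) (hfg : ∀ i, f (u i) = g (u i))
    (h : ∀ a, f a - g a ∈ Ideal.jacobson (⊥ : Ideal B)) : f = g := by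
  let : Algebra (MvPolynomial (Fin n) K) L := (aeval (R := K) u).toRingHom.toAlgebra
  let : Algebra (MvPolynomial (Fin n) K) B := (f.comp (algebraMap _ L)).toAlgebra
  have : IsScalarTower K (MvPolynomial (Fin n) K) L :=
    .of_algebraMap_eq fun r => ((aeval_C (R := K) u r).symm : _)
  have := formallyEtale_of_isResidueBasis hu fun _ => rfl
  have := essFiniteType_of_hasResidueExtensions hL
  have : Algebra.EssFiniteType (MvPolynomial (Fin n) K) L := .of_comp K _ _
  have hg : f.comp (algebraMap (MvPolynomial (Fin n) K) L) =
      g.comp (algebraMap (MvPolynomial (Fin n) K) L) := by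
    refine MvPolynomial.ringHom_ext (fun r => ?_) fun i => ?_
    · have : algebraMap (MvPolynomial (Fin n) K) L (C r) = algebraMap K L r := aeval_C _ _
      rw [RingHom.comp_apply, RingHom.comp_apply, this, hK]
    · have : algebraMap (MvPolynomial (Fin n) K) L (X i) = u i := aeval_X _ _
      rw [RingHom.comp_apply, RingHom.comp_apply, this, hfg]
  have key := algHom_ext_of_sub_mem_jacobson (S := MvPolynomial (Fin n) K)
    { f with commutes' := fun _ => rfl } { g with commutes' := fun p => (RingHom.congr_fun hg p).symm }
    h
  exact RingHom.ext fun a => DFunLike.congr_fun key a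

end ResidueBasis

/-! ### The iterative derivation attached to a residue basis -/

theorem mem_jacobson_bot_of_constantCoeff {σ R : Type*} [CommRing R] {f : MvPowerSeries σ R}
    (h : MvPowerSeries.constantCoeff f ∈ Ideal.jacobson (⊥ : Ideal R)) :
    f ∈ Ideal.jacobson (⊥ : Ideal (MvPowerSeries σ R)) := by
  rw [Ideal.mem_jacobson_bot] at h ⊢
  intro y
  rw [MvPowerSeries.isUnit_iff_constantCoeff, map_add, map_mul, map_one]
  exact h _

section

variable {K L : Type*} [CommRing K] [IsArtinianRing K] [CommRing L] [IsArtinianRing L] [Algebra K L]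
  {n : ℕ} {u : Fin n → L}

/-- The homomorphism `θ_u` is the lift of `L → L[[w]] / (w)` along the complete ideal `(w)` that is linear
over `K[X]`, where `Xᵢ` acts on `L` as `uᵢ` and on `L[[w]]` as `uᵢ + wᵢ`. -/
theorem exists_algHom_of_isResidueBasis [IsReduced K] [IsReduced L] (hu : IsResidueBasis K u) :
    ∃ f : L →ₐ[K] MvPowerSeries (Fin n) L, (∀ a, MvPowerSeries.coeff 0 (f a) = a) ∧
      ∀ i, f (u i) = MvPowerSeries.C (u i) + MvPowerSeries.X i := by
  let v : Fin n → MvPowerSeries (Fin n) L := fun i => MvPowerSeries.C (u i) + MvPowerSeries.X i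
  let : Algebra (MvPolynomial (Fin n) K) L := (MvPolynomial.aeval (R := K) u).toRingHom.toAlgebra
  let : Algebra (MvPolynomial (Fin n) K) (MvPowerSeries (Fin n) L) :=
    (MvPolynomial.aeval (R := K) v).toRingHom.toAlgebra
  have : Algebra.FormallyEtale (MvPolynomial (Fin n) K) L :=
    formallyEtale_of_isResidueBasis hu fun _ => rfl
  have : IsScalarTower K (MvPolynomial (Fin n) K) L :=
    .of_algebraMap_eq fun r => ((MvPolynomial.aeval_C (R := K) u r).symm : _)
  have : IsScalarTower K (MvPolynomial (Fin n) K) (MvPowerSeries (Fin n) L) :=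
    .of_algebraMap_eq fun r => ((MvPolynomial.aeval_C (R := K) v r).symm : _)
  have hmk : ((Ideal.Quotient.mk (varIdeal n L)).comp MvPowerSeries.C).comp
      (algebraMap (MvPolynomial (Fin n) K) L) =
      (Ideal.Quotient.mk (varIdeal n L)).comp (algebraMap _ (MvPowerSeries (Fin n) L)) := by
    refine MvPolynomial.ringHom_ext (fun r => ?_) fun i => ?_
    · have h1 : algebraMap (MvPolynomial (Fin n) K) L (MvPolynomial.C r) = algebraMap K L r :=
        MvPolynomial.aeval_C _ _
      have h2 : algebraMap (MvPolynomial (Fin n) K) (MvPowerSeries (Fin n) L) (MvPolynomial.C r) =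
          algebraMap K _ r := MvPolynomial.aeval_C _ _
      simp only [RingHom.comp_apply]
      rw [h1, h2, MvPowerSeries.algebraMap_apply]
    · have h1 : algebraMap (MvPolynomial (Fin n) K) L (MvPolynomial.X i) = u i :=
        MvPolynomial.aeval_X _ _
      have h2 : algebraMap (MvPolynomial (Fin n) K) (MvPowerSeries (Fin n) L) (MvPolynomial.X i) =
          v i := MvPolynomial.aeval_X _ _
      simp only [RingHom.comp_apply]
      rw [h1, h2, map_add, left_eq_add, Ideal.Quotient.eq_zero_iff_mem]
      exact Ideal.subset_span (Set.mem_range_self i)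
  let f0 : L →ₐ[MvPolynomial (Fin n) K] MvPowerSeries (Fin n) L ⧸ varIdeal n L :=
    { (Ideal.Quotient.mk (varIdeal n L)).comp MvPowerSeries.C with
      commutes' := fun p => RingHom.congr_fun hmk p }
  obtain ⟨g, hg⟩ := Algebra.FormallySmooth.exists_mkₐ_comp_eq_of_isAdicComplete f0
  refine ⟨g.restrictScalars K, fun a => ?_, fun i => ?_⟩
  · have h1 : Ideal.Quotient.mk (varIdeal n L) (g a) =
        Ideal.Quotient.mk (varIdeal n L) (MvPowerSeries.C a) := DFunLike.congr_fun hg a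
    rw [Ideal.Quotient.eq, ← pow_one (varIdeal n L), mem_varIdeal_pow_iff] at h1
    have := h1 0 (by simp)
    rwa [map_sub, MvPowerSeries.coeff_zero_C, sub_eq_zero] at this
  · have h1 : algebraMap (MvPolynomial (Fin n) K) L (MvPolynomial.X i) = u i :=
      MvPolynomial.aeval_X _ _
    have h2 : algebraMap (MvPolynomial (Fin n) K) (MvPowerSeries (Fin n) L) (MvPolynomial.X i) =
        v i := MvPolynomial.aeval_X _ _
    change g (u i) = v i
    rw [← h1, ← h2, g.commutes]

/-- Iterativity says that `f ↦ θ(θ(f))` and `f ↦ θ(f)(w + t)` agree; both are homomorphisms to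
`L[[w]][[t]]` sending `uᵢ` to `uᵢ + wᵢ + tᵢ`. -/
theorem existsUnique_isAssociated [IsReduced K] [IsReduced L] (hL : HasResidueExtensions K L n)
    (hu : IsResidueBasis K u) : ∃! θ : IterativeDerivation K L n, θ.IsAssociated u := by
  obtain ⟨f, hf0, hfu⟩ := exists_algHom_of_isResidueBasis hu
  have hiter : (MvPowerSeries.map (f : L →+* MvPowerSeries (Fin n) L)).comp
      (f : L →+* MvPowerSeries (Fin n) L) = taylor.comp (f : L →+* MvPowerSeries (Fin n) L) := by
    refine ringHom_ext_of_isResidueBasis hL hu _ _ (fun a => ?_) (fun i => ?_) fun a => ?_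
    · simp only [RingHom.comp_apply, RingHom.coe_coe, AlgHom.commutes,
        MvPowerSeries.algebraMap_apply, MvPowerSeries.map_C, taylor_C]
    · simp only [RingHom.comp_apply, RingHom.coe_coe, hfu, map_add, MvPowerSeries.map_C,
        MvPowerSeries.map_X, taylor_C, taylor_X, add_assoc]
    · refine mem_jacobson_bot_of_constantCoeff (mem_jacobson_bot_of_constantCoeff ?_)
      have h1 : MvPowerSeries.constantCoeff (taylor (f a)) = f a := by
        rw [← MvPowerSeries.coeff_zero_eq_constantCoeff_apply, coeff_taylor, hasse_zero]
      simp only [RingHom.comp_apply, RingHom.coe_coe, map_sub, h1,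
        MvPowerSeries.constantCoeff_map]
      rw [← MvPowerSeries.coeff_zero_eq_constantCoeff_apply,
        ← MvPowerSeries.coeff_zero_eq_constantCoeff_apply, hf0, sub_self]
      exact zero_mem _
  refine ⟨⟨f, hf0, fun i j a => ?_⟩, hfu, fun θ hθ => ?_⟩
  · have h := congrArg (fun F => MvPowerSeries.coeff i (MvPowerSeries.coeff j F))
      (RingHom.congr_fun hiter a)
    simp only [RingHom.comp_apply, RingHom.coe_coe, MvPowerSeries.coeff_map, coeff_taylor,
      coeff_hasse] at h
    rw [h]
    congr 1
    exact Finset.prod_congr rfl fun s _ => Nat.choose_symm_add.symm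
  · have h : (θ.hom : L →+* MvPowerSeries (Fin n) L) = f := by
      refine ringHom_ext_of_isResidueBasis hL hu _ _ (fun a => ?_) (fun i => ?_) fun a => ?_
      · simp only [RingHom.coe_coe, AlgHom.commutes]
      · simp only [RingHom.coe_coe, hfu]
        exact hθ i
      · refine mem_jacobson_bot_of_constantCoeff ?_
        rw [map_sub, ← MvPowerSeries.coeff_zero_eq_constantCoeff_apply,
          ← MvPowerSeries.coeff_zero_eq_constantCoeff_apply]
        simp only [RingHom.coe_coe, hf0, θ.coeff_zero, sub_self]
        exact zero_mem _
    cases θ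
    congr
    exact AlgHom.ext fun a => RingHom.congr_fun h a

end

/-! ### Existence of residue bases -/

/-- In a geometrically reduced extension of characteristic `p`, `p`-th powers of linearly independent
elements are linearly independent (MacLane's criterion): from a relation `∑ cᵢ xᵢ ^ p = 0` the
element `∑ cᵢ ^ (1/p) ⊗ xᵢ` is nilpotent over the algebraic closure. -/
theorem linearIndepOn_pow_of_isGeometricallyReduced {k E : Type*} [Field k] [Field E] [Algebra k E]
    [Algebra.IsGeometricallyReduced k E] (p : ℕ) [hp : Fact p.Prime] [CharP k p] (s : Finset E)
    (hs : LinearIndepOn k _root_.id (s : Set E)) : LinearIndepOn k (· ^ p) (s : Set E) := by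
  let Ω := AlgebraicClosure k
  have hred : IsReduced (Ω ⊗[k] E) := (Algebra.isGeometricallyReduced_field_iff k E).1 inferInstance
  have : CharP (Ω ⊗[k] E) p := charP_of_injective_algebraMap (algebraMap k (Ω ⊗[k] E)).injective p
  rw [linearIndepOn_finset_iff] at hs ⊢
  intro f hf i hi
  choose d hd using fun j => IsAlgClosed.exists_pow_nat_eq (algebraMap k Ω (f j)) hp.out.pos
  have hx : (∑ j ∈ s, d j ⊗ₜ[k] j : Ω ⊗[k] E) ^ p = 0 := by
    rw [sum_pow_char]
    have : ∀ j ∈ s, (d j ⊗ₜ[k] j : Ω ⊗[k] E) ^ p = 1 ⊗ₜ[k] (f j • j ^ p) := by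
      intro j _
      rw [Algebra.TensorProduct.tmul_pow, hd, Algebra.algebraMap_eq_smul_one,
        TensorProduct.smul_tmul]
    rw [Finset.sum_congr rfl this, ← TensorProduct.tmul_sum, hf, TensorProduct.tmul_zero]
  have h0 : ∑ j ∈ s, d j ⊗ₜ[k] j = (0 : Ω ⊗[k] E) := pow_eq_zero_iff hp.out.ne_zero |>.1 hx
  have hli : LinearIndependent k (fun j : s => (j : E)) := by
    rw [← linearIndepOn_finset_iff] at hs
    exact hs
  have h1 := Module.Flat.linearIndependent_one_tmul (S := Ω) hli
  have h2 := (Fintype.linearIndependent_iff.1 h1) (fun j => d j) (by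
    rw [← h0, ← Finset.sum_coe_sort s]
    refine Finset.sum_congr rfl fun j _ => ?_
    rw [TensorProduct.smul_tmul', smul_eq_mul, mul_one]) ⟨i, hi⟩
  have h3 := hd i
  have h4 : d i = 0 := h2
  rw [h4, zero_pow hp.out.ne_zero] at h3
  exact (map_eq_zero _).1 h3.symm

theorem exists_isSeparatingTranscendenceBasis {k E : Type*} [Field k] [Field E] [Algebra k E]
    [Algebra.IsGeometricallyReduced k E] [Algebra.EssFiniteType k E] {n : ℕ}
    (hn : Algebra.trdeg k E = n) :
    ∃ x : Fin n → E, IsSeparatingTranscendenceBasis k E x := by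
  have h : ∃ s : Finset E, IsTranscendenceBasis k ((↑) : s → E) ∧
      Algebra.IsSeparable (IntermediateField.adjoin k (s : Set E)) E := by
    obtain h0 | ⟨p, hp, hpk⟩ := CharP.exists' k
    · exact exists_isTranscendenceBasis_and_isSeparable_of_perfectField k E
    · exact exists_isTranscendenceBasis_and_isSeparable_of_linearIndepOn_pow_of_essFiniteType p hp.out
        fun s hs => linearIndepOn_pow_of_isGeometricallyReduced p s hs
  obtain ⟨s, hs, hsep⟩ := h
  have hc := hs.lift_cardinalMk_eq_trdeg
  rw [hn] at hc
  have hc' : s.card = n := by simpa using hc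
  let e : Fin n ≃ s := (s.equivFinOfCardEq hc').symm
  refine ⟨fun i => (e i : E), (isTranscendenceBasis_equiv e).2 hs, ?_⟩
  have : Set.range (fun i => (e i : E)) = s := by
    change Set.range (((↑) : s → E) ∘ e) = s
    rw [e.surjective.range_comp]
    simp
  rw [this]
  exact hsep

attribute [local instance] Ideal.Quotient.field in
/-- Bases of the residue fields are lifted by the Chinese remainder theorem. -/
theorem exists_isResidueBasis {K L : Type*} [CommRing K] [IsArtinianRing K] [CommRing L]
    [IsArtinianRing L] [Algebra K L] {n : ℕ} (hL : HasResidueExtensions K L n) :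
    ∃ u : Fin n → L, IsResidueBasis K u := by
  have h : ∀ I : MaximalSpectrum L, ∃ x : Fin n → L ⧸ I.asIdeal,
      IsSeparatingTranscendenceBasis (K ⧸ I.asIdeal.under K) (L ⧸ I.asIdeal) x := by
    intro I
    obtain ⟨h1, h2, h3⟩ := hL I.asIdeal
    have : Algebra.EssFiniteType (K ⧸ I.asIdeal.under K) (L ⧸ I.asIdeal) :=
      IntermediateField.fg_top_iff.1 h2
    exact exists_isSeparatingTranscendenceBasis h3
  choose x hx using h
  have hcop : Pairwise (Function.onFun IsCoprime fun I : MaximalSpectrum L => I.asIdeal) :=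
    fun I J hIJ => Ideal.isCoprime_of_isMaximal fun h => hIJ (MaximalSpectrum.ext h)
  choose u hu using fun i => Ideal.pi_quotient_surjective hcop (fun I => x I i)
  refine ⟨u, fun Q hQ => ?_⟩
  have := hx ⟨Q, inferInstance⟩
  have e : (fun i => Ideal.Quotient.mk Q (u i)) = x ⟨Q, inferInstance⟩ :=
    funext fun i => hu i ⟨Q, inferInstance⟩
  rw [e]
  exact this

/-! ### Simple module algebras over Birkhoff–Witt smash products are reduced -/

section Reduced

variable {C G : Type*} {H : Type*} [Field C] [Monoid G] [Ring H] [HopfAlgebra C H]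
  [MulSemiringAction G H] [SMulCommClass G C H] [BialgebraAction C G H]
  {A : Type*} [CommRing A] [Algebra C A] (M : ModuleAlgebra C (SkewMonoidAlgebra H G) A)

theorem act_single_mul (g : G) (h : H) (a b : A) :
    M.act (SkewMonoidAlgebra.single g h) (a * b) =
      LinearMap.mul' C A (TensorProduct.map
        ((M.act.flip a) ∘ₗ SkewMonoidAlgebra.lsingle C g)
        ((M.act.flip b) ∘ₗ SkewMonoidAlgebra.lsingle C g) (Coalgebra.comul (R := C) h)) := by
  rw [M.act_mul, smash_comul_single, TensorProduct.map_map]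

/-- A grouplike element acts by a ring endomorphism. -/
def actGroupHom (g : G) : A →+* A where
  toFun := M.act (SkewMonoidAlgebra.single g 1)
  map_one' := by
    rw [M.act_one, smash_counit_single, Bialgebra.counit_one, map_one]
  map_mul' a b := by
    rw [act_single_mul, Bialgebra.comul_one, Algebra.TensorProduct.one_def, TensorProduct.map_tmul,
      LinearMap.mul'_apply]
    rfl
  map_zero' := map_zero _
  map_add' := map_add _

/-- The power series `∑ b_α(a) x^α`, for a basis `b` of `H` indexed by multi-indices. -/
def actSeries {ι : Type*} (b : Module.Basis (ι →₀ ℕ) C H) (a : A) : MvPowerSeries ι A :=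
  fun α => M.act (SkewMonoidAlgebra.single 1 (b α)) a

theorem coeff_actSeries {ι : Type*} (b : Module.Basis (ι →₀ ℕ) C H) (a : A) (α : ι →₀ ℕ) :
    MvPowerSeries.coeff α (actSeries M b a) = M.act (SkewMonoidAlgebra.single 1 (b α)) a := rfl

open Classical in
/-- The divided powers of a Birkhoff–Witt coalgebra act as the coefficients of a homomorphism to a
power series ring. -/
def actSeriesHom {ι : Type*} (b : Module.Basis (ι →₀ ℕ) C H)
    (hb : ∀ α, Coalgebra.comul (R := C) (b α) =
      ∑ p ∈ Finset.HasAntidiagonal.antidiagonal α, b p.1 ⊗ₜ[C] b p.2)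
    (hb0 : ∀ α, Coalgebra.counit (R := C) (b α) = if α = 0 then 1 else 0) :
    A →+* MvPowerSeries ι A where
  toFun := actSeries M b
  map_one' := by
    ext α
    rw [MvPowerSeries.coeff_one, coeff_actSeries, M.act_one, smash_counit_single, hb0]
    split_ifs <;> simp
  map_mul' x y := by
    ext α
    rw [MvPowerSeries.coeff_mul, coeff_actSeries, act_single_mul, hb, map_sum, map_sum]
    refine Finset.sum_congr rfl fun p _ => ?_
    rw [TensorProduct.map_tmul, LinearMap.mul'_apply]
    rfl
  map_zero' := by
    ext α
    rw [coeff_actSeries, map_zero, map_zero]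
  map_add' x y := by
    ext α
    rw [map_add, coeff_actSeries, coeff_actSeries, coeff_actSeries, map_add]

/-- The nilradical is stable because divided powers and grouplike elements act through homomorphisms to
power series rings and to `A`. -/
theorem isStableIdeal_nilradical (hH : IsBirkhoffWitt C H) : M.IsStableIdeal (nilradical A) := by
  obtain ⟨ι, b, hb, hb0⟩ := hH
  have h1 : ∀ (h : H), ∀ a ∈ nilradical A,
      M.act (SkewMonoidAlgebra.single 1 h) a ∈ nilradical A := by
    intro h a ha
    let N : Submodule C A := (nilradical A).restrictScalars C
    have hle : (⊤ : Submodule C H) ≤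
        N.comap (M.act.flip a ∘ₗ SkewMonoidAlgebra.lsingle C (1 : G)) := by
      rw [← b.span_eq, Submodule.span_le]
      rintro _ ⟨α, rfl⟩
      change M.act (SkewMonoidAlgebra.single 1 (b α)) a ∈ nilradical A
      -- modulo a prime ideal the power series ring has no nilpotent elements
      rw [nilradical_eq_sInf, Ideal.mem_sInf]
      intro Q hQ
      have : Q.IsPrime := hQ
      have hnil : IsNilpotent (MvPowerSeries.map (Ideal.Quotient.mk Q)
          (actSeriesHom M b hb hb0 a)) :=
        ((mem_nilradical.1 ha).map _).map _
      have h0 := congrArg (MvPowerSeries.coeff α) hnil.eq_zero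
      rw [MvPowerSeries.coeff_map, map_zero, Ideal.Quotient.eq_zero_iff_mem] at h0
      exact h0
    exact hle (Submodule.mem_top (x := h))
  intro d a ha
  induction d using SkewMonoidAlgebra.induction_on with
  | zero => simp
  | add x y hx hy =>
    rw [map_add]
    exact add_mem hx hy
  | single g h =>
    have e : SkewMonoidAlgebra.single g h =
        (SkewMonoidAlgebra.single 1 h * SkewMonoidAlgebra.single g 1 : SkewMonoidAlgebra H G) := by
      rw [SkewMonoidAlgebra.single_mul_single, one_smul, mul_one, one_mul]
    rw [e, M.mul_act]
    exact h1 _ _ (mem_nilradical.2 ((mem_nilradical.1 ha).map (actGroupHom M g)))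

theorem ModuleAlgebra.IsSimple.isReduced (hH : IsBirkhoffWitt C H) (hM : M.IsSimple) :
    IsReduced A := by
  have := hM.1
  rw [← nilradical_eq_bot_iff]
  refine (hM.2 _ (isStableIdeal_nilradical M hH)).resolve_right fun h => ?_
  have h1 : (1 : A) ∈ nilradical A := h ▸ Submodule.mem_top
  exact not_isNilpotent_one (mem_nilradical.1 h1)

end Reduced

/-! ### Evaluation of the completed tensor product along linear forms -/

section Evaluation

variable {k L : Type*} [CommRing k] [CommRing L] [Algebra k L] {n : ℕ}
  (θ : IterativeDerivation k L n) {P A B : Type*} [CommRing P] [Algebra L P]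
  [CommRing A] [Algebra L A] [CommRing B]

variable (A) in
/-- The homomorphism `θ : L → L[[w]] → A[[w]]`. -/
def twHom : L →+* MvPowerSeries (Fin n) A :=
  (MvPowerSeries.map (algebraMap L A)).comp (θ.hom : L →+* MvPowerSeries (Fin n) L)

theorem twHom_apply (a : L) : twHom θ A a = MvPowerSeries.map (algebraMap L A) (θ.hom a) := rfl

theorem map_twHom [Algebra L B] (g : A →ₐ[L] B) (a : L) :
    MvPowerSeries.map (g : A →+* B) (twHom θ A a) = twHom θ B a := by
  rw [twHom_apply, twHom_apply, ← RingHom.comp_apply, ← MvPowerSeries.map_comp,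
    AlgHom.comp_algebraMap]

theorem hasse_twHom (m : Fin n →₀ ℕ) (a : L) : hasse m (twHom θ A a) = twHom θ A (θ.op m a) :=
  congrArg (Tw.equiv θ A).symm (Tw.hasse_algebraMap (S := A) θ m a)

/-- Continuity of an additive map from a completion to a power series ring. -/
def SeriesCont (F : Hat θ P A →+ MvPowerSeries (Fin n) B) : Prop :=
  ∀ m, ∃ M, ∀ x, AdicCompletion.evalₐ (wIdeal θ P A) M x = 0 → F x ∈ varIdeal n B ^ m

variable {θ}

theorem SeriesCont.comp {Q E : Type*} [CommRing Q] [Algebra L Q] [CommRing E] [Algebra L E]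
    {F : Hat θ P A →+ MvPowerSeries (Fin n) B}
    (hF : SeriesCont θ F) {G : Hat θ Q E →+ Hat θ P A} (hG : HatCont _ _ G) :
    SeriesCont θ (F.comp G) := by
  intro m
  obtain ⟨M, hM⟩ := hF m
  obtain ⟨N, hN⟩ := hG M
  exact ⟨N, fun x hx => hM _ (hN x hx)⟩

theorem SeriesCont.postcomp {E : Type*} [CommRing E]
    {F : Hat θ P A →+ MvPowerSeries (Fin n) B} (hF : SeriesCont θ F)
    {G : MvPowerSeries (Fin n) B →+ MvPowerSeries (Fin n) E}
    (hG : ∀ m, ∃ M, ∀ x ∈ varIdeal n B ^ M, G x ∈ varIdeal n E ^ m) : SeriesCont θ (G.comp F) := by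
  intro m
  obtain ⟨M, hM⟩ := hG m
  obtain ⟨N, hN⟩ := hF M
  exact ⟨N, fun x hx => hM _ (hN x hx)⟩

theorem SeriesCont.mulLeft {F : Hat θ P A →+ MvPowerSeries (Fin n) B} (hF : SeriesCont θ F)
    (y : MvPowerSeries (Fin n) B) : SeriesCont θ ((AddMonoidHom.mulLeft y).comp F) :=
  hF.postcomp fun m => ⟨m, fun _ hx => Ideal.mul_mem_left _ _ hx⟩

theorem SeriesCont.sum {ι : Type*} (s : Finset ι) {F : ι → Hat θ P A →+ MvPowerSeries (Fin n) B}
    (hF : ∀ i ∈ s, SeriesCont θ (F i)) : SeriesCont θ (∑ i ∈ s, F i) := by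
  intro m
  choose! M hM using fun i hi => hF i hi m
  refine ⟨s.sup M, fun x hx => ?_⟩
  rw [AddMonoidHom.finsetSum_apply]
  exact sum_mem fun i hi => hM i hi x (evala_of_le _ (Finset.le_sup hi) hx)

theorem SeriesCont.ext {F G : Hat θ P A →+ MvPowerSeries (Fin n) B} (hF : SeriesCont θ F)
    (hG : SeriesCont θ G) (h : ∀ f b, F (hatLeft θ P A f * hatRight θ P A b) =
      G (hatLeft θ P A f * hatRight θ P A b)) : F = G := by
  refine AddMonoidHom.ext fun x => eq_of_forall_sub_mem fun m => ?_
  obtain ⟨M, hM⟩ := hF m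
  obtain ⟨N, hN⟩ := hG m
  obtain ⟨r, hr⟩ := exists_rep (wIdeal θ P A) (max M N) x
  have h1 := hM _ (evala_of_le _ (le_max_left _ _) hr)
  have h2 := hN _ (evala_of_le _ (le_max_right _ _) hr)
  have h3 : F (algebraMap _ _ r) = G (algebraMap _ _ r) := by
    refine TwT.induction θ (p := fun r => F (algebraMap _ _ r) = G (algebraMap _ _ r)) ?_
      (fun x y hx hy => ?_) (fun f b => ?_) r
    · rw [map_zero, map_zero, map_zero]
    · rw [map_add, map_add, map_add, hx, hy]
    · rw [algebraMap_tmul, h]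
  rw [map_sub] at h1 h2
  have := sub_mem h1 h2
  rwa [h3, sub_sub_sub_cancel_right] at this

variable (θ)

/-- Elements of `(w) ^ M` are sums of products `y (1 ⊗ b)` with `b ∈ (w) ^ M`. -/
theorem mem_wIdeal_pow_induction (M : ℕ) {p : TwT θ P A → Prop}
    (h0 : p 0) (ha : ∀ x y, p x → p y → p (x + y))
    (hm : ∀ y, ∀ b ∈ varIdeal n A ^ M, p (y * TwT.right θ P A (Tw.equiv θ A b)))
    (x : TwT θ P A) (hx : x ∈ wIdeal θ P A ^ M) : p x := by
  have hI : wIdeal θ P A = (varIdeal n A).map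
      ((TwT.right θ P A : Tw θ A →+* TwT θ P A).comp (Tw.equiv θ A : MvPowerSeries (Fin n) A →+* _)) := by
    rw [← Ideal.map_map, Ideal.map_span, ← Set.range_comp]
    rfl
  rw [hI, ← Ideal.map_pow] at hx
  suffices h : ∀ y, p (y * x) by simpa using h 1
  refine Submodule.span_induction (p := fun x _ => ∀ y, p (y * x)) ?_ ?_ ?_ ?_ hx
  · rintro _ ⟨b, hb, rfl⟩ y
    exact hm y b hb
  · intro y
    rwa [mul_zero]
  · intro a b _ _ h1 h2 y
    rw [mul_add]
    exact ha _ _ (h1 y) (h2 y)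
  · intro r a _ h1 y
    rw [smul_eq_mul, ← mul_assoc]
    exact h1 _

variable (A) in
/-- The map `P ⊗_L A[[w]] → A[[w]]`, `f ⊗ b ↦ θ(ℓ(f)) b`, for an `L`-linear form `ℓ` on `P`. -/
def evalTensor (ℓ : P →ₗ[L] L) : TwT θ P A →+ MvPowerSeries (Fin n) A :=
  ((Tw.equiv θ A).symm : Tw θ A →+ MvPowerSeries (Fin n) A).comp
    ((TensorProduct.lid L (Tw θ A)).toLinearMap ∘ₗ
      LinearMap.rTensor (Tw θ A) ℓ : P ⊗[L] Tw θ A →ₗ[L] Tw θ A).toAddMonoidHom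

theorem evalTensor_mul_right (ℓ : P →ₗ[L] L) (y : TwT θ P A) (b : Tw θ A) :
    evalTensor θ A ℓ (y * TwT.right θ P A b) = evalTensor θ A ℓ y * (Tw.equiv θ A).symm b := by
  have h1 : ∀ f c, evalTensor θ A ℓ (TwT.left θ P A f * TwT.right θ P A c) =
      twHom θ A (ℓ f) * (Tw.equiv θ A).symm c := by
    intro f c
    rw [← TwT.tmul_eq]
    refine congrArg (Tw.equiv θ A).symm (a₂ := algebraMap L (Tw θ A) (ℓ f) * c) ?_
    rw [← Algebra.smul_def]
    rfl
  refine TwT.induction θ (p := fun y => evalTensor θ A ℓ (y * TwT.right θ P A b) =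
    evalTensor θ A ℓ y * (Tw.equiv θ A).symm b) ?_ (fun x y hx hy => ?_) (fun f c => ?_) y
  · rw [zero_mul, map_zero, zero_mul]
  · rw [add_mul, map_add, map_add, hx, hy, add_mul]
  · rw [mul_assoc, ← map_mul, h1, h1, map_mul, mul_assoc]

theorem evalTensor_left (ℓ : P →ₗ[L] L) (f : P) :
    evalTensor θ A ℓ (TwT.left θ P A f) = twHom θ A (ℓ f) := by
  refine congrArg (Tw.equiv θ A).symm (a₂ := algebraMap L (Tw θ A) (ℓ f)) ?_
  rw [Algebra.algebraMap_eq_smul_one]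
  rfl

theorem evalTensor_mem (ℓ : P →ₗ[L] L) (m : ℕ) (x : TwT θ P A) (hx : x ∈ wIdeal θ P A ^ m) :
    evalTensor θ A ℓ x ∈ varIdeal n A ^ m := by
  refine mem_wIdeal_pow_induction θ m (p := fun x => evalTensor θ A ℓ x ∈ varIdeal n A ^ m) ?_
    (fun x y hx hy => ?_) (fun y b hb => ?_) x hx
  · rw [map_zero]
    exact zero_mem _
  · rw [map_add]
    exact add_mem hx hy
  · rw [evalTensor_mul_right, RingEquiv.symm_apply_apply]
    exact Ideal.mul_mem_left _ _ hb

variable (A) in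
/-- The composition of `evalTensor` with the inclusion of `A[[w]]` into its (trivial) completion. -/
def evalTensorHat (ℓ : P →ₗ[L] L) :
    TwT θ P A →+ AdicCompletion (varIdeal n A) (MvPowerSeries (Fin n) A) :=
  (algebraMap (MvPowerSeries (Fin n) A)
    (AdicCompletion (varIdeal n A) (MvPowerSeries (Fin n) A)) : _ →+ _).comp (evalTensor θ A ℓ)

theorem evala_evalTensorHat (ℓ : P →ₗ[L] L) (m : ℕ) (x : TwT θ P A)
    (hx : x ∈ wIdeal θ P A ^ (m + 0)) :
    AdicCompletion.evalₐ (varIdeal n A) m (evalTensorHat θ A ℓ x) = 0 := by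
  change AdicCompletion.evalₐ _ m (algebraMap _ _ (evalTensor θ A ℓ x)) = 0
  rw [evala_algebraMap, Ideal.Quotient.eq_zero_iff_mem]
  exact evalTensor_mem θ ℓ m x hx

variable (A) in
/-- The continuous extension of `f ⊗ b ↦ θ(ℓ(f)) b` to `P ⊗̂_L A[[w]]`. -/
def evalHat (ℓ : P →ₗ[L] L) : Hat θ P A →+ MvPowerSeries (Fin n) A :=
  ((AdicCompletion.ofAlgEquiv (varIdeal n A)).symm :
      AdicCompletion (varIdeal n A) (MvPowerSeries (Fin n) A) →+ MvPowerSeries (Fin n) A).comp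
    (extAdd (wIdeal θ P A) (varIdeal n A) (evalTensorHat θ A ℓ) 0 (evala_evalTensorHat θ ℓ))

theorem evalHat_algebraMap (ℓ : P →ₗ[L] L) (x : TwT θ P A) :
    evalHat θ A ℓ (algebraMap _ _ x) = evalTensor θ A ℓ x := by
  refine (congrArg (AdicCompletion.ofAlgEquiv (varIdeal n A)).symm
    (extAdd_algebraMap _ _ _ _ _ x)).trans ?_
  exact AdicCompletion.ofAlgEquiv_symm_of _ _

theorem evalHat_mem (ℓ : P →ₗ[L] L) (m : ℕ) (x : Hat θ P A)
    (hx : AdicCompletion.evalₐ (wIdeal θ P A) m x = 0) : evalHat θ A ℓ x ∈ varIdeal n A ^ m := by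
  rw [← Ideal.Quotient.eq_zero_iff_mem]
  refine (AdicCompletion.mk_ofAlgEquiv_symm _ _ _).trans ?_
  refine (extAddFun_spec _ _ _ 0 (evala_evalTensorHat θ ℓ) x m 0 ?_).trans ?_
  · rw [map_zero]
    exact hx
  · rw [map_zero, map_zero]

theorem evalHat_cont (ℓ : P →ₗ[L] L) : SeriesCont θ (evalHat θ A ℓ) :=
  fun m => ⟨m, evalHat_mem θ ℓ m⟩

theorem evalHat_left (ℓ : P →ₗ[L] L) (f : P) :
    evalHat θ A ℓ (hatLeft θ P A f) = twHom θ A (ℓ f) :=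
  (evalHat_algebraMap θ ℓ _).trans (evalTensor_left θ ℓ f)

theorem evalHat_mul (ℓ : P →ₗ[L] L) (f : P) (b : Tw θ A) :
    evalHat θ A ℓ (hatLeft θ P A f * hatRight θ P A b) =
      twHom θ A (ℓ f) * (Tw.equiv θ A).symm b := by
  rw [← algebraMap_tmul, evalHat_algebraMap, evalTensor_mul_right, evalTensor_left]

theorem evalHat_mul_right (ℓ : P →ₗ[L] L) (x : Hat θ P A) (b : Tw θ A) :
    evalHat θ A ℓ (x * hatRight θ P A b) = evalHat θ A ℓ x * (Tw.equiv θ A).symm b := by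
  have h : (evalHat θ A ℓ).comp (AddMonoidHom.mulRight (hatRight θ P A b)) =
      (AddMonoidHom.mulLeft ((Tw.equiv θ A).symm b)).comp (evalHat θ A ℓ) := by
    refine SeriesCont.ext ((evalHat_cont θ ℓ).comp ((HatCont.id _).mulRight _))
      ((evalHat_cont θ ℓ).mulLeft _) fun f c => ?_
    simp only [AddMonoidHom.comp_apply, AddMonoidHom.coe_mulRight, AddMonoidHom.coe_mulLeft]
    rw [mul_assoc, ← map_mul, evalHat_mul, evalHat_mul, map_mul]
    ring
  refine (DFunLike.congr_fun h x).trans ?_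
  rw [AddMonoidHom.comp_apply, AddMonoidHom.coe_mulLeft, mul_comm]

theorem evalHat_hatLin (ℓ : P →ₗ[L] L) (T : P →ₗ[L] P) (x : Hat θ P A) :
    evalHat θ A ℓ (hatLin θ T x) = evalHat θ A (ℓ ∘ₗ T) x := by
  refine DFunLike.congr_fun (SeriesCont.ext ((evalHat_cont θ ℓ).comp (hatLin_cont θ T))
    (evalHat_cont θ (ℓ ∘ₗ T)) fun f c => ?_) x
  rw [AddMonoidHom.comp_apply, hatLin_mul, evalHat_mul, evalHat_mul, LinearMap.comp_apply]

theorem evalHat_hatMap [Algebra L B] (ℓ : P →ₗ[L] L) (g : A →ₐ[L] B) (x : Hat θ P A) :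
    evalHat θ B ℓ (hatMap θ (AlgHom.id L P) g x) =
      MvPowerSeries.map (g : A →+* B) (evalHat θ A ℓ x) := by
  have h1 : SeriesCont θ ((evalHat θ B ℓ).comp
      (hatMap θ (AlgHom.id L P) g : Hat θ P A →+ Hat θ P B)) :=
    (evalHat_cont θ ℓ).comp (hatMap_cont θ _ g)
  have h2 : SeriesCont θ ((MvPowerSeries.map (σ := Fin n) (g : A →+* B)).toAddMonoidHom.comp
      (evalHat θ A ℓ : Hat θ P A →+ _)) := by
    refine (evalHat_cont θ ℓ).postcomp fun m => ⟨m, fun x hx => ?_⟩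
    rw [mem_varIdeal_pow_iff] at hx ⊢
    intro l hl
    change MvPowerSeries.coeff l (MvPowerSeries.map (g : A →+* B) x) = 0
    rw [MvPowerSeries.coeff_map, hx l hl, map_zero]
  have h3 := h1.ext h2 fun f c => by
    rw [AddMonoidHom.comp_apply, AddMonoidHom.comp_apply, AddMonoidHom.coe_coe, map_mul,
      hatMap_left, hatMap_right, evalHat_mul, evalHat_mul, AlgHom.id_apply]
    change _ = MvPowerSeries.map (g : A →+* B) _
    rw [map_mul, map_twHom]
    rfl
  exact DFunLike.congr_fun h3 x

/-- Compatibility of the evaluations with the iterative derivations. -/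
theorem evalHat_hatOp (ℓ : P →ₗ[L] L) (δ : P →ₐ[L] Tw θ P)
    (hδ : ∀ m f, ℓ (MvPowerSeries.coeff m ((Tw.equiv θ P).symm (δ f))) = θ.op m (ℓ f))
    (m : Fin n →₀ ℕ) (x : Hat θ P A) :
    evalHat θ A ℓ (hatOp θ δ m x) = hasse m (evalHat θ A ℓ x) := by
  let h : MvPowerSeries (Fin n) A →+ MvPowerSeries (Fin n) A :=
    (MvPowerSeries.coeff (R := MvPowerSeries (Fin n) A) m).toAddMonoidHom.comp
      (taylor : _ →+* _).toAddMonoidHom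
  refine DFunLike.congr_fun (f := (evalHat θ A ℓ).comp (hatOp θ δ m)) (g := h.comp (evalHat θ A ℓ))
    (SeriesCont.ext ((evalHat_cont θ ℓ).comp (hatOp_cont θ δ m))
    ((evalHat_cont θ ℓ).postcomp fun N => ⟨N + m.degree, fun x hx => ?_⟩) fun f c => ?_) x
  · change hasse m x ∈ _
    rw [mem_varIdeal_pow_iff] at hx ⊢
    intro l hl
    rw [coeff_hasse, hx _ (by rw [map_add]; omega), smul_zero]
  · change evalHat θ A ℓ (hatOp θ δ m _) = hasse m (evalHat θ A ℓ _)
    rw [hatOp_mul, map_sum, evalHat_mul, hasse_mul]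
    refine Finset.sum_congr rfl fun p _ => ?_
    rw [hatOp_left, evalHat_mul, hδ, hasse_twHom]
    rfl

/-- The evaluation along a form `ℓ` with `ℓ(f g) = ∑ μᵢ(f) νᵢ(g)` satisfies the same product formula. -/
theorem evalHat_mul_eq_sum {ι : Type*} (s : Finset ι) (ℓ : P →ₗ[L] L) (μ ν : ι → P →ₗ[L] L)
    (h : ∀ f g, ℓ (f * g) = ∑ i ∈ s, μ i f * ν i g) (x y : Hat θ P A) :
    evalHat θ A ℓ (x * y) = ∑ i ∈ s, evalHat θ A (μ i) x * evalHat θ A (ν i) y := by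
  have h1 : ∀ (f : P) (c : Tw θ A) (y : Hat θ P A),
      evalHat θ A ℓ (hatLeft θ P A f * hatRight θ P A c * y) =
        ∑ i ∈ s, evalHat θ A (μ i) (hatLeft θ P A f * hatRight θ P A c) * evalHat θ A (ν i) y := by
    intro f c y
    have := SeriesCont.ext
      ((evalHat_cont θ ℓ).comp ((HatCont.id _).mulLeft (hatLeft θ P A f * hatRight θ P A c)))
      (SeriesCont.sum s fun i _ => (evalHat_cont θ (ν i)).mulLeft
        (evalHat θ A (μ i) (hatLeft θ P A f * hatRight θ P A c))) fun g d => by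
      simp only [AddMonoidHom.comp_apply, AddMonoidHom.coe_mulLeft, AddMonoidHom.finsetSum_apply,
        AddMonoidHom.id_apply]
      rw [mul_mul_mul_comm, ← map_mul, ← map_mul, evalHat_mul, h, map_sum, Finset.sum_mul]
      refine Finset.sum_congr rfl fun i _ => ?_
      rw [evalHat_mul, evalHat_mul, map_mul, map_mul]
      ring
    refine (DFunLike.congr_fun this y).trans ?_
    simp only [AddMonoidHom.comp_apply, AddMonoidHom.coe_mulLeft, AddMonoidHom.finsetSum_apply]
  have := SeriesCont.ext
    ((evalHat_cont θ ℓ).comp ((HatCont.id _).mulRight y))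
    (SeriesCont.sum s fun i _ => (evalHat_cont θ (μ i)).mulLeft (evalHat θ A (ν i) y)) fun f c => by
    simp only [AddMonoidHom.comp_apply, AddMonoidHom.coe_mulLeft, AddMonoidHom.finsetSum_apply,
      AddMonoidHom.id_apply, AddMonoidHom.coe_mulRight]
    rw [h1]
    exact Finset.sum_congr rfl fun i _ => mul_comm _ _
  refine (DFunLike.congr_fun this x).trans ?_
  simp only [AddMonoidHom.comp_apply, AddMonoidHom.coe_mulLeft, AddMonoidHom.finsetSum_apply]
  exact Finset.sum_congr rfl fun i _ => mul_comm _ _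

end Evaluation

/-! ### Joint injectivity of the evaluations -/

section Injectivity

/-- Over a semisimple ring, linear forms that separate the points of `P` separate those of `P ⊗ V`:
as `V` is projective, an element of `P ⊗ V` is determined by its images under `id ⊗ ℓ`, `ℓ ∈ V*`. -/
theorem eq_zero_of_forall_rTensor {L P V ι : Type*} [CommRing L] [IsSemisimpleRing L]
    [AddCommGroup P] [Module L P] [AddCommGroup V] [Module L V] (ℓ : ι → P →ₗ[L] L)
    (hℓ : ∀ f, (∀ d, ℓ d f = 0) → f = 0) (y : P ⊗[L] V)
    (hy : ∀ d, LinearMap.rTensor V (ℓ d) y = 0) : y = 0 := by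
  classical
  have hproj := Module.projective_of_isSemisimpleRing L V
  obtain ⟨s, hs⟩ := Module.projective_def'.1 hproj
  -- the section `s` of `V` in a free module reduces the claim to the coordinate forms of `s`
  have h1 : ∀ r : V →ₗ[L] L, LinearMap.lTensor P r y = 0 := by
    intro r
    apply (TensorProduct.rid L P).injective
    rw [map_zero]
    refine hℓ _ fun d => ?_
    have h2 : ∀ z : P ⊗[L] V, ℓ d (TensorProduct.rid L P (LinearMap.lTensor P r z)) =
        r (TensorProduct.lid L V (LinearMap.rTensor V (ℓ d) z)) := by
      intro z
      induction z with
      | zero => simp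
      | add a b ha hb => simp only [map_add, ha, hb]
      | tmul a b => simp [mul_comm]
    rw [h2, hy, map_zero, map_zero]
  have h3 : LinearMap.lTensor P s y = 0 := by
    apply (TensorProduct.finsuppScalarRight L L P V).injective
    ext v
    rw [TensorProduct.finsuppScalarRight_apply, ← LinearMap.comp_apply, ← LinearMap.lTensor_comp, h1]
    simp
  have h4 : LinearMap.lTensor P (Finsupp.linearCombination L id) (LinearMap.lTensor P s y) = y := by
    rw [← LinearMap.comp_apply, ← LinearMap.lTensor_comp, hs, LinearMap.lTensor_id, LinearMap.id_apply]
  rw [← h4, h3, map_zero]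

variable {k L : Type*} [CommRing k] [CommRing L] [Algebra k L] {n : ℕ}
  (θ : IterativeDerivation k L n) {P A : Type*} [CommRing P] [Algebra L P]
  [CommRing A] [Algebra L A]

variable (A) in
/-- The ideal `(w) ^ M` of `A[[w]]` as an `L`-submodule, for the structure given by `θ`. -/
def twPow (M : ℕ) : Submodule L (Tw θ A) :=
  ((varIdeal n A ^ M).map (Tw.equiv θ A : MvPowerSeries (Fin n) A →+* Tw θ A)).restrictScalars L

theorem mem_twPow (M : ℕ) (b : Tw θ A) :
    b ∈ twPow θ A M ↔ (Tw.equiv θ A).symm b ∈ varIdeal n A ^ M := by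
  refine (Ideal.mem_map_iff_of_surjective _ (Tw.equiv θ A).surjective).trans ⟨?_, fun h => ⟨_, h, ?_⟩⟩
  · rintro ⟨x, hx, rfl⟩
    exact hx
  · exact (Tw.equiv θ A).apply_symm_apply b

theorem right_mem_wIdeal_pow (M : ℕ) {b : Tw θ A} (hb : b ∈ twPow θ A M) :
    TwT.right θ P A b ∈ wIdeal θ P A ^ M := by
  rw [wIdeal, ← Ideal.map_pow]
  refine Ideal.mem_map_of_mem _ ?_
  have h : b ∈ (varIdeal n A ^ M).map (Tw.equiv θ A : MvPowerSeries (Fin n) A →+* Tw θ A) := hb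
  rw [Ideal.map_pow, Ideal.map_span, ← Set.range_comp] at h
  exact h

/-- The ideal `(w) ^ M` is the kernel of `P ⊗ A[[w]] → P ⊗ A[[w]] / (w) ^ M`. -/
theorem mem_wIdeal_pow_of_lTensor (M : ℕ) (r : TwT θ P A)
    (h : LinearMap.lTensor P (twPow θ A M).mkQ (r : P ⊗[L] Tw θ A) = 0) :
    r ∈ wIdeal θ P A ^ M := by
  have hex := lTensor_exact P (LinearMap.exact_subtype_mkQ (twPow θ A M))
    (twPow θ A M).mkQ_surjective
  obtain ⟨z, rfl⟩ := (hex r).1 h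
  clear h hex
  induction z with
  | zero =>
    rw [map_zero]
    exact zero_mem (wIdeal θ P A ^ M)
  | add a b ha hb =>
    rw [map_add]
    exact add_mem (S := Ideal (TwT θ P A)) ha hb
  | tmul p b =>
    rw [LinearMap.lTensor_tmul, TwT.tmul_eq]
    exact Ideal.mul_mem_left _ _ (right_mem_wIdeal_pow θ M b.2)

/-- Linear forms that separate the points of `P` give jointly injective evaluations: modulo `(w) ^ M` the
tensor product is `P ⊗ A[[w]] / (w) ^ M`. -/
theorem hat_eq_zero_of_forall_evalHat [IsSemisimpleRing L] {ι : Type*} (ℓ : ι → P →ₗ[L] L)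
    (hℓ : ∀ f, (∀ d, ℓ d f = 0) → f = 0) (x : Hat θ P A)
    (hx : ∀ d, evalHat θ A (ℓ d) x = 0) : x = 0 := by
  refine AdicCompletion.ext_evalₐ fun M => ?_
  rw [map_zero]
  obtain ⟨r, hr⟩ := exists_rep (wIdeal θ P A) M x
  have h1 : ∀ d, evalTensor θ A (ℓ d) r ∈ varIdeal n A ^ M := by
    intro d
    have := evalHat_mem θ (ℓ d) M _ hr
    rwa [map_sub, hx, zero_sub, evalHat_algebraMap, neg_mem_iff] at this
  have h2 : r ∈ wIdeal θ P A ^ M := by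
    refine mem_wIdeal_pow_of_lTensor θ M r (eq_zero_of_forall_rTensor ℓ hℓ _ fun d => ?_)
    apply (TensorProduct.lid L _).injective
    have h3 : ∀ z : P ⊗[L] Tw θ A, TensorProduct.lid L _ (LinearMap.rTensor _ (ℓ d)
        (LinearMap.lTensor P (twPow θ A M).mkQ z)) =
        (twPow θ A M).mkQ (TensorProduct.lid L _ (LinearMap.rTensor (Tw θ A) (ℓ d) z)) := by
      intro z
      induction z with
      | zero => simp
      | add a b ha hb => simp only [map_add, ha, hb]
      | tmul a b => simp
    refine (h3 r).trans ?_
    rw [map_zero, Submodule.mkQ_apply, Submodule.Quotient.mk_eq_zero, mem_twPow]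
    exact h1 d
  rw [map_sub, evala_algebraMap, Ideal.Quotient.eq_zero_iff_mem.2 h2, sub_zero] at hr
  exact hr

end Injectivity

/-! ### Taylor expansion along a transformation -/

section Shift

variable {k L : Type*} [CommRing k] [CommRing L] [Algebra k L] {n : ℕ}
  (θ : IterativeDerivation k L n) {P A : Type*} [CommRing P] [Algebra L P]
  [CommRing A] [Algebra L A]

/-- The multi-indices of degree at most `N`. -/
def degreeLE (n N : ℕ) : Finset (Fin n →₀ ℕ) := (Finsupp.finite_of_degree_le N).toFinset

theorem mem_degreeLE {N : ℕ} {m : Fin n →₀ ℕ} : m ∈ degreeLE n N ↔ m.degree ≤ N := by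
  simp [degreeLE]

/-- Convergence of the series `∑ cₘ ⊗ bₘ` if the `bₘ` tend to zero. -/
theorem exists_hat_sum (c : (Fin n →₀ ℕ) → P) (b : (Fin n →₀ ℕ) → MvPowerSeries (Fin n) A) (d : ℕ)
    (hb : ∀ M m, M + d ≤ m.degree → b m ∈ varIdeal n A ^ M) :
    ∃ E : Hat θ P A, ∀ N, AdicCompletion.evalₐ (wIdeal θ P A) N
      (E - ∑ m ∈ degreeLE n (N + d), hatLeft θ P A (c m) * hatRight θ P A (Tw.equiv θ A (b m))) = 0 := by
  classical
  let t : ℕ → TwT θ P A := fun N => ∑ m ∈ degreeLE n (N + d),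
    TwT.left θ P A (c m) * TwT.right θ P A (Tw.equiv θ A (b m))
  have ht : ∀ N, t N ≡ t (N + 1) [SMOD ((wIdeal θ P A) ^ N • ⊤ : Submodule (TwT θ P A) (TwT θ P A))] := by
    intro N
    rw [SModEq.comm, SModEq.sub_mem, smul_eq_mul, Ideal.mul_top]
    have hsub : degreeLE n (N + d) ⊆ degreeLE n (N + 1 + d) := fun m hm =>
      mem_degreeLE.2 ((mem_degreeLE.1 hm).trans (by omega))
    simp only [t]
    rw [← Finset.sum_sdiff hsub, add_sub_cancel_right]
    refine sum_mem fun m hm => Ideal.mul_mem_left _ _ (right_mem_wIdeal_pow θ N ?_)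
    rw [Finset.mem_sdiff, mem_degreeLE, mem_degreeLE] at hm
    rw [mem_twPow]
    exact hb N m (by omega)
  refine ⟨AdicCompletion.mk _ _ (AdicCompletion.AdicCauchySequence.mk _ _ t ht), fun N => ?_⟩
  have h1 : (∑ m ∈ degreeLE n (N + d), hatLeft θ P A (c m) * hatRight θ P A (Tw.equiv θ A (b m))) =
      algebraMap (TwT θ P A) (Hat θ P A) (t N) := by
    rw [map_sum]
    exact Finset.sum_congr rfl fun m _ => (algebraMap_tmul θ _ _).symm
  rw [h1, map_sub, evala_algebraMap, AdicCompletion.evalₐ_mk, sub_eq_zero]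
  rfl

/-- A continuous `A[[w]]`-linear map to `A[[w]]` that is compatible with the iterative derivations. -/
structure IsEvaluation (δ : P →ₐ[L] Tw θ P) (F : Hat θ P A →+ MvPowerSeries (Fin n) A) : Prop where
  cont : SeriesCont θ F
  mul_right : ∀ x b, F (x * hatRight θ P A b) = F x * (Tw.equiv θ A).symm b
  hatOp : ∀ m x, F (hatOp θ δ m x) = hasse m (F x)

/-- The Taylor expansion `∑ₘ δ^{(m)}(f) ⊗ (Ψ - w)^m` converges, and every evaluation maps it to the
Taylor expansion of a power series at `Ψ`. -/
theorem exists_shift (δ : P →ₐ[L] Tw θ P) (Ψ : Gamma n A) (f : P) :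
    ∃ E : Hat θ P A, ∀ F : Hat θ P A →+ MvPowerSeries (Fin n) A, IsEvaluation θ δ F →
      F E = Ψ.substHom (F (hatLeft θ P A f)) := by
  have hn : ∀ i, IsNilpotent (MvPowerSeries.constantCoeff (Ψ.1 i - MvPowerSeries.X i)) := by
    intro i
    rw [map_sub, MvPowerSeries.constantCoeff_X, sub_zero]
    exact Ψ.isNilpotent_constantCoeff i
  obtain ⟨d, hd⟩ := exists_pow_le_varIdeal_pow hn
  have hb : ∀ M (m : Fin n →₀ ℕ), M + d ≤ m.degree →
      ∏ i, (Ψ.1 i - MvPowerSeries.X i) ^ m i ∈ varIdeal n A ^ M := fun M m hm =>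
    hd M (Ideal.pow_le_pow_right hm (prod_pow_mem_span_pow _ m))
  obtain ⟨E, hE⟩ := exists_hat_sum θ (P := P)
    (fun m => MvPowerSeries.coeff m ((Tw.equiv θ P).symm (δ f))) _ d hb
  refine ⟨E, fun F hF => eq_of_forall_sub_mem fun M => ?_⟩
  obtain ⟨N, hN⟩ := hF.cont M
  have h1 := hN _ (evala_of_le _ (le_max_left N M) (hE (max N M)))
  have h2 := subst_sub_sum_hasse_mem Ψ.isNilpotent_constantCoeff (F (hatLeft θ P A f)) M
    (degreeLE n (max N M + d)) fun m hm => hb M m (by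
      rw [mem_degreeLE] at hm
      have := le_max_right N M
      omega)
  rw [← Ψ.substHom_apply] at h2
  rw [map_sub, map_sum] at h1
  have h3 : ∀ m, F (hatLeft θ P A (MvPowerSeries.coeff m ((Tw.equiv θ P).symm (δ f))) *
      hatRight θ P A (Tw.equiv θ A (∏ i, (Ψ.1 i - MvPowerSeries.X i) ^ m i))) =
      hasse m (F (hatLeft θ P A f)) * ∏ i, (Ψ.1 i - MvPowerSeries.X i) ^ m i := by
    intro m
    rw [hF.mul_right, ← hatOp_left, hF.hatOp, RingEquiv.symm_apply_apply]
  simp only [h3] at h1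
  have := sub_mem h1 h2
  rwa [sub_sub_sub_cancel_right] at this

/-- The element `∑ₘ δ^{(m)}(f) ⊗ (Ψ - w)^m` of `P ⊗̂_L A[[w]]`, the "value of `f` at `Ψ`". -/
def shift (δ : P →ₐ[L] Tw θ P) (Ψ : Gamma n A) (f : P) : Hat θ P A :=
  (exists_shift θ δ Ψ f).choose

theorem IsEvaluation.apply_shift {θ : IterativeDerivation k L n} {δ : P →ₐ[L] Tw θ P}
    {F : Hat θ P A →+ MvPowerSeries (Fin n) A}
    (hF : IsEvaluation θ δ F) (Ψ : Gamma n A) (f : P) :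
    F (shift θ δ Ψ f) = Ψ.substHom (F (hatLeft θ P A f)) :=
  (exists_shift θ δ Ψ f).choose_spec F hF

end Shift

/-! ### The transformation attached to an automorphism -/

section

variable {k L : Type*} [CommRing k] [CommRing L] [Algebra k L] {n : ℕ}
  {θ : IterativeDerivation k L n} {P Q ι A : Type*} [CommRing P] [Algebra L P]
  [CommRing Q] [Algebra L Q] [CommRing A] [Algebra L A]
  {δ : P →ₐ[L] Tw θ P} {act : ι → P →ₗ[L] P} {inc : Q →ₐ[L] P}

theorem IsEvaluation.comp_aut {F : Hat θ P A →+ MvPowerSeries (Fin n) A}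
    (hF : IsEvaluation θ δ F) (φ : AutGroup θ δ act inc A) :
    IsEvaluation θ δ (F.comp ((φ.1 : Hat θ P A →+* Hat θ P A) : Hat θ P A →+ Hat θ P A)) where
  cont := hF.cont.comp (AutGroup.cont φ)
  mul_right x b := by
    simp only [AddMonoidHom.comp_apply, AddMonoidHom.coe_coe, RingHom.coe_coe, map_mul,
      AutGroup.fix_right, hF.mul_right]
  hatOp m x := by
    simp only [AddMonoidHom.comp_apply, AddMonoidHom.coe_coe, RingHom.coe_coe, φ.2.2.1, hF.hatOp]

end

section Hull

variable {C D k L : Type*} [CommRing C] [Ring D] [Bialgebra C D]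
  [CommRing k] [CommRing L] [Algebra C k] [Algebra C L] [Algebra k L] [IsScalarTower C k L] {n : ℕ}
  (M : ModuleAlgebra C D L) (θ : IterativeDerivation k L n)

/-- The evaluation `f ↦ f(d)` on `𝓛`. -/
def hullEval (d : D) : galoisHull M θ →ₗ[L] L where
  toFun f := f.1 d
  map_add' _ _ := rfl
  map_smul' _ _ := rfl

/-- The homomorphism `ρ : L → 𝓛`. -/
def hullRho : L →+* galoisHull M θ :=
  (M.rho : L →+* Conv C D L).codRestrict (galoisHull M θ) (rho_mem_galoisHull M θ)

theorem hullEval_hullRho (d : D) (a : L) : hullEval M θ d (hullRho M θ a) = M.act d a := rfl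

theorem hullEval_hullAct (d e : D) (f : galoisHull M θ) :
    hullEval M θ e (hullAct M θ d f) = hullEval M θ (e * d) f := rfl

theorem hullAct_hullRho (d : D) (a : L) :
    hullAct M θ d (hullRho M θ a) = hullRho M θ (M.act d a) :=
  Subtype.ext (actInt_rho M d a)

theorem eq_zero_of_forall_hullEval (f : galoisHull M θ) (h : ∀ d, hullEval M θ d f = 0) : f = 0 :=
  Subtype.ext (WithConv.ext (LinearMap.ext h))

theorem hullEval_mul {ι : Type*} {d : D} (r : Coalgebra.Repr C d ι) (f g : galoisHull M θ) :
    hullEval M θ d (f * g) =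
      ∑ i ∈ r.index, hullEval M θ (r.left i) f * hullEval M θ (r.right i) g := by
  change LinearMap.mul' C L (TensorProduct.map f.1.ofConv g.1.ofConv
    (Coalgebra.comul (R := C) d)) = _
  rw [← r.eq, map_sum, map_sum]
  exact Finset.sum_congr rfl fun i _ => by rw [TensorProduct.map_tmul, LinearMap.mul'_apply]; rfl

theorem hullEval_one_mul (f g : galoisHull M θ) :
    hullEval M θ 1 (f * g) = hullEval M θ 1 f * hullEval M θ 1 g := by
  change LinearMap.mul' C L (TensorProduct.map f.1.ofConv g.1.ofConv
    (Coalgebra.comul (R := C) 1)) = _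
  rw [Bialgebra.comul_one, Algebra.TensorProduct.one_def, TensorProduct.map_tmul,
    LinearMap.mul'_apply]
  rfl

/-- A subalgebra of `𝓛` that contains `ρ(L)` and is stable under the iterative derivation is `𝓛`. -/
theorem hull_induction {S : Subalgebra L (galoisHull M θ)} (hρ : ∀ a, hullRho M θ a ∈ S)
    (hop : ∀ m, ∀ f ∈ S, hullOp M θ m f ∈ S) (f : galoisHull M θ) : f ∈ S := by
  have h := Algebra.mem_sInf.1 f.2 (S.map (galoisHull M θ).val)
    ⟨fun a => ⟨_, hρ a, rfl⟩, by
      rintro m _ ⟨g, hg, rfl⟩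
      exact ⟨_, hop m g hg, rfl⟩⟩
  obtain ⟨g, hg, hgf⟩ := h
  rwa [← Subtype.ext hgf]

variable [Coalgebra.IsCocomm C D] {A B : Type*} [CommRing A] [Algebra L A] [CommRing B] [Algebra L B]

theorem isEvaluation_evalHat (d : D) :
    IsEvaluation θ (hullTheta M θ) (evalHat θ A (hullEval M θ d)) where
  cont := evalHat_cont θ _
  mul_right := evalHat_mul_right θ _
  hatOp := evalHat_hatOp θ _ _ fun _ _ => rfl

theorem hatOp_hullTheta (m : Fin n →₀ ℕ) (f : galoisHull M θ) :
    hatOp θ (hullTheta M θ) m (hatLeft θ _ A f) = hatLeft θ _ A (hullOp M θ m f) :=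
  hatOp_left θ _ m f

theorem hat_ext_of_evalHat [IsSemisimpleRing L] {x y : Hat θ (galoisHull M θ) A}
    (h : ∀ d, evalHat θ A (hullEval M θ d) x = evalHat θ A (hullEval M θ d) y) : x = y := by
  rw [← sub_eq_zero]
  refine hat_eq_zero_of_forall_evalHat θ (hullEval M θ) (eq_zero_of_forall_hullEval M θ) _ fun d => ?_
  rw [map_sub, h, sub_self]

variable (A) in
/-- The homomorphism `𝓛 ⊗̂_L A[[w]] → A[[w]]`, `f ⊗ b ↦ θ(f(1)) b`. -/
def evalOne : Hat θ (galoisHull M θ) A →+* MvPowerSeries (Fin n) A where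
  __ := evalHat θ A (hullEval M θ 1)
  map_one' := by
    have h := evalHat_left θ (A := A) (hullEval M θ 1) 1
    rw [map_one] at h
    refine h.trans ?_
    have h1 : hullEval M θ 1 (1 : galoisHull M θ) = 1 := by
      rw [← map_one (hullRho M θ), hullEval_hullRho, M.one_act]
    rw [h1, map_one]
  map_mul' x y := by
    have := evalHat_mul_eq_sum θ (A := A) (Finset.univ : Finset Unit) (hullEval M θ 1)
      (fun _ => hullEval M θ 1) (fun _ => hullEval M θ 1) (fun f g => by
        rw [Finset.univ_unique, Finset.sum_singleton, hullEval_one_mul]) x y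
    rwa [Finset.univ_unique, Finset.sum_singleton] at this

theorem evalOne_apply (x : Hat θ (galoisHull M θ) A) :
    evalOne M θ A x = evalHat θ A (hullEval M θ 1) x := rfl

theorem evalOne_hullRho (a : L) :
    evalOne M θ A (hatLeft θ _ A (hullRho M θ a)) = twHom θ A a := by
  rw [evalOne_apply, evalHat_left, hullEval_hullRho, M.one_act]

theorem evalOne_hatLin (d : D) (x : Hat θ (galoisHull M θ) A) :
    evalOne M θ A (hatLin θ (hullAct M θ d) x) = evalHat θ A (hullEval M θ d) x := by
  rw [evalOne_apply, evalHat_hatLin]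
  congr 2
  ext f
  rw [LinearMap.comp_apply, hullEval_hullAct, one_mul]

/-- The automorphism group `Ume(L|k)(A)`. -/
abbrev UmeGroup (A : Type*) [CommRing A] [Algebra L A] : Type _ :=
  AutGroup θ (hullTheta M θ) (hullAct M θ) (Subalgebra.inclusion (galoisBase_le M θ)) A

variable {M θ}

/-- The homomorphism `L → A[[w]]`, `a ↦ φ(ρ(a))(1)`. -/
def autHom (φ : UmeGroup M θ A) : L →+* MvPowerSeries (Fin n) A :=
  (evalOne M θ A).comp (((φ.1 : Hat θ (galoisHull M θ) A →+* _)).comp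
    ((hatLeft θ (galoisHull M θ) A : _ →+* _).comp (hullRho M θ)))

theorem autHom_apply (φ : UmeGroup M θ A) (a : L) :
    autHom φ a = evalOne M θ A (φ.1 (hatLeft θ _ A (hullRho M θ a))) := rfl

theorem map_autHom (φ : UmeGroup M θ A) (a : L) :
    MvPowerSeries.map (Ideal.Quotient.mk (nilradical A)) (autHom φ a) =
      MvPowerSeries.map (Ideal.Quotient.mk (nilradical A)) (twHom θ A a) := by
  rw [← evalOne_hullRho M θ, autHom_apply]
  have h := φ.2.2.2.2 (hatLeft θ _ A (hullRho M θ a))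
  have h2 := congrArg (evalHat θ (A ⧸ nilradical A) (hullEval M θ 1)) h
  rw [evalHat_hatMap, evalHat_hatMap] at h2
  exact h2

theorem autHom_algebraMap (φ : UmeGroup M θ A) (a : k) :
    autHom φ (algebraMap k L a) = MvPowerSeries.C (algebraMap L A (algebraMap k L a)) := by
  have h1 : M.rho (algebraMap k L a) ∈ galoisBase k M :=
    Algebra.subset_adjoin (Set.mem_range_self (f := fun a : k => M.rho (algebraMap k L a)) a)
  have h2 := AutGroup.fix_base φ ⟨_, h1⟩
  have h3 : Subalgebra.inclusion (galoisBase_le M θ) ⟨_, h1⟩ = hullRho M θ (algebraMap k L a) := rfl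
  rw [h3] at h2
  rw [autHom_apply, h2, evalOne_hullRho, twHom_apply, AlgHom.commutes,
    MvPowerSeries.algebraMap_apply, MvPowerSeries.map_C]

variable {u : Fin n → L}

theorem twHom_of_isAssociated (hθ : θ.IsAssociated u) (i : Fin n) :
    twHom θ A (u i) = MvPowerSeries.C (algebraMap L A (u i)) + MvPowerSeries.X i := by
  rw [twHom_apply, hθ, map_add, MvPowerSeries.map_C, MvPowerSeries.map_X]

/-- The transformation attached to an automorphism `φ`: its `i`-th component is
`φ(ρ(uᵢ))(1) - uᵢ`. -/
def gammaOfAut (hθ : θ.IsAssociated u) (φ : UmeGroup M θ A) : Gamma n A :=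
  ⟨fun i => autHom φ (u i) - MvPowerSeries.C (algebraMap L A (u i)), (mem_gamma_iff _).2 fun i => by
    rw [map_sub, map_autHom, twHom_of_isAssociated hθ, map_add, MvPowerSeries.map_X,
      add_sub_cancel_left]⟩

theorem autHom_basis (hθ : θ.IsAssociated u) (φ : UmeGroup M θ A) (i : Fin n) :
    autHom φ (u i) = MvPowerSeries.C (algebraMap L A (u i)) + (gammaOfAut hθ φ).1 i :=
  (add_sub_cancel _ _).symm

theorem Gamma.substHom_C (Φ : Gamma n A) (a : A) :
    Φ.substHom (MvPowerSeries.C a) = MvPowerSeries.C a := Φ.substHom.commutes a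

theorem Gamma.map_substHom (Φ : Gamma n A) (f : MvPowerSeries (Fin n) A) :
    MvPowerSeries.map (Ideal.Quotient.mk (nilradical A)) (Φ.substHom f) =
      MvPowerSeries.map (Ideal.Quotient.mk (nilradical A)) f := by
  rw [Gamma.substHom_apply, MvPowerSeries.map_subst Φ.hasSubst]
  have : (fun i => MvPowerSeries.map (Ideal.Quotient.mk (nilradical A)) (Φ.1 i)) =
      MvPowerSeries.X := funext fun i => (mem_gamma_iff _).1 Φ.2 i
  rw [this, MvPowerSeries.subst_self, id]

theorem Gamma.substHom_twHom_basis (hθ : θ.IsAssociated u) (Φ : Gamma n A) (i : Fin n) :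
    Φ.substHom (twHom θ A (u i)) = MvPowerSeries.C (algebraMap L A (u i)) + Φ.1 i := by
  rw [twHom_of_isAssociated hθ, map_add, Gamma.substHom_C, Gamma.substHom_X]

theorem mem_jacobson_of_map_nilradical {f : MvPowerSeries (Fin n) A}
    (h : MvPowerSeries.map (Ideal.Quotient.mk (nilradical A)) f = 0) :
    f ∈ Ideal.jacobson (⊥ : Ideal (MvPowerSeries (Fin n) A)) := by
  refine mem_jacobson_bot_of_constantCoeff ?_
  have h1 := congrArg MvPowerSeries.constantCoeff h
  rw [MvPowerSeries.constantCoeff_map, map_zero, Ideal.Quotient.eq_zero_iff_mem] at h1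
  exact Ideal.radical_le_jacobson h1

theorem gammaOfAut_one (hθ : θ.IsAssociated u) : gammaOfAut hθ (1 : UmeGroup M θ A) = 1 := by
  refine Gamma.ext fun i => ?_
  have h1 := autHom_basis hθ (1 : UmeGroup M θ A) i
  rw [autHom_apply, OneMemClass.coe_one, RingAut.one_apply, evalOne_hullRho,
    twHom_of_isAssociated hθ, add_right_inj] at h1
  rw [← h1, Gamma.one_val]

variable (M θ) in
/-- The homomorphism `Ume(L|k)(A) → Ume(L|k)(B)` induced by `A → B`. -/
abbrev umeMap (g : A →ₐ[L] B) : UmeGroup M θ A →* UmeGroup M θ B :=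
  autMap (hullTheta M θ) (hullAct M θ) (Subalgebra.inclusion (galoisBase_le M θ)) g

theorem umeMap_left (g : A →ₐ[L] B) (φ : UmeGroup M θ A) (f : galoisHull M θ) :
    (umeMap M θ g φ).1 (hatLeft θ _ B f) =
      hatMap θ (AlgHom.id L _) g (φ.1 (hatLeft θ _ A f)) := autExt_left g φ f

theorem autHom_umeMap (g : A →ₐ[L] B) (φ : UmeGroup M θ A) (a : L) :
    autHom (umeMap M θ g φ) a = MvPowerSeries.map (g : A →+* B) (autHom φ a) := by
  rw [autHom_apply, autHom_apply, umeMap_left, evalOne_apply, evalOne_apply, evalHat_hatMap]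

theorem gammaOfAut_umeMap (hθ : θ.IsAssociated u) (g : A →ₐ[L] B) (φ : UmeGroup M θ A) :
    gammaOfAut hθ (umeMap M θ g φ) = Gamma.map (g : A →+* B) (gammaOfAut hθ φ) := by
  refine Gamma.ext fun i => ?_
  have h1 := autHom_umeMap g φ (u i)
  rw [autHom_basis hθ, autHom_basis hθ φ, map_add, MvPowerSeries.map_C] at h1
  have h2 : (g : A →+* B) (algebraMap L A (u i)) = algebraMap L B (u i) := g.commutes _
  rw [h2, add_right_inj] at h1
  exact h1

/-- A continuous `A[[w]]`-linear homomorphism that commutes with the iterative derivation is determined by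
its values on `ρ(L)`. -/
theorem hat_ringHom_ext {F : Hat θ (galoisHull M θ) A →+* Hat θ (galoisHull M θ) A}
    {G : Hat θ (galoisHull M θ) A →+* Hat θ (galoisHull M θ) A}
    (hF : HatCont _ _ (F : Hat θ (galoisHull M θ) A →+ Hat θ (galoisHull M θ) A))
    (hG : HatCont _ _ (G : Hat θ (galoisHull M θ) A →+ Hat θ (galoisHull M θ) A))
    (hFr : ∀ b, F (hatRight θ _ A b) = hatRight θ _ A b)
    (hGr : ∀ b, G (hatRight θ _ A b) = hatRight θ _ A b)
    (hFo : ∀ m x, F (hatOp θ (hullTheta M θ) m x) = hatOp θ (hullTheta M θ) m (F x))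
    (hGo : ∀ m x, G (hatOp θ (hullTheta M θ) m x) = hatOp θ (hullTheta M θ) m (G x))
    (h : ∀ a, F (hatLeft θ _ A (hullRho M θ a)) = G (hatLeft θ _ A (hullRho M θ a))) : F = G := by
  have e : ∀ a : L, hatLeft θ (galoisHull M θ) A (algebraMap L _ a) =
      hatRight θ (galoisHull M θ) A (algebraMap L _ a) := fun a => by
    rw [AlgHom.commutes, AlgHom.commutes]
  let S : Subalgebra L (galoisHull M θ) :=
    { carrier := {f | F (hatLeft θ _ A f) = G (hatLeft θ _ A f)}
      add_mem' := fun {f g} hf hg => by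
        change F (hatLeft θ _ A (f + g)) = G (hatLeft θ _ A (f + g))
        rw [map_add, map_add, map_add, hf, hg]
      mul_mem' := fun {f g} hf hg => by
        change F (hatLeft θ _ A (f * g)) = G (hatLeft θ _ A (f * g))
        rw [map_mul, map_mul, map_mul, hf, hg]
      algebraMap_mem' := fun a => by
        change F (hatLeft θ _ A (algebraMap L _ a)) = G (hatLeft θ _ A (algebraMap L _ a))
        rw [e, hFr, hGr] }
  have hS : ∀ f, F (hatLeft θ _ A f) = G (hatLeft θ _ A f) :=
    fun f => hull_induction M θ (S := S) h (fun m f hf => by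
      change F (hatLeft θ _ A (hullOp M θ m f)) = G (hatLeft θ _ A (hullOp M θ m f))
      rw [← hatOp_hullTheta, hFo, hGo]
      exact congrArg _ hf) f
  have := hat_ext θ hF hG fun f b => by
    rw [AddMonoidHom.coe_coe, AddMonoidHom.coe_coe, map_mul, map_mul, hS, hFr, hGr]
  exact RingHom.ext fun x => DFunLike.congr_fun this x

end Hull

section Coordinates

variable {C D k L : Type*} [CommRing C] [Ring D] [Bialgebra C D] [Coalgebra.IsCocomm C D]
  [CommRing k] [IsArtinianRing k] [IsReduced k] [CommRing L] [IsArtinianRing L] [IsReduced L]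
  [Algebra C k] [Algebra C L] [Algebra k L] [IsScalarTower C k L] {n : ℕ}
  {M : ModuleAlgebra C D L} {θ : IterativeDerivation k L n} {u : Fin n → L}
  {A : Type*} [CommRing A] [Algebra L A]

/-- An automorphism `φ` moves `ρ(a)` along its transformation `Φ`, as both sides of
`φ(ρ(a))(1) = θ(a)(Φ)` are homomorphisms on `L` that agree on `k` and the `uᵢ`, and are congruent
modulo the nilradical. -/
theorem autHom_eq (hL : HasResidueExtensions k L n) (hu : IsResidueBasis k u)
    (hθ : θ.IsAssociated u) (φ : UmeGroup M θ A) (a : L) :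
    autHom φ a = (gammaOfAut hθ φ).substHom (twHom θ A a) := by
  have h := ringHom_ext_of_isResidueBasis hL hu (autHom φ)
    (((gammaOfAut hθ φ).substHom : _ →+* _).comp (twHom θ A)) (fun a => ?_) (fun i => ?_) fun a => ?_
  · exact RingHom.congr_fun h a
  · rw [autHom_algebraMap, RingHom.comp_apply, twHom_apply, AlgHom.commutes,
      MvPowerSeries.algebraMap_apply, MvPowerSeries.map_C]
    exact (Gamma.substHom_C _ _).symm
  · rw [autHom_basis hθ]
    exact (Gamma.substHom_twHom_basis hθ _ i).symm
  · refine mem_jacobson_of_map_nilradical ?_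
    rw [map_sub, map_autHom, sub_eq_zero]
    exact (Gamma.map_substHom _ _).symm

/-- Evaluating at `d ∈ D` amounts to evaluating `φ(ρ(d(a)))` at `1`, since `φ` commutes with `d`. -/
theorem aut_hullRho (hL : HasResidueExtensions k L n) (hu : IsResidueBasis k u)
    (hθ : θ.IsAssociated u) (φ : UmeGroup M θ A) (a : L) :
    φ.1 (hatLeft θ _ A (hullRho M θ a)) =
      shift θ (hullTheta M θ) (gammaOfAut hθ φ) (hullRho M θ a) := by
  have := IsArtinianRing.isSemisimpleRing_of_isReduced L
  refine hat_ext_of_evalHat M θ fun d => ?_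
  rw [(isEvaluation_evalHat M θ d).apply_shift, evalHat_left, hullEval_hullRho, ← evalOne_hatLin,
    ← φ.2.1, hatLin_left, hullAct_hullRho, ← autHom_apply, autHom_eq hL hu hθ]

/-- The map `x ↦ φ(x)(1)` is an evaluation in the sense of `IsEvaluation`, so its value at the Taylor
expansion `ψ(ρ(a))` is `φ(ρ(a))(1)` substituted at the transformation of `ψ`. -/
theorem gammaOfAut_mul (hL : HasResidueExtensions k L n) (hu : IsResidueBasis k u)
    (hθ : θ.IsAssociated u) (φ ψ : UmeGroup M θ A) :
    gammaOfAut hθ (φ * ψ) = gammaOfAut hθ φ * gammaOfAut hθ ψ := by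
  refine Gamma.ext fun i => ?_
  have h1 : autHom (φ * ψ) (u i) = (gammaOfAut hθ ψ).substHom (autHom φ (u i)) := by
    rw [autHom_apply, Subgroup.coe_mul, RingAut.mul_apply, aut_hullRho hL hu hθ ψ]
    exact ((isEvaluation_evalHat M θ 1).comp_aut φ).apply_shift _ _
  rw [autHom_basis hθ, autHom_basis hθ φ, map_add, Gamma.substHom_C, add_right_inj] at h1
  rw [h1, Gamma.mul_val, Gamma.substHom_apply]

theorem gammaOfAut_injective (hL : HasResidueExtensions k L n) (hu : IsResidueBasis k u)
    (hθ : θ.IsAssociated u) :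
    Function.Injective (gammaOfAut hθ : UmeGroup M θ A → Gamma n A) := by
  intro φ ψ h
  have := hat_ringHom_ext (AutGroup.cont φ) (AutGroup.cont ψ) (AutGroup.fix_right φ)
    (AutGroup.fix_right ψ) φ.2.2.1 ψ.2.2.1 fun a => by
      refine (aut_hullRho hL hu hθ φ a).trans ?_
      rw [h]
      exact (aut_hullRho hL hu hθ ψ a).symm
  exact Subtype.ext (RingEquiv.ext fun x => RingHom.congr_fun this x)

end Coordinates

/-! ### Endomorphisms congruent to the identity modulo the nilradical are injective -/

section Injective

/-- Nakayama's argument for a linear map `T` that is congruent to the identity, on the image `N` of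
a projector `π`, modulo an ideal `J` with `J ^ e W ⊆ Z`: if `T y ∈ Z` then `y ∈ Z`. -/
theorem mem_of_apply_mem {B W : Type*} [CommRing B] [AddCommGroup W] [Module B W]
    (T π : W →ₗ[B] W) (N Z : Submodule B W) (J : Ideal B) (e : ℕ)
    (hTZ : Z ≤ Z.comap T) (hπZ : Z ≤ Z.comap π) (hJ : J ^ e • (⊤ : Submodule B W) ≤ Z)
    (hT : ∀ y ∈ N, T y - y ∈ J • (⊤ : Submodule B W) ⊔ Z)
    (hπN : ∀ y ∈ N, π y = y) (hπ : ∀ y, π y ∈ N ⊔ Z) (y : W) (hy : y ∈ N) (hTy : T y ∈ Z) :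
    y ∈ Z := by
  have hsub : ∀ i, ∀ a ∈ J ^ i • N, T a - a ∈ J ^ (i + 1) • (⊤ : Submodule B W) ⊔ Z := by
    intro i a ha
    refine Submodule.smul_induction_on ha (fun b hb c hc => ?_) fun b c hb hc => ?_
    · rw [map_smul, ← smul_sub]
      have h1 := Submodule.smul_mem_smul hb (hT c hc)
      rw [Submodule.smul_sup, ← Submodule.mul_smul, ← pow_succ] at h1
      have h2 : J ^ (i + 1) • (⊤ : Submodule B W) ⊔ J ^ i • Z ≤ J ^ (i + 1) • ⊤ ⊔ Z :=
        sup_le_sup_left Submodule.smul_le_right _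
      exact h2 h1
    · have := add_mem hb hc
      rw [map_add]
      convert this using 1
      abel
  -- write `y = a + z` with `a ∈ J ^ i N`; then `T a ∈ Z`, so `a ∈ J ^ (i + 1) W + Z`, and the
  -- projector moves `y` into `J ^ (i + 1) N + Z`
  have key : ∀ i, y ∈ J ^ i • N ⊔ Z := by
    intro i
    induction i with
    | zero =>
      rw [pow_zero, one_smul]
      exact Submodule.mem_sup_left hy
    | succ i ih =>
      obtain ⟨a, ha, z, hz, rfl⟩ := Submodule.mem_sup.1 ih
      have h1 : T a ∈ Z := by
        rw [map_add] at hTy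
        exact (Submodule.add_mem_iff_left Z (hTZ hz)).1 hTy
      have h2 : a ∈ J ^ (i + 1) • (⊤ : Submodule B W) ⊔ Z := by
        have := sub_mem (Submodule.mem_sup_right h1) (hsub i a ha)
        rwa [sub_sub_cancel] at this
      have h3 : a + z ∈ J ^ (i + 1) • (⊤ : Submodule B W) ⊔ Z := add_mem h2 (Submodule.mem_sup_right hz)
      have h4 := Submodule.mem_map_of_mem (f := π) h3
      rw [hπN _ hy, Submodule.map_sup, Submodule.map_smul''] at h4
      have h5 : Submodule.map π ⊤ ≤ N ⊔ Z := by
        rintro _ ⟨x, -, rfl⟩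
        exact hπ x
      have h6 : J ^ (i + 1) • Submodule.map π ⊤ ⊔ Submodule.map π Z ≤ J ^ (i + 1) • N ⊔ Z := by
        refine sup_le ((Submodule.smul_mono le_rfl h5).trans ?_) ?_
        · rw [Submodule.smul_sup]
          exact sup_le_sup_left Submodule.smul_le_right _
        · exact (Submodule.map_le_iff_le_comap.2 hπZ).trans le_sup_right
      exact h6 h4
  have h7 : J ^ e • N ⊔ Z ≤ Z := sup_le ((Submodule.smul_mono le_rfl le_top).trans hJ) le_rfl
  exact h7 (key e)

theorem evala_extAdd {R S : Type*} [CommRing R] [CommRing S] (I : Ideal R) (J : Ideal S)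
    (f : R →+ AdicCompletion J S) (c : ℕ)
    (h : ∀ m, ∀ x ∈ I ^ (m + c), AdicCompletion.evalₐ J m (f x) = 0) (m : ℕ)
    (x : AdicCompletion I R) (hx : AdicCompletion.evalₐ I (m + c) x = 0) :
    AdicCompletion.evalₐ J m (extAdd I J f c h x) = 0 := by
  have := extAddFun_spec I J f c h x m 0 (by rw [hx, map_zero])
  rwa [map_zero, map_zero] at this

variable {k L : Type*} [CommRing k] [CommRing L] [Algebra k L] {n : ℕ}
  (θ : IterativeDerivation k L n) {P Q A B : Type*} [CommRing P] [Algebra L P]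
  [CommRing Q] [Algebra L Q] [CommRing A] [Algebra L A] [CommRing B] [Algebra L B]

theorem evala_hatLin (f : P →ₗ[L] P) (m : ℕ) (x : Hat θ P A)
    (hx : AdicCompletion.evalₐ (wIdeal θ P A) m x = 0) :
    AdicCompletion.evalₐ (wIdeal θ P A) m (hatLin θ f x) = 0 :=
  evala_extAdd _ _ _ 0 _ m x hx

theorem evala_extRing {R S : Type*} [CommRing R] [CommRing S] (I : Ideal R) (J : Ideal S)
    (f : R →+* AdicCompletion J S) (h : I.map f ≤ J.map (algebraMap S (AdicCompletion J S)))
    (m : ℕ) (x : AdicCompletion I R) (hx : AdicCompletion.evalₐ I m x = 0) :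
    AdicCompletion.evalₐ J m (extRing I J f h x) = 0 :=
  evala_extAdd I J (f : R →+ AdicCompletion J S) 0 (ringHom_cont_aux f h) m x hx

theorem evala_hatLift (f : P →ₐ[L] Hat θ Q B) (g : A →ₐ[L] B) (m : ℕ) (x : Hat θ P A)
    (hx : AdicCompletion.evalₐ (wIdeal θ P A) m x = 0) :
    AdicCompletion.evalₐ (wIdeal θ Q B) m (hatLift θ f g x) = 0 :=
  evala_extRing _ _ _ _ m x hx

/-- The kernel of the projection to `P ⊗_L A[[w]] / (w) ^ m`. -/
def hatKer (P A : Type*) [CommRing P] [Algebra L P] [CommRing A] [Algebra L A] (m : ℕ) :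
    Ideal (Hat θ P A) :=
  RingHom.ker (AdicCompletion.evalₐ (wIdeal θ P A) m)

theorem mem_hatKer {m : ℕ} {x : Hat θ P A} :
    x ∈ hatKer θ P A m ↔ AdicCompletion.evalₐ (wIdeal θ P A) m x = 0 := RingHom.mem_ker

/-- The structure homomorphism `A[[w]] → P ⊗̂_L A[[w]]`. -/
def seriesHom (P A : Type*) [CommRing P] [Algebra L P] [CommRing A] [Algebra L A] :
    MvPowerSeries (Fin n) A →+* Hat θ P A :=
  (hatRight θ P A : Tw θ A →+* Hat θ P A).comp (Tw.equiv θ A : MvPowerSeries (Fin n) A →+* Tw θ A)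

theorem seriesHom_mem {m : ℕ} {b : MvPowerSeries (Fin n) A} (hb : b ∈ varIdeal n A ^ m) :
    seriesHom θ P A b ∈ hatKer θ P A m := by
  rw [mem_hatKer]
  refine (evala_algebraMap _ m (TwT.right θ P A (Tw.equiv θ A b))).trans ?_
  rw [Ideal.Quotient.eq_zero_iff_mem]
  exact right_mem_wIdeal_pow θ m ((mem_twPow θ m _).2 hb)

theorem lTensor_eq_zero_of_mem_wIdeal_pow (M : ℕ) (r : TwT θ P A) (h : r ∈ wIdeal θ P A ^ M) :
    LinearMap.lTensor P (twPow θ A M).mkQ (r : P ⊗[L] Tw θ A) = 0 := by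
  refine mem_wIdeal_pow_induction θ M
    (p := fun r => LinearMap.lTensor P (twPow θ A M).mkQ (r : P ⊗[L] Tw θ A) = 0)
    (map_zero (LinearMap.lTensor P (twPow θ A M).mkQ)) (fun x y hx hy => ?_) (fun y b hb => ?_) r h
  · refine (map_add (LinearMap.lTensor P (twPow θ A M).mkQ) x y).trans ?_
    exact (congrArg₂ (· + ·) hx hy).trans (add_zero 0)
  · refine TwT.induction θ (p := fun y => LinearMap.lTensor P (twPow θ A M).mkQ
      (y * TwT.right θ P A (Tw.equiv θ A b) : TwT θ P A) = 0) ?_ (fun x y hx hy => ?_)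
      (fun f c => ?_) y
    · rw [zero_mul]
      exact map_zero (LinearMap.lTensor P (twPow θ A M).mkQ)
    · rw [add_mul]
      refine (map_add (LinearMap.lTensor P (twPow θ A M).mkQ) _ _).trans ?_
      rw [hx, hy, add_zero]
    · rw [mul_assoc, ← map_mul, ← TwT.tmul_eq, LinearMap.lTensor_tmul]
      have h1 : (twPow θ A M).mkQ (c * Tw.equiv θ A b) = 0 := by
        rw [Submodule.mkQ_apply, Submodule.Quotient.mk_eq_zero, mem_twPow, map_mul,
          RingEquiv.symm_apply_apply]
        exact Ideal.mul_mem_left _ _ hb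
      rw [h1, TensorProduct.tmul_zero]

theorem hatMap_id_algebraMap (g : A →ₐ[L] B) (r : TwT θ P A) :
    hatMap θ (AlgHom.id L P) g (algebraMap _ _ r) = algebraMap (TwT θ P B) (Hat θ P B)
      (LinearMap.lTensor P (Tw.map θ g).toLinearMap (r : P ⊗[L] Tw θ A)) := by
  refine TwT.induction θ (p := fun r => hatMap θ (AlgHom.id L P) g (algebraMap _ _ r) =
    algebraMap (TwT θ P B) (Hat θ P B)
      (LinearMap.lTensor P (Tw.map θ g).toLinearMap (r : P ⊗[L] Tw θ A))) ?_ (fun x y hx hy => ?_)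
      (fun f c => ?_) r
  · rw [map_zero, map_zero]
    exact ((congrArg _ (map_zero (LinearMap.lTensor P (Tw.map θ g).toLinearMap))).trans
      (map_zero (algebraMap (TwT θ P B) (Hat θ P B)))).symm
  · rw [map_add, map_add, hx, hy]
    exact ((congrArg _ (map_add (LinearMap.lTensor P (Tw.map θ g).toLinearMap) x y)).trans
      (map_add (algebraMap (TwT θ P B) (Hat θ P B)) _ _)).symm
  · rw [algebraMap_tmul, map_mul, hatMap_left, hatMap_right, ← TwT.tmul_eq,
      LinearMap.lTensor_tmul, TwT.tmul_eq, algebraMap_tmul]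
    rfl

/-- An element that vanishes modulo the nilradical lies, modulo `(w) ^ M`, in a finitely generated
ideal of power series with nilpotent constant coefficients. -/
theorem exists_fg_of_hatMap_eq_zero {M : ℕ} (hM : 0 < M) (x : Hat θ P A)
    (hx : hatMap θ (AlgHom.id L P) (Ideal.Quotient.mkₐ L (nilradical A)) x = 0) :
    ∃ J : Ideal (MvPowerSeries (Fin n) A), J.FG ∧
      J ≤ (nilradical A).comap MvPowerSeries.constantCoeff ∧
      x ∈ J.map (seriesHom θ P A) ⊔ hatKer θ P A M := by
  let π := Ideal.Quotient.mkₐ L (nilradical A)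
  obtain ⟨r, hr⟩ := exists_rep (wIdeal θ P A) M x
  let q := (twPow θ (A ⧸ nilradical A) M).mkQ ∘ₗ (Tw.map θ π).toLinearMap
  have hπ : Function.Surjective (Tw.map θ π) := fun b => by
    choose f hf using fun m : Fin n →₀ ℕ =>
      Ideal.Quotient.mk_surjective (MvPowerSeries.coeff m ((Tw.equiv θ _).symm b))
    refine ⟨Tw.equiv θ A f, (Tw.equiv θ _).symm.injective (MvPowerSeries.ext fun m => ?_)⟩
    exact hf m
  have hq : Function.Surjective q := (Submodule.mkQ_surjective _).comp hπ
  have hrq : LinearMap.lTensor P q (r : P ⊗[L] Tw θ A) = 0 := by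
    refine (LinearMap.congr_fun (LinearMap.lTensor_comp P _ _) r).trans ?_
    refine lTensor_eq_zero_of_mem_wIdeal_pow θ M _ ?_
    have h1 := evala_hatLift θ ((hatLeft θ P _).comp (AlgHom.id L P)) π M _ hr
    have h2 := map_sub (hatMap θ (AlgHom.id L P) π) x (algebraMap _ _ r)
    rw [hx, zero_sub, hatMap_id_algebraMap] at h2
    change AdicCompletion.evalₐ _ M (hatMap θ (AlgHom.id L P) π (x - algebraMap _ _ r)) = 0 at h1
    rw [h2, map_neg, neg_eq_zero] at h1
    exact Ideal.Quotient.eq_zero_iff_mem.1 ((evala_algebraMap _ M _).symm.trans h1)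
  obtain ⟨z, hz⟩ := (lTensor_exact P (LinearMap.exact_subtype_ker_map q) hq r).1 hrq
  have hz' : ∀ z : P ⊗[L] LinearMap.ker q, ∃ J : Ideal (MvPowerSeries (Fin n) A), J.FG ∧
      J ≤ (nilradical A).comap MvPowerSeries.constantCoeff ∧
      algebraMap (TwT θ P A) (Hat θ P A) (LinearMap.lTensor P (LinearMap.ker q).subtype z) ∈
        J.map (seriesHom θ P A) := by
    intro z
    induction z with
    | zero =>
      refine ⟨⊥, Submodule.fg_bot, bot_le, ?_⟩
      rw [map_zero]
      exact (map_zero (algebraMap (TwT θ P A) (Hat θ P A))).symm ▸ zero_mem _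
    | add a b ha hb =>
      obtain ⟨J, h1, h2, h3⟩ := ha
      obtain ⟨J', h1', h2', h3'⟩ := hb
      refine ⟨J ⊔ J', Submodule.FG.sup h1 h1', sup_le h2 h2', ?_⟩
      rw [map_add, Ideal.map_sup]
      have := add_mem (Ideal.mem_sup_left (T := J'.map (seriesHom θ P A)) h3)
        (Ideal.mem_sup_right (S := J.map (seriesHom θ P A)) h3')
      exact (map_add (algebraMap (TwT θ P A) (Hat θ P A)) _ _).symm ▸ this
    | tmul p b =>
      refine ⟨Ideal.span {(Tw.equiv θ A).symm b.1}, Submodule.fg_span_singleton _, ?_, ?_⟩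
      · rw [Ideal.span_singleton_le_iff_mem, Ideal.mem_comap]
        have h1 : Tw.map θ π b.1 ∈ twPow θ (A ⧸ nilradical A) M :=
          (Submodule.Quotient.mk_eq_zero _).1 b.2
        rw [mem_twPow, mem_varIdeal_pow_iff] at h1
        have h2 := h1 0 (by simpa using hM)
        rw [← Ideal.Quotient.eq_zero_iff_mem]
        exact h2
      · rw [LinearMap.lTensor_tmul, TwT.tmul_eq, algebraMap_tmul]
        exact Ideal.mul_mem_left _ _ (Ideal.mem_map_of_mem (seriesHom θ P A)
          (Ideal.mem_span_singleton_self ((Tw.equiv θ A).symm b.1)))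
  obtain ⟨J, h1, h2, h3⟩ := hz' z
  rw [hz] at h3
  refine ⟨J, h1, h2, ?_⟩
  rw [← sub_add_cancel x (algebraMap (TwT θ P A) (Hat θ P A) r)]
  exact add_mem (Ideal.mem_sup_right ((mem_hatKer θ).2 hr)) (Ideal.mem_sup_left h3)

/-- A finitely generated ideal with nilpotent constant coefficients is topologically nilpotent. -/
theorem exists_pow_le_of_fg {J : Ideal (MvPowerSeries (Fin n) A)} (hJ : J.FG)
    (hn : J ≤ (nilradical A).comap MvPowerSeries.constantCoeff) (M : ℕ) :
    ∃ e, J ^ e ≤ varIdeal n A ^ M := by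
  obtain ⟨t, rfl⟩ := hJ
  obtain ⟨d, hd⟩ := exists_pow_le_varIdeal_pow (b := fun b : t => (b : MvPowerSeries (Fin n) A))
    fun b => hn (Ideal.subset_span b.2)
  refine ⟨M + d, ?_⟩
  have h := hd M
  rwa [Subtype.range_coe_subtype, Finset.setOfPred_mem] at h

theorem hatLeft_smul (a : L) (p : P) :
    hatLeft θ P A (a • p) = seriesHom θ P A (twHom θ A a) * hatLeft θ P A p := by
  rw [map_smul, Algebra.smul_def]
  congr 1
  exact ((hatRight θ P A).commutes a).symm

theorem hatLift_seriesHom (h : P →ₐ[L] Hat θ P A) (b : MvPowerSeries (Fin n) A) :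
    hatLift θ h (AlgHom.id L A) (seriesHom θ P A b) = seriesHom θ P A b :=
  (hatLift_right θ h _ _).trans (congrArg _ (Tw.map_id θ _))

/-- A continuous `A[[w]]`-linear endomorphism that is the identity modulo the nilradical of `A` is
injective.  As `L` is semisimple, the finitely many elements of `P` occurring in an element of the
tensor product span a direct summand of `P`, to which Nakayama's argument applies. -/
theorem eq_zero_of_hatLift_eq_zero [IsSemisimpleRing L] (h : P →ₐ[L] Hat θ P A)
    (hmod : ∀ f, hatMap θ (AlgHom.id L P) (Ideal.Quotient.mkₐ L (nilradical A)) (h f) =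
      hatLeft θ P _ f) (x : Hat θ P A) (hx : hatLift θ h (AlgHom.id L A) x = 0) : x = 0 := by
  classical
  refine AdicCompletion.ext_evalₐ fun M => ?_
  rw [map_zero]
  refine evala_of_le (wIdeal θ P A) M.le_succ ?_
  obtain ⟨r, hr⟩ := exists_rep (wIdeal θ P A) (M + 1) x
  obtain ⟨S, hS⟩ := TensorProduct.exists_finset (r : P ⊗[L] Tw θ A)
  -- the elements of `P` that occur in `r` span a direct summand, with projector `πP`
  let P0 : Submodule L P := Submodule.span L (S.image Prod.fst)
  obtain ⟨p0, hp0⟩ := IsSemisimpleModule.extension_property P0.subtype P0.injective_subtype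
    LinearMap.id
  let πP : P →ₗ[L] P := P0.subtype ∘ₗ p0
  have hπP : ∀ p ∈ P0, πP p = p := fun p hp =>
    congrArg Subtype.val (LinearMap.congr_fun hp0 ⟨p, hp⟩)
  let : Algebra (MvPowerSeries (Fin n) A) (Hat θ P A) := (seriesHom θ P A).toAlgebra
  have hsmul : ∀ (b : MvPowerSeries (Fin n) A) (y : Hat θ P A), b • y = seriesHom θ P A b * y :=
    fun b y => Algebra.smul_def b y
  let T : Hat θ P A →ₗ[MvPowerSeries (Fin n) A] Hat θ P A :=
    { toFun := hatLift θ h (AlgHom.id L A)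
      map_add' := map_add _
      map_smul' := fun b y => by rw [hsmul, map_mul, hatLift_seriesHom, RingHom.id_apply, hsmul] }
  let π : Hat θ P A →ₗ[MvPowerSeries (Fin n) A] Hat θ P A :=
    { toFun := hatLin θ πP
      map_add' := map_add _
      map_smul' := fun b y => by
        rw [hsmul, mul_comm, RingHom.id_apply, hsmul, mul_comm (seriesHom θ P A b)]
        exact hatLin_mul_right θ πP y _ }
  let N : Submodule (MvPowerSeries (Fin n) A) (Hat θ P A) :=
    Submodule.span _ (hatLeft θ P A '' (S.image Prod.fst))
  let Z : Submodule (MvPowerSeries (Fin n) A) (Hat θ P A) :=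
    (hatKer θ P A (M + 1)).restrictScalars _
  choose J hJfg hJn hJ using fun p : P => exists_fg_of_hatMap_eq_zero θ M.succ_pos
    (h p - hatLeft θ P A p) (by rw [map_sub, hmod, hatMap_left, AlgHom.id_apply, sub_self])
  -- a finitely generated ideal that is nilpotent modulo `(w) ^ (M + 1)` and controls `h p - p` for
  -- the generators `p` of the summand
  let Jt := (S.image Prod.fst).sup J
  obtain ⟨e, he⟩ := exists_pow_le_of_fg (J := Jt) (Submodule.fg_finset_sup _ _ fun p _ => hJfg p)
    (Finset.sup_le fun p _ => hJn p) (M + 1)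
  have hN : ∀ p ∈ P0, hatLeft θ P A p ∈ N := by
    intro p hp
    induction hp using Submodule.span_induction with
    | mem p hp => exact Submodule.subset_span (Set.mem_image_of_mem _ hp)
    | zero =>
      rw [map_zero]
      exact zero_mem _
    | add a b _ _ ha hb =>
      rw [map_add]
      exact add_mem ha hb
    | smul a p _ hp =>
      rw [hatLeft_smul, ← hsmul]
      exact Submodule.smul_mem _ _ hp
  have hNr : ∀ p ∈ P0, ∀ b : Tw θ A, hatLeft θ P A p * hatRight θ P A b ∈ N := by
    intro p hp b
    have := Submodule.smul_mem N ((Tw.equiv θ A).symm b) (hN p hp)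
    rw [hsmul, mul_comm] at this
    exact this
  have hy : algebraMap (TwT θ P A) (Hat θ P A) r ∈ N := by
    have hr' : r = ∑ i ∈ S, TwT.left θ P A i.1 * TwT.right θ P A i.2 :=
      hS.trans (Finset.sum_congr rfl fun i _ => TwT.tmul_eq θ i.1 i.2)
    rw [hr', map_sum]
    refine sum_mem fun i hi => ?_
    rw [algebraMap_tmul]
    exact hNr _ (Submodule.subset_span (Finset.mem_coe.2 (Finset.mem_image_of_mem _ hi))) _
  have key : algebraMap (TwT θ P A) (Hat θ P A) r ∈ Z := by
    refine mem_of_apply_mem T π N Z Jt e ?_ ?_ ?_ ?_ ?_ ?_ _ hy ?_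
    · exact fun z hz => (mem_hatKer θ).2 (evala_hatLift θ h _ _ z ((mem_hatKer θ).1 hz))
    · exact fun z hz => (mem_hatKer θ).2 (evala_hatLin θ πP _ z ((mem_hatKer θ).1 hz))
    · refine Submodule.smul_le.2 fun b hb y _ => ?_
      rw [hsmul]
      exact Ideal.mul_mem_right _ _ (seriesHom_mem θ (he hb))
    · intro y hy
      induction hy using Submodule.span_induction with
      | mem y hy =>
        obtain ⟨p, hp, rfl⟩ := hy
        have h1 := hJ p
        have h2 : T (hatLeft θ P A p) = h p := hatLift_left θ h _ p
        rw [h2]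
        obtain ⟨a, ha, z, hz, haz⟩ := Submodule.mem_sup.1 h1
        rw [← haz]
        refine Submodule.add_mem_sup ?_ hz
        rw [Ideal.smul_top_eq_map]
        exact Ideal.map_mono (Finset.le_sup (f := J) (Finset.mem_coe.1 hp)) ha
      | zero =>
        rw [map_zero, sub_zero]
        exact zero_mem _
      | add a b _ _ ha hb =>
        rw [map_add, add_sub_add_comm]
        exact add_mem ha hb
      | smul b y _ hy =>
        rw [map_smul, ← smul_sub]
        exact Submodule.smul_mem _ _ hy
    · intro y hy
      induction hy using Submodule.span_induction with
      | mem y hy =>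
        obtain ⟨p, hp, rfl⟩ := hy
        refine (hatLin_left θ πP p).trans ?_
        rw [hπP p (Submodule.subset_span hp)]
      | zero => exact map_zero _
      | add a b _ _ ha hb => rw [map_add, ha, hb]
      | smul b y _ hy => rw [map_smul, hy]
    · intro y
      obtain ⟨s, hs⟩ := exists_rep (wIdeal θ P A) (M + 1) y
      rw [← sub_add_cancel y (algebraMap (TwT θ P A) (Hat θ P A) s), map_add]
      refine add_mem (Submodule.mem_sup_right
        ((mem_hatKer θ).2 (evala_hatLin θ πP _ _ hs))) (Submodule.mem_sup_left ?_)
      refine TwT.induction θ (p := fun s => π (algebraMap (TwT θ P A) (Hat θ P A) s) ∈ N) ?_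
        (fun a b ha hb => ?_) (fun f c => ?_) s
      · rw [map_zero, map_zero]
        exact zero_mem _
      · rw [map_add, map_add]
        exact add_mem ha hb
      · rw [algebraMap_tmul]
        have : π (hatLeft θ P A f * hatRight θ P A c) =
          hatLeft θ P A (πP f) * hatRight θ P A c := hatLin_mul θ πP f c
        rw [this]
        exact hNr _ (p0 f).2 c
    · have h1 : T (algebraMap (TwT θ P A) (Hat θ P A) r) =
          -T (x - algebraMap (TwT θ P A) (Hat θ P A) r) := by
        rw [map_sub, neg_sub, show T x = 0 from hx, sub_zero]
      rw [h1]
      exact neg_mem ((mem_hatKer θ).2 (evala_hatLift θ h _ _ _ hr))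
  have h2 := add_mem ((mem_hatKer θ).2 hr) key
  rw [sub_add_cancel] at h2
  exact (mem_hatKer θ).1 h2

end Injective

/-! ### Product formulas on the completed tensor product -/

section Product

theorem hasse_hasse {n : ℕ} {S : Type*} [CommRing S] (i j : Fin n →₀ ℕ)
    (f : MvPowerSeries (Fin n) S) :
    hasse i (hasse j f) = (∏ s, (i s + j s).choose (i s)) • hasse (i + j) f := by
  ext m
  rw [map_nsmul, coeff_hasse, coeff_hasse, coeff_hasse, ← mul_smul, ← mul_smul, add_assoc,
    ← Finset.prod_mul_distrib, ← Finset.prod_mul_distrib]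
  congr 1
  refine Finset.prod_congr rfl fun s _ => ?_
  simp only [Finsupp.add_apply]
  have h1 := Nat.choose_mul (n := m s + (i s + j s)) (k := i s + j s) (s := j s)
    (by omega)
  rw [show m s + (i s + j s) - j s = m s + i s by omega, Nat.add_sub_cancel] at h1
  rw [Nat.choose_symm_add, mul_comm, add_assoc, ← h1, mul_comm]

variable {k L : Type*} [CommRing k] [CommRing L] [Algebra k L] {n : ℕ}
  (θ : IterativeDerivation k L n) {P A : Type*} [CommRing P] [Algebra L P]
  [CommRing A] [Algebra L A]

/-- Product formulas between continuous additive maps may be checked on tensors. -/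
theorem hat_mul_eq_sum {ι : Type*} (s : Finset ι) {T : Hat θ P A →+ Hat θ P A}
    (U V : ι → Hat θ P A →+ Hat θ P A) (hT : HatCont _ _ T) (hU : ∀ i, HatCont _ _ (U i))
    (hV : ∀ i, HatCont _ _ (V i))
    (h : ∀ f b g c, T (hatLeft θ P A f * hatRight θ P A b * (hatLeft θ P A g * hatRight θ P A c)) =
      ∑ i ∈ s, U i (hatLeft θ P A f * hatRight θ P A b) * V i (hatLeft θ P A g * hatRight θ P A c))
    (x y : Hat θ P A) : T (x * y) = ∑ i ∈ s, U i x * V i y := by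
  have h1 : ∀ f b y, T (hatLeft θ P A f * hatRight θ P A b * y) =
      ∑ i ∈ s, U i (hatLeft θ P A f * hatRight θ P A b) * V i y := by
    intro f b y
    have := hat_ext θ (hT.comp ((HatCont.id _).mulLeft (hatLeft θ P A f * hatRight θ P A b)))
      (HatCont.sum s fun i => (hV i).mulLeft (U i (hatLeft θ P A f * hatRight θ P A b)))
      fun g c => by
        simp only [AddMonoidHom.comp_apply, AddMonoidHom.coe_mulLeft, AddMonoidHom.finsetSum_apply,
          AddMonoidHom.id_apply]
        rw [h]
    refine (DFunLike.congr_fun this y).trans ?_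
    simp only [AddMonoidHom.comp_apply, AddMonoidHom.coe_mulLeft, AddMonoidHom.finsetSum_apply]
  have := hat_ext θ (hT.comp ((HatCont.id _).mulRight y))
    (HatCont.sum s fun i => (hU i).mulRight (V i y)) fun f b => by
    simp only [AddMonoidHom.comp_apply, AddMonoidHom.coe_mulRight, AddMonoidHom.finsetSum_apply,
      AddMonoidHom.id_apply]
    rw [h1]
  refine (DFunLike.congr_fun this x).trans ?_
  simp only [AddMonoidHom.comp_apply, AddMonoidHom.coe_mulRight, AddMonoidHom.finsetSum_apply]

theorem hatOp_mul_eq_sum (δ : P →ₐ[L] Tw θ P) (m : Fin n →₀ ℕ) (x y : Hat θ P A) :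
    hatOp θ δ m (x * y) = ∑ p ∈ Finset.HasAntidiagonal.antidiagonal m,
      hatOp θ δ p.1 x * hatOp θ δ p.2 y := by
  have h : ∀ r s : TwT θ P A, hatOp θ δ m (algebraMap _ (Hat θ P A) r * algebraMap _ (Hat θ P A) s) =
      ∑ p ∈ Finset.HasAntidiagonal.antidiagonal m, hatOp θ δ p.1 (algebraMap _ (Hat θ P A) r) *
        hatOp θ δ p.2 (algebraMap _ (Hat θ P A) s) := by
    intro r s
    rw [← map_mul, hatOp_algebraMap, twOp_mul, map_sum]
    refine Finset.sum_congr rfl fun p _ => ?_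
    rw [hatOp_algebraMap, hatOp_algebraMap, map_mul]
  let U : (Fin n →₀ ℕ) × (Fin n →₀ ℕ) → Hat θ P A →+ Hat θ P A := fun p => hatOp θ δ p.1
  let V : (Fin n →₀ ℕ) × (Fin n →₀ ℕ) → Hat θ P A →+ Hat θ P A := fun p => hatOp θ δ p.2
  refine hat_mul_eq_sum θ (T := hatOp θ δ m) _ U V (hatOp_cont θ δ m)
    (fun p => hatOp_cont θ δ p.1) (fun p => hatOp_cont θ δ p.2) (fun f b g c => ?_) x y
  rw [← algebraMap_tmul, ← algebraMap_tmul]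
  exact h _ _

theorem hatOp_algebraMap_base (δ : P →ₐ[L] Tw θ P) (m : Fin n →₀ ℕ) (a : L) :
    hatOp θ δ m (algebraMap L (Hat θ P A) a) = algebraMap L (Hat θ P A) (θ.op m a) := by
  rw [← (hatLeft θ P A).commutes, hatOp_left, δ.commutes, Tw.coeff_symm_algebraMap,
    (hatLeft θ P A).commutes]

end Product

section HullProduct

variable {C D k L : Type*} [CommRing C] [Ring D] [Bialgebra C D]
  [CommRing k] [CommRing L] [Algebra C k] [Algebra C L] [Algebra k L] [IsScalarTower C k L] {n : ℕ}
  (M : ModuleAlgebra C D L) (θ : IterativeDerivation k L n)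

theorem hullOp_mul (m : Fin n →₀ ℕ) (f g : galoisHull M θ) :
    hullOp M θ m (f * g) = ∑ p ∈ Finset.HasAntidiagonal.antidiagonal m,
      hullOp M θ p.1 f * hullOp M θ p.2 g := by
  refine Subtype.ext ((θ.convOp_mul m _ _).trans ?_)
  rw [AddSubmonoidClass.coe_finsetSum]
  rfl

theorem hullOp_add (m : Fin n →₀ ℕ) (f g : galoisHull M θ) :
    hullOp M θ m (f + g) = hullOp M θ m f + hullOp M θ m g :=
  Subtype.ext (map_add (θ.convOp C D m) _ _)

theorem hullOp_algebraMap (m : Fin n →₀ ℕ) (a : L) :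
    hullOp M θ m (algebraMap L _ a) = algebraMap L (galoisHull M θ) (θ.op m a) :=
  Subtype.ext (θ.convOp_algebraMap m a)

theorem hullOp_zero (f : galoisHull M θ) : hullOp M θ 0 f = f := Subtype.ext (θ.convOp_zero _)

theorem hullOp_hullOp (i j : Fin n →₀ ℕ) (f : galoisHull M θ) :
    hullOp M θ i (hullOp M θ j f) =
      (∏ s, (i s + j s).choose (i s)) • hullOp M θ (i + j) f :=
  Subtype.ext (WithConv.ext (LinearMap.ext fun d => θ.iter i j (f.1 d)))

theorem hullAct_hullOp (d : D) (m : Fin n →₀ ℕ) (f : galoisHull M θ) :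
    hullAct M θ d (hullOp M θ m f) = hullOp M θ m (hullAct M θ d f) := rfl

theorem hullAct_mul {ι : Type*} {d : D} (r : Coalgebra.Repr C d ι) (f g : galoisHull M θ) :
    hullAct M θ d (f * g) =
      ∑ i ∈ r.index, hullAct M θ (r.left i) f * hullAct M θ (r.right i) g := by
  refine Subtype.ext ((actInt_mul r _ _).trans ?_)
  rw [AddSubmonoidClass.coe_finsetSum]
  rfl

theorem hullAct_algebraMap (d : D) (a : L) :
    hullAct M θ d (algebraMap L _ a) =
      algebraMap L (galoisHull M θ) (algebraMap C L (Coalgebra.counit (R := C) d) * a) :=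
  Subtype.ext (actInt_algebraMap d a)

variable [Coalgebra.IsCocomm C D] {A : Type*} [CommRing A] [Algebra L A]

theorem hatOp_hatOp [IsSemisimpleRing L] (i j : Fin n →₀ ℕ) (x : Hat θ (galoisHull M θ) A) :
    hatOp θ (hullTheta M θ) i (hatOp θ (hullTheta M θ) j x) =
      (∏ s, (i s + j s).choose (i s)) • hatOp θ (hullTheta M θ) (i + j) x := by
  refine hat_ext_of_evalHat M θ fun d => ?_
  rw [map_nsmul, (isEvaluation_evalHat M θ d).hatOp, (isEvaluation_evalHat M θ d).hatOp,
    (isEvaluation_evalHat M θ d).hatOp, hasse_hasse]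

theorem hatLin_hatOp (d : D) (m : Fin n →₀ ℕ) (x : Hat θ (galoisHull M θ) A) :
    hatLin θ (hullAct M θ d) (hatOp θ (hullTheta M θ) m x) =
      hatOp θ (hullTheta M θ) m (hatLin θ (hullAct M θ d) x) := by
  refine DFunLike.congr_fun (hat_ext θ ((hatLin_cont θ (hullAct M θ d)).comp
    (hatOp_cont θ (hullTheta M θ) m)) ((hatOp_cont θ (hullTheta M θ) m).comp
    (hatLin_cont θ (hullAct M θ d))) fun f b => ?_) x
  simp only [AddMonoidHom.comp_apply, hatLin_mul, hatOp_mul, map_sum, hatOp_hullTheta,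
    hullAct_hullOp]

theorem hatLin_mul_eq_sum {ι : Type*} {d : D} (r : Coalgebra.Repr C d ι)
    (x y : Hat θ (galoisHull M θ) A) :
    hatLin θ (hullAct M θ d) (x * y) =
      ∑ i ∈ r.index, hatLin θ (hullAct M θ (r.left i)) x * hatLin θ (hullAct M θ (r.right i)) y := by
  refine hat_mul_eq_sum θ _ (fun i => hatLin θ (hullAct M θ (r.left i)))
    (fun i => hatLin θ (hullAct M θ (r.right i))) (hatLin_cont θ _) (fun i => hatLin_cont θ _)
    (fun i => hatLin_cont θ _) (fun f b g c => ?_) x y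
  rw [mul_mul_mul_comm, ← map_mul, ← map_mul, hatLin_mul, hullAct_mul M θ r, map_sum,
    Finset.sum_mul]
  refine Finset.sum_congr rfl fun i _ => ?_
  rw [hatLin_mul, hatLin_mul, map_mul, map_mul, mul_mul_mul_comm]

end HullProduct

/-! ### Transformations that give rise to automorphisms -/

section Presentation

variable {C D k L : Type*} [CommRing C] [Ring D] [Bialgebra C D] [Coalgebra.IsCocomm C D]
  [CommRing k] [CommRing L] [Algebra C k] [Algebra C L] [Algebra k L] [IsScalarTower C k L] {n : ℕ}
  (M : ModuleAlgebra C D L) (θ : IterativeDerivation k L n)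

/-- The presentation of `𝓛` by the generators `θ^{(m)}(ρ(a))`. -/
def hullPres : MvPolynomial ((Fin n →₀ ℕ) × L) L →ₐ[L] galoisHull M θ :=
  MvPolynomial.aeval fun p => hullOp M θ p.1 (hullRho M θ p.2)

theorem hullPres_X (m : Fin n →₀ ℕ) (a : L) :
    hullPres M θ (MvPolynomial.X (m, a)) = hullOp M θ m (hullRho M θ a) :=
  MvPolynomial.aeval_X _ _

/-- The image is stable under the iterative derivation, by the product formula and iterativity. -/
theorem hullPres_surjective : Function.Surjective (hullPres M θ) := by
  intro f
  refine (AlgHom.mem_range _).1 (hull_induction M θ (S := (hullPres M θ).range) (fun a => ?_)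
    (fun m f hf => ?_) f)
  · exact ⟨MvPolynomial.X (0, a), (hullPres_X M θ 0 a).trans (hullOp_zero M θ _)⟩
  · obtain ⟨p, rfl⟩ := hf
    change hullOp M θ m (hullPres M θ p) ∈ (hullPres M θ).range
    induction p using MvPolynomial.induction_on generalizing m with
    | C a =>
      rw [MvPolynomial.algHom_C, hullOp_algebraMap]
      exact Subalgebra.algebraMap_mem _ _
    | add p q hp hq =>
      rw [map_add, hullOp_add]
      exact add_mem (hp m) (hq m)
    | mul_X p i hp =>
      rw [map_mul, hullOp_mul]
      refine sum_mem fun j _ => mul_mem (hp j.1) ?_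
      rw [hullPres_X M θ i.1 i.2, hullOp_hullOp, ← hullPres_X M θ (j.2 + i.1) i.2]
      exact nsmul_mem (AlgHom.mem_range_self _ _) _

variable {M θ} {A : Type*} [CommRing A] [Algebra L A]

variable (M θ) in
/-- The homomorphism that sends the generator of `𝓛` with image `θ^{(m)}(ρ(a))` to
`θ^{(m)}(ρ(a)(Φ))`. -/
def hatPres (Φ : Gamma n A) :
    MvPolynomial ((Fin n →₀ ℕ) × L) L →ₐ[L] Hat θ (galoisHull M θ) A :=
  MvPolynomial.aeval fun p =>
    hatOp θ (hullTheta M θ) p.1 (shift θ (hullTheta M θ) Φ (hullRho M θ p.2))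

theorem hatPres_X (Φ : Gamma n A) (m : Fin n →₀ ℕ) (a : L) :
    hatPres M θ Φ (MvPolynomial.X (m, a)) =
      hatOp θ (hullTheta M θ) m (shift θ (hullTheta M θ) Φ (hullRho M θ a)) :=
  MvPolynomial.aeval_X _ _

variable (M θ) in
/-- The transformation `Φ` is compatible with the relations between the generators
`θ^{(m)}(ρ(a))` of `𝓛`. -/
def Gamma.IsCompatible (Φ : Gamma n A) : Prop :=
  ∀ p, hullPres M θ p = 0 → hatPres M θ Φ p = 0

/-- The homomorphism `𝓛 → 𝓛 ⊗̂_L A[[w]]` given by a compatible transformation. -/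
def Gamma.IsCompatible.hom {Φ : Gamma n A} (h : Φ.IsCompatible M θ) :
    galoisHull M θ →ₐ[L] Hat θ (galoisHull M θ) A :=
  (Ideal.Quotient.liftₐ (RingHom.ker (hullPres M θ)) (hatPres M θ Φ) h).comp
    (Ideal.quotientKerAlgEquivOfSurjective (hullPres_surjective M θ)).symm.toAlgHom

namespace Gamma.IsCompatible

variable {Φ : Gamma n A} (h : Φ.IsCompatible M θ)

theorem hom_hullPres (p : MvPolynomial ((Fin n →₀ ℕ) × L) L) :
    h.hom (hullPres M θ p) = hatPres M θ Φ p := by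
  have : (Ideal.quotientKerAlgEquivOfSurjective (hullPres_surjective M θ)).symm
      (hullPres M θ p) = Ideal.Quotient.mk _ p := by
    rw [AlgEquiv.symm_apply_eq]
    rfl
  exact congrArg (Ideal.Quotient.liftₐ (RingHom.ker (hullPres M θ)) (hatPres M θ Φ) h) this

theorem hom_hullOp_hullRho (m : Fin n →₀ ℕ) (a : L) :
    h.hom (hullOp M θ m (hullRho M θ a)) =
      hatOp θ (hullTheta M θ) m (shift θ (hullTheta M θ) Φ (hullRho M θ a)) := by
  rw [← hullPres_X, hom_hullPres, hatPres_X]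

/-- The endomorphism of `𝓛 ⊗̂_L A[[w]]` given by a compatible transformation. -/
def endo : Hat θ (galoisHull M θ) A →+* Hat θ (galoisHull M θ) A :=
  hatLift θ h.hom (AlgHom.id L A)

theorem endo_left (f : galoisHull M θ) : h.endo (hatLeft θ _ A f) = h.hom f := hatLift_left θ _ _ f

theorem endo_right (b : Tw θ A) : h.endo (hatRight θ _ A b) = hatRight θ _ A b :=
  (hatLift_right θ _ _ b).trans (congrArg _ (Tw.map_id θ b))

theorem endo_cont : HatCont (wIdeal θ (galoisHull M θ) A) (wIdeal θ (galoisHull M θ) A)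
    (h.endo : Hat θ (galoisHull M θ) A →+ Hat θ (galoisHull M θ) A) := hatLift_cont θ _ _

end Gamma.IsCompatible

theorem evalHat_shift (Φ : Gamma n A) (d : D) (a : L) :
    evalHat θ A (hullEval M θ d) (shift θ (hullTheta M θ) Φ (hullRho M θ a)) =
      Φ.substHom (twHom θ A (M.act d a)) := by
  rw [(isEvaluation_evalHat M θ d).apply_shift, evalHat_left, hullEval_hullRho]

theorem hatLin_algebraMap (d : D) (a : L) :
    hatLin θ (hullAct M θ d) (algebraMap L (Hat θ (galoisHull M θ) A) a) =
      algebraMap L _ (algebraMap C L (Coalgebra.counit (R := C) d) * a) := by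
  rw [← (hatLeft θ (galoisHull M θ) A).commutes, hatLin_left, hullAct_algebraMap,
    (hatLeft θ (galoisHull M θ) A).commutes]

end Presentation

section Compatible

variable {C D k L : Type*} [CommRing C] [Ring D] [Bialgebra C D] [Coalgebra.IsCocomm C D]
  [CommRing k] [CommRing L] [IsSemisimpleRing L]
  [Algebra C k] [Algebra C L] [Algebra k L] [IsScalarTower C k L] {n : ℕ}
  {M : ModuleAlgebra C D L} {θ : IterativeDerivation k L n} {A : Type*} [CommRing A] [Algebra L A]

theorem hatOp_zero (x : Hat θ (galoisHull M θ) A) : hatOp θ (hullTheta M θ) 0 x = x :=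
  hat_ext_of_evalHat M θ fun d => by rw [(isEvaluation_evalHat M θ d).hatOp, hasse_zero]

theorem hatLin_shift (Φ : Gamma n A) (d : D) (a : L) :
    hatLin θ (hullAct M θ d) (shift θ (hullTheta M θ) Φ (hullRho M θ a)) =
      shift θ (hullTheta M θ) Φ (hullRho M θ (M.act d a)) := by
  refine hat_ext_of_evalHat M θ fun e => ?_
  have h1 : hullEval M θ e ∘ₗ hullAct M θ d = hullEval M θ (e * d) :=
    LinearMap.ext fun f => hullEval_hullAct M θ d e f
  rw [evalHat_hatLin, h1, evalHat_shift, evalHat_shift, M.mul_act]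

namespace Gamma.IsCompatible

variable {Φ : Gamma n A} (h : Φ.IsCompatible M θ)

theorem hom_hullRho (a : L) :
    h.hom (hullRho M θ a) = shift θ (hullTheta M θ) Φ (hullRho M θ a) := by
  have := h.hom_hullOp_hullRho 0 a
  rwa [hullOp_zero, hatOp_zero] at this

theorem hom_hullOp (m : Fin n →₀ ℕ) (f : galoisHull M θ) :
    h.hom (hullOp M θ m f) = hatOp θ (hullTheta M θ) m (h.hom f) := by
  let S : Subalgebra L (galoisHull M θ) :=
    { carrier := {f | ∀ m, h.hom (hullOp M θ m f) = hatOp θ (hullTheta M θ) m (h.hom f)}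
      add_mem' := fun {f g} hf hg m => by rw [hullOp_add, map_add, map_add, map_add, hf, hg]
      mul_mem' := fun {f g} hf hg m => by
        rw [hullOp_mul, map_sum, map_mul, hatOp_mul_eq_sum]
        exact Finset.sum_congr rfl fun p _ => by rw [map_mul, hf, hg]
      algebraMap_mem' := fun a m => by
        rw [hullOp_algebraMap, AlgHom.commutes, AlgHom.commutes, hatOp_algebraMap_base] }
  refine hull_induction M θ (S := S) (fun a m => ?_) (fun i f hf m => ?_) f m
  · rw [hom_hullOp_hullRho, hom_hullRho]
  · rw [hullOp_hullOp, map_nsmul, hf, hf, hatOp_hatOp]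

theorem hom_hullAct (d : D) (f : galoisHull M θ) :
    h.hom (hullAct M θ d f) = hatLin θ (hullAct M θ d) (h.hom f) := by
  let S : Subalgebra L (galoisHull M θ) :=
    { carrier := {f | ∀ d, h.hom (hullAct M θ d f) = hatLin θ (hullAct M θ d) (h.hom f)}
      add_mem' := fun {f g} hf hg d => by rw [map_add, map_add, map_add, map_add, hf, hg]
      mul_mem' := fun {f g} hf hg d => by
        let r := Coalgebra.Repr.arbitrary C d
        rw [hullAct_mul M θ r, map_sum, map_mul, hatLin_mul_eq_sum M θ r]
        exact Finset.sum_congr rfl fun i _ => by rw [map_mul, hf, hg]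
      algebraMap_mem' := fun a d => by
        rw [hullAct_algebraMap, AlgHom.commutes, AlgHom.commutes, hatLin_algebraMap] }
  refine hull_induction M θ (S := S) (fun a d => ?_) (fun i f hf d => ?_) f d
  · rw [hullAct_hullRho, hom_hullRho, hom_hullRho, hatLin_shift]
  · rw [hullAct_hullOp, hom_hullOp, hom_hullOp, hf, hatLin_hatOp]

theorem hatMap_hom (f : galoisHull M θ) :
    hatMap θ (AlgHom.id L _) (Ideal.Quotient.mkₐ L (nilradical A)) (h.hom f) =
      hatLeft θ _ _ f := by
  let π : Hat θ (galoisHull M θ) A →+* Hat θ (galoisHull M θ) (A ⧸ nilradical A) :=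
    hatMap θ (AlgHom.id L _) (Ideal.Quotient.mkₐ L (nilradical A))
  let S : Subalgebra L (galoisHull M θ) :=
    { carrier := {f | π (h.hom f) = hatLeft θ _ _ f}
      add_mem' := fun {f g} hf hg => by
        change π (h.hom (f + g)) = _
        rw [map_add, map_add, map_add, hf, hg]
      mul_mem' := fun {f g} hf hg => by
        change π (h.hom (f * g)) = _
        rw [map_mul, map_mul, map_mul, hf, hg]
      algebraMap_mem' := fun a => by
        change π (h.hom (algebraMap L _ a)) = _
        rw [AlgHom.commutes, ← (hatLeft θ (galoisHull M θ) A).commutes]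
        exact hatMap_left θ _ _ _ }
  refine hull_induction M θ (S := S) (fun a => ?_) (fun m f hf => ?_) f
  · refine hat_ext_of_evalHat M θ fun d => ?_
    change evalHat θ _ (hullEval M θ d) (hatMap θ _ _ (h.hom (hullRho M θ a))) = _
    rw [hom_hullRho, evalHat_hatMap, evalHat_shift, evalHat_left, hullEval_hullRho]
    refine (Gamma.map_substHom Φ _).trans ?_
    exact map_twHom θ (Ideal.Quotient.mkₐ L (nilradical A)) _
  · change hatMap θ _ _ (h.hom (hullOp M θ m f)) = _
    rw [hom_hullOp, ← hatOp_hatMap, ← hatOp_hullTheta]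
    exact congrArg _ hf

theorem hom_galoisBase (hk : ∀ (d : D) (a : k), ∃ b : k, M.act d (algebraMap k L a) = algebraMap k L b)
    (q : galoisBase k M) :
    h.hom (Subalgebra.inclusion (galoisBase_le M θ) q) =
      hatLeft θ _ A (Subalgebra.inclusion (galoisBase_le M θ) q) := by
  have hle : galoisBase k M ≤ (AlgHom.equalizer h.hom (hatLeft θ _ A)).map (galoisHull M θ).val := by
    refine Algebra.adjoin_le ?_
    rintro _ ⟨a, rfl⟩
    refine ⟨hullRho M θ (algebraMap k L a), ?_, rfl⟩
    refine (hom_hullRho h _).trans (hat_ext_of_evalHat M θ fun d => ?_)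
    obtain ⟨b, hb⟩ := hk d a
    rw [evalHat_shift, evalHat_left, hullEval_hullRho, hb, twHom_apply, AlgHom.commutes,
      MvPowerSeries.algebraMap_apply, MvPowerSeries.map_C]
    exact Gamma.substHom_C _ _
  obtain ⟨f, hf, hfq⟩ := hle q.2
  rw [← show f = Subalgebra.inclusion (galoisBase_le M θ) q from Subtype.ext hfq]
  exact hf

theorem endo_hatOp (m : Fin n →₀ ℕ) (x : Hat θ (galoisHull M θ) A) :
    h.endo (hatOp θ (hullTheta M θ) m x) = hatOp θ (hullTheta M θ) m (h.endo x) := by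
  refine DFunLike.congr_fun (hat_ext θ (h.endo_cont.comp (hatOp_cont θ (hullTheta M θ) m))
    ((hatOp_cont θ (hullTheta M θ) m).comp h.endo_cont) fun f b => ?_) x
  simp only [AddMonoidHom.comp_apply, AddMonoidHom.coe_coe, hatOp_mul, map_sum, map_mul, endo_left,
    endo_right, hatOp_hullTheta, hom_hullOp]

theorem endo_hatLin (d : D) (x : Hat θ (galoisHull M θ) A) :
    h.endo (hatLin θ (hullAct M θ d) x) = hatLin θ (hullAct M θ d) (h.endo x) := by
  refine DFunLike.congr_fun (hat_ext θ (h.endo_cont.comp (hatLin_cont θ (hullAct M θ d)))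
    ((hatLin_cont θ (hullAct M θ d)).comp h.endo_cont) fun f b => ?_) x
  simp only [AddMonoidHom.comp_apply, AddMonoidHom.coe_coe, map_mul, endo_left,
    endo_right, hatLin_mul_right, hatLin_left, hom_hullAct]

theorem hatMap_endo (x : Hat θ (galoisHull M θ) A) :
    hatMap θ (AlgHom.id L _) (Ideal.Quotient.mkₐ L (nilradical A)) (h.endo x) =
      hatMap θ (AlgHom.id L _) (Ideal.Quotient.mkₐ L (nilradical A)) x := by
  refine DFunLike.congr_fun (hat_ext θ
    ((hatMap_cont θ (AlgHom.id L (galoisHull M θ)) (Ideal.Quotient.mkₐ L (nilradical A))).comp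
      h.endo_cont)
    (hatMap_cont θ (AlgHom.id L (galoisHull M θ)) (Ideal.Quotient.mkₐ L (nilradical A)))
    fun f b => ?_) x
  simp only [AddMonoidHom.comp_apply, AddMonoidHom.coe_coe, map_mul, endo_left, endo_right,
    hatMap_hom, hatMap_left, hatMap_right, AlgHom.id_apply]

theorem endo_hatMap_inclusion
    (hk : ∀ (d : D) (a : k), ∃ b : k, M.act d (algebraMap k L a) = algebraMap k L b)
    (y : Hat θ (galoisBase k M) A) :
    h.endo (hatMap θ (Subalgebra.inclusion (galoisBase_le M θ)) (AlgHom.id L A) y) =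
      hatMap θ (Subalgebra.inclusion (galoisBase_le M θ)) (AlgHom.id L A) y := by
  refine DFunLike.congr_fun (hat_ext θ (h.endo_cont.comp
    (hatMap_cont θ (Subalgebra.inclusion (galoisBase_le M θ)) (AlgHom.id L A)))
    (hatMap_cont θ (Subalgebra.inclusion (galoisBase_le M θ)) (AlgHom.id L A)) fun f b => ?_) y
  simp only [AddMonoidHom.comp_apply, AddMonoidHom.coe_coe, map_mul, hatMap_left, hatMap_right,
    endo_left, endo_right, hom_galoisBase h hk]

theorem endo_injective : Function.Injective h.endo := by
  rw [injective_iff_map_eq_zero]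
  exact fun x hx => eq_zero_of_hatLift_eq_zero θ h.hom h.hatMap_hom x hx

/-- The endomorphism given by `Φ` sends the Taylor expansion of `ρ(a)` along `Φ⁻¹` back to `ρ(a)`. -/
theorem endo_shift {Ψ : Gamma n A} (hΨ : Φ * Ψ = 1) (a : L) :
    h.endo (shift θ (hullTheta M θ) Ψ (hullRho M θ a)) = hatLeft θ _ A (hullRho M θ a) := by
  refine hat_ext_of_evalHat M θ fun d => ?_
  have hF : IsEvaluation θ (hullTheta M θ) ((evalHat θ A (hullEval M θ d)).comp
      (h.endo : Hat θ (galoisHull M θ) A →+ Hat θ (galoisHull M θ) A)) :=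
    { cont := (evalHat_cont θ (hullEval M θ d)).comp h.endo_cont
      mul_right := fun x b => by
        simp only [AddMonoidHom.comp_apply, AddMonoidHom.coe_coe, map_mul, endo_right,
          evalHat_mul_right]
      hatOp := fun m x => by
        simp only [AddMonoidHom.comp_apply, AddMonoidHom.coe_coe, endo_hatOp]
        exact (isEvaluation_evalHat M θ d).hatOp m _ }
  refine (hF.apply_shift Ψ (hullRho M θ a)).trans ?_
  simp only [AddMonoidHom.comp_apply, AddMonoidHom.coe_coe, endo_left, hom_hullRho]
  rw [evalHat_shift, evalHat_left, hullEval_hullRho, Gamma.substHom_apply, Gamma.substHom_apply,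
    MvPowerSeries.subst_comp_subst_apply Φ.hasSubst Ψ.hasSubst]
  change MvPowerSeries.subst (Φ * Ψ).1 _ = _
  rw [hΨ]
  exact congrFun MvPowerSeries.subst_self _

/-- The inverse of a compatible transformation is compatible: its homomorphism is obtained by
applying an injective endomorphism to the relations. -/
theorem of_mul_eq_one (h : Φ.IsCompatible M θ) {Ψ : Gamma n A} (hΨ : Φ * Ψ = 1) : Ψ.IsCompatible M θ := by
  have key : (h.endo).comp (hatPres M θ Ψ : MvPolynomial ((Fin n →₀ ℕ) × L) L →+* Hat θ (galoisHull M θ) A) =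
      (hatLeft θ (galoisHull M θ) A : galoisHull M θ →+* Hat θ (galoisHull M θ) A).comp
        (hullPres M θ : MvPolynomial ((Fin n →₀ ℕ) × L) L →+* galoisHull M θ) := by
    refine MvPolynomial.ringHom_ext (fun a => ?_) fun p => ?_
    · simp only [RingHom.comp_apply, RingHom.coe_coe, MvPolynomial.algHom_C]
      rw [← (hatLeft θ (galoisHull M θ) A).commutes, endo_left, AlgHom.commutes, AlgHom.commutes]
    · simp only [RingHom.comp_apply, RingHom.coe_coe]
      rw [hatPres_X Ψ p.1 p.2, hullPres_X M θ p.1 p.2, endo_hatOp, h.endo_shift hΨ, hatOp_hullTheta]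
  intro p hp
  apply h.endo_injective
  refine (RingHom.congr_fun key p).trans ?_
  simp only [RingHom.comp_apply, RingHom.coe_coe, hp, map_zero]

theorem endo_comp {Ψ : Gamma n A} (h' : Ψ.IsCompatible M θ) (hΨ : Φ * Ψ = 1) :
    h.endo.comp h'.endo = RingHom.id _ := by
  refine hat_ringHom_ext (F := h.endo.comp h'.endo) (G := RingHom.id _) (fun m => ?_)
    (fun m => ⟨m, fun x hx => hx⟩) (fun b => ?_) (fun _ => rfl) (fun m x => ?_) (fun _ _ => rfl)
    fun a => ?_
  · obtain ⟨N, hN⟩ := h.endo_cont m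
    obtain ⟨N', hN'⟩ := h'.endo_cont N
    exact ⟨N', fun x hx => hN _ (hN' x hx)⟩
  · rw [RingHom.comp_apply, endo_right, endo_right]
  · rw [RingHom.comp_apply, endo_hatOp, endo_hatOp, RingHom.comp_apply]
  · rw [RingHom.comp_apply, endo_left, hom_hullRho, h.endo_shift hΨ, RingHom.id_apply]

/-- A compatible transformation is the transformation of an automorphism. -/
theorem exists_aut (h : Φ.IsCompatible M θ) {u : Fin n → L} (hθ : θ.IsAssociated u)
    (hk : ∀ (d : D) (a : k), ∃ b : k, M.act d (algebraMap k L a) = algebraMap k L b) :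
    ∃ φ : UmeGroup M θ A, gammaOfAut hθ φ = Φ := by
  obtain ⟨Ψ, h1, h2⟩ := Φ.exists_mul_eq_one
  have h' : Ψ.IsCompatible M θ := h.of_mul_eq_one h2
  refine ⟨⟨RingEquiv.ofRingHom h.endo h'.endo (h.endo_comp h' h2) (h'.endo_comp h h1),
    h.endo_hatLin, h.endo_hatOp, h.endo_hatMap_inclusion hk, h.hatMap_endo⟩, Gamma.ext fun i => ?_⟩
  refine add_left_cancel (a := MvPowerSeries.C (algebraMap L A (u i)))
    ((autHom_basis hθ _ i).symm.trans ?_)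
  rw [autHom_apply]
  change evalHat θ A (hullEval M θ 1) (h.endo (hatLeft θ _ A (hullRho M θ (u i)))) = _
  rw [endo_left, hom_hullRho, evalHat_shift, M.one_act, Gamma.substHom_twHom_basis hθ]

end Gamma.IsCompatible

end Compatible

section

variable {C D k L : Type*} [CommRing C] [Ring D] [Bialgebra C D] [Coalgebra.IsCocomm C D]
  [CommRing k] [IsArtinianRing k] [IsReduced k] [CommRing L] [IsArtinianRing L] [IsReduced L]
  [Algebra C k] [Algebra C L] [Algebra k L] [IsScalarTower C k L] {n : ℕ}
  {M : ModuleAlgebra C D L} {θ : IterativeDerivation k L n} {u : Fin n → L}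
  {A : Type*} [CommRing A] [Algebra L A]

/-- The generators `θ^{(m)}(ρ(a)(Φ))` are the images under `φ` of the generators `θ^{(m)}(ρ(a))`. -/
theorem isCompatible_gammaOfAut (hL : HasResidueExtensions k L n) (hu : IsResidueBasis k u)
    (hθ : θ.IsAssociated u) (φ : UmeGroup M θ A) : (gammaOfAut hθ φ).IsCompatible M θ := by
  have key : (hatPres M θ (gammaOfAut hθ φ) : MvPolynomial ((Fin n →₀ ℕ) × L) L →+* Hat θ (galoisHull M θ) A) =
      ((φ.1 : Hat θ (galoisHull M θ) A →+* Hat θ (galoisHull M θ) A).comp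
        (hatLeft θ (galoisHull M θ) A : galoisHull M θ →+* Hat θ (galoisHull M θ) A)).comp
        (hullPres M θ : MvPolynomial ((Fin n →₀ ℕ) × L) L →+* galoisHull M θ) := by
    refine MvPolynomial.ringHom_ext (fun a => ?_) fun p => ?_
    · simp only [RingHom.comp_apply, RingHom.coe_coe, MvPolynomial.algHom_C]
      rw [AlgHom.commutes, ← (hatRight θ (galoisHull M θ) A).commutes, AutGroup.fix_right]
    · simp only [RingHom.comp_apply, RingHom.coe_coe]
      rw [hatPres_X _ p.1 p.2, hullPres_X M θ p.1 p.2, ← aut_hullRho hL hu hθ, ← hatOp_hullTheta,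
        φ.2.2.1]
  intro p hp
  refine (RingHom.congr_fun key p).trans ?_
  simp only [RingHom.comp_apply, RingHom.coe_coe, hp, map_zero]

end

/-! ### The iterative differential equations of a transformation -/

section Substitution

variable {n : ℕ} {R : Type*} [CommRing R] {b : Fin n → MvPowerSeries (Fin n) R}

/-- The substitution `f ↦ f(b)` as a ring homomorphism. -/
def substRingHom (hb : MvPowerSeries.HasSubst b) :
    MvPowerSeries (Fin n) R →+* MvPowerSeries (Fin n) R :=
  (MvPowerSeries.substAlgHom hb : MvPowerSeries (Fin n) R →ₐ[R] MvPowerSeries (Fin n) R)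

theorem substRingHom_C (hb : MvPowerSeries.HasSubst b) (r : R) :
    substRingHom hb (MvPowerSeries.C r) = MvPowerSeries.C r :=
  (MvPowerSeries.substAlgHom (R := R) hb).commutes r

theorem substRingHom_X (hb : MvPowerSeries.HasSubst b) (i : Fin n) :
    substRingHom hb (MvPowerSeries.X i) = b i := MvPowerSeries.substAlgHom_X hb i

theorem prod_pow_coeff_eq_zero  (hb : ∀ i, MvPowerSeries.constantCoeff (b i) = 0) {j m : Fin n →₀ ℕ} (h : m.degree < j.degree) :
    MvPowerSeries.coeff m (∏ i, b i ^ j i) = 0 := by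
  have h1 := Ideal.pow_right_mono (show Ideal.span (Set.range b) ≤ varIdeal n R from
    Ideal.span_le.2 (by
      rintro _ ⟨i, rfl⟩
      have := (mem_varIdeal_pow_iff 1 (b i)).2 fun l hl => by
        rw [(Finsupp.degree_eq_zero_iff l).1 (by omega)]
        exact hb i
      rwa [pow_one] at this)) j.degree (prod_pow_mem_span_pow b j)
  exact (mem_varIdeal_pow_iff _ _).1 h1 m h

theorem coeff_substRingHom (hb : MvPowerSeries.HasSubst b)
    (hb0 : ∀ i, MvPowerSeries.constantCoeff (b i) = 0) (f : MvPowerSeries (Fin n) R)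
    (m : Fin n →₀ ℕ) : MvPowerSeries.coeff m (substRingHom hb f) = ∑ j ∈ degreeLE n m.degree,
      MvPowerSeries.coeff j f * MvPowerSeries.coeff m (∏ i, b i ^ j i) := by
  change MvPowerSeries.coeff m (MvPowerSeries.substAlgHom hb f) = _
  rw [MvPowerSeries.substAlgHom_apply, MvPowerSeries.coeff_subst hb,
    finsum_eq_sum_of_support_subset (s := degreeLE n m.degree)]
  · refine Finset.sum_congr rfl fun j _ => ?_
    rw [smul_eq_mul, Finsupp.prod_fintype _ _ (by simp)]
  · intro j hj
    rw [Finset.mem_coe, mem_degreeLE]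
    by_contra h
    refine hj ?_
    change _ • _ = _
    rw [Finsupp.prod_fintype _ _ (by simp), prod_pow_coeff_eq_zero hb0 (by omega), smul_zero]

end Substitution

section ChainRule

variable {n : ℕ} {A : Type*} [CommRing A]

/-- The difference `φᵢ(w + t) - φᵢ(w)`. -/
def Gamma.diff (Φ : Gamma n A) (i : Fin n) : MvPowerSeries (Fin n) (MvPowerSeries (Fin n) A) :=
  taylor (Φ.1 i) - MvPowerSeries.C (Φ.1 i)

theorem Gamma.constantCoeff_diff (Φ : Gamma n A) (i : Fin n) :
    MvPowerSeries.constantCoeff (Φ.diff i) = 0 := by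
  rw [Gamma.diff, map_sub, MvPowerSeries.constantCoeff_C, ← MvPowerSeries.coeff_zero_eq_constantCoeff_apply,
    coeff_taylor, hasse_zero, sub_self]

theorem Gamma.hasSubst_diff (Φ : Gamma n A) : MvPowerSeries.HasSubst Φ.diff :=
  MvPowerSeries.hasSubst_of_constantCoeff_zero Φ.constantCoeff_diff

/-- Taylor's formula `f(Φ(w + t)) = ∑ⱼ θ^{(j)}(f)(Φ(w)) (Φ(w + t) - Φ(w))^j`. -/
theorem Gamma.taylor_substHom (Φ : Gamma n A) (f : MvPowerSeries (Fin n) A) :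
    taylor (Φ.substHom f) = substRingHom Φ.hasSubst_diff
      (MvPowerSeries.map (Φ.substHom : MvPowerSeries (Fin n) A →+* MvPowerSeries (Fin n) A)
        (taylor f)) := by
  refine RingHom.congr_fun (ringHom_ext_of_isNilpotent₂
    (taylor.comp (Φ.substHom : MvPowerSeries (Fin n) A →+* MvPowerSeries (Fin n) A))
    ((substRingHom Φ.hasSubst_diff).comp ((MvPowerSeries.map
      (Φ.substHom : MvPowerSeries (Fin n) A →+* MvPowerSeries (Fin n) A)).comp taylor))
    (fun a => ?_) (fun i => ?_) fun i => ?_) f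
  · simp only [RingHom.comp_apply, RingHom.coe_coe, Gamma.substHom_C, taylor_C,
      MvPowerSeries.map_C, substRingHom_C]
  · simp only [RingHom.comp_apply, RingHom.coe_coe, Gamma.substHom_X, taylor_X, map_add,
      MvPowerSeries.map_C, MvPowerSeries.map_X, substRingHom_X, substRingHom_C]
    exact (add_sub_cancel (MvPowerSeries.C (Φ.1 i)) (taylor (Φ.1 i))).symm
  · simp only [RingHom.comp_apply, RingHom.coe_coe, Gamma.substHom_X]
    rw [← MvPowerSeries.coeff_zero_eq_constantCoeff_apply (σ := Fin n) (R := MvPowerSeries (Fin n) A),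
      coeff_taylor, hasse_zero]
    exact Φ.isNilpotent_constantCoeff i

/-- The chain rule for Hasse derivatives. -/
theorem Gamma.hasse_substHom (Φ : Gamma n A) (m : Fin n →₀ ℕ) (f : MvPowerSeries (Fin n) A) :
    hasse m (Φ.substHom f) = ∑ j ∈ degreeLE n m.degree,
      Φ.substHom (hasse j f) * MvPowerSeries.coeff m (∏ i, Φ.diff i ^ j i) := by
  rw [← coeff_taylor, Gamma.taylor_substHom, coeff_substRingHom _ Φ.constantCoeff_diff]
  refine Finset.sum_congr rfl fun j _ => ?_
  rw [MvPowerSeries.coeff_map, coeff_taylor]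
  rfl

variable {L : Type*} [CommRing L] [Algebra L A]

variable (L) in
/-- The difference `Yᵢ(w + t) - Yᵢ(w)` of the differential indeterminate `Yᵢ`. -/
def genericDiff (n : ℕ) (i : Fin n) : MvPowerSeries (Fin n) (DiffPowerSeries n L) :=
  open Classical in fun k => if h : k ≠ 0 then MvPolynomial.X ⟨(i, k), h⟩ else 0

theorem map_eval_genericDiff (Φ : Gamma n A) (i : Fin n) :
    MvPowerSeries.map (Φ.eval L) (genericDiff L n i) = Φ.diff i := by
  ext1 k
  have h1 : MvPowerSeries.coeff k (genericDiff L n i) = genericDiff L n i k := rfl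
  rw [MvPowerSeries.coeff_map, h1, genericDiff]
  by_cases hk : k = 0
  · rw [dif_neg (not_not.2 hk), map_zero, hk, MvPowerSeries.coeff_zero_eq_constantCoeff_apply,
      Gamma.constantCoeff_diff]
  · classical
    rw [dif_pos hk, Gamma.diff, map_sub, coeff_taylor, MvPowerSeries.coeff_C, if_neg hk, sub_zero]
    exact MvPolynomial.eval₂Hom_X' _ _ _

variable (L n) in
/-- The homomorphism `g(w) ↦ g(w)` to the iterative differential power series. -/
def constSeries : MvPowerSeries (Fin n) L →+* DiffPowerSeries n L :=
  MvPolynomial.C.comp ((MvPowerSeries.rename Sum.inl :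
    MvPowerSeries (Fin n) L →ₐ[L] MvPowerSeries (Fin n ⊕ Fin n) L) : _ →+* _)

variable (L n) in
/-- The homomorphism `g(w) ↦ g(Y)` to the iterative differential power series. -/
def substSeries : MvPowerSeries (Fin n) L →+* DiffPowerSeries n L :=
  MvPolynomial.C.comp ((MvPowerSeries.rename Sum.inr :
    MvPowerSeries (Fin n) L →ₐ[L] MvPowerSeries (Fin n ⊕ Fin n) L) : _ →+* _)

theorem Gamma.eval_C_C (Φ : Gamma n A) (a : L) :
    Φ.eval L (MvPolynomial.C (MvPowerSeries.C a)) = MvPowerSeries.C (algebraMap L A a) := by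
  refine (MvPolynomial.eval₂Hom_C _ _ _).trans ?_
  exact ((MvPowerSeries.substAlgHom (R := L) Φ.hasSubst_elim).commutes a).trans
    MvPowerSeries.algebraMap_apply

theorem Gamma.eval_C_X (Φ : Gamma n A) (i : Fin n ⊕ Fin n) :
    Φ.eval L (MvPolynomial.C (MvPowerSeries.X i)) = Sum.elim MvPowerSeries.X Φ.1 i := by
  refine (MvPolynomial.eval₂Hom_C _ _ _).trans ?_
  exact MvPowerSeries.substAlgHom_X Φ.hasSubst_elim i

theorem Gamma.eval_constSeries (Φ : Gamma n A) (g : MvPowerSeries (Fin n) L) :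
    Φ.eval L (constSeries n L g) = MvPowerSeries.map (algebraMap L A) g := by
  refine RingHom.congr_fun (ringHom_ext_of_isNilpotent ((Φ.eval L).comp (constSeries n L))
    (MvPowerSeries.map (algebraMap L A)) (fun a => ?_) (fun i => ?_) fun i => ?_) g
  · rw [RingHom.comp_apply, constSeries, RingHom.comp_apply, RingHom.coe_coe,
      MvPowerSeries.rename_C, Gamma.eval_C_C, MvPowerSeries.map_C]
  · rw [RingHom.comp_apply, constSeries, RingHom.comp_apply, RingHom.coe_coe,
      MvPowerSeries.rename_X, Gamma.eval_C_X, MvPowerSeries.map_X, Sum.elim_inl]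
  · rw [RingHom.comp_apply, constSeries, RingHom.comp_apply, RingHom.coe_coe,
      MvPowerSeries.rename_X, Gamma.eval_C_X, Sum.elim_inl, MvPowerSeries.constantCoeff_X]
    exact IsNilpotent.zero

theorem Gamma.eval_substSeries (Φ : Gamma n A) (g : MvPowerSeries (Fin n) L) :
    Φ.eval L (substSeries n L g) = Φ.substHom (MvPowerSeries.map (algebraMap L A) g) := by
  refine RingHom.congr_fun (ringHom_ext_of_isNilpotent ((Φ.eval L).comp (substSeries n L))
    ((Φ.substHom : MvPowerSeries (Fin n) A →+* MvPowerSeries (Fin n) A).comp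
      (MvPowerSeries.map (algebraMap L A))) (fun a => ?_) (fun i => ?_) fun i => ?_) g
  · rw [RingHom.comp_apply, substSeries, RingHom.comp_apply, RingHom.coe_coe,
      MvPowerSeries.rename_C, Gamma.eval_C_C, RingHom.comp_apply, MvPowerSeries.map_C]
    exact (Gamma.substHom_C _ _).symm
  · rw [RingHom.comp_apply, substSeries, RingHom.comp_apply, RingHom.coe_coe,
      MvPowerSeries.rename_X, Gamma.eval_C_X, RingHom.comp_apply, MvPowerSeries.map_X, Sum.elim_inr]
    exact (Gamma.substHom_X _ _).symm
  · rw [RingHom.comp_apply, substSeries, RingHom.comp_apply, RingHom.coe_coe,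
      MvPowerSeries.rename_X, Gamma.eval_C_X, Sum.elim_inr]
    exact Φ.isNilpotent_constantCoeff i

/-- The iterative differential power series `θ^{(m)}(g(Y))`. -/
def hasseSeries (m : Fin n →₀ ℕ) (g : MvPowerSeries (Fin n) L) : DiffPowerSeries n L :=
  ∑ j ∈ degreeLE n m.degree, substSeries n L (hasse j g) *
    MvPowerSeries.coeff m (∏ i, genericDiff L n i ^ j i)

theorem Gamma.eval_hasseSeries (Φ : Gamma n A) (m : Fin n →₀ ℕ) (g : MvPowerSeries (Fin n) L) :
    Φ.eval L (hasseSeries m g) =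
      hasse m (Φ.substHom (MvPowerSeries.map (algebraMap L A) g)) := by
  rw [hasseSeries, map_sum, Gamma.hasse_substHom]
  refine Finset.sum_congr rfl fun j _ => ?_
  rw [map_mul, Gamma.eval_substSeries, map_hasse, ← MvPowerSeries.coeff_map, map_prod]
  simp only [map_pow, map_eval_genericDiff]

end ChainRule

section Equations

variable {C D k L : Type*} [CommRing C] [Ring D] [Bialgebra C D] [Coalgebra.IsCocomm C D]
  [CommRing k] [CommRing L] [Algebra C k] [Algebra C L] [Algebra k L] [IsScalarTower C k L] {n : ℕ}
  (M : ModuleAlgebra C D L) (θ : IterativeDerivation k L n)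

/-- The values of a polynomial in the `θ^{(m)}(ρ(a)(Φ))` are iterative differential power series in
`Φ`, which do not depend on `A`. -/
theorem exists_eval_eq_evalHat_hatPres (p : MvPolynomial ((Fin n →₀ ℕ) × L) L) (d : D) :
    ∃ F : DiffPowerSeries n L, ∀ (A : CommAlgCat.{v} L) (Φ : Gamma n A),
      Φ.eval L F = evalHat θ A (hullEval M θ d) (hatPres M θ Φ p) := by
  induction p using MvPolynomial.induction_on generalizing d with
  | C a =>
    refine ⟨constSeries n L (θ.hom (hullEval M θ d (algebraMap L _ a))), fun A Φ => ?_⟩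
    rw [Gamma.eval_constSeries, MvPolynomial.algHom_C, ← (hatLeft θ (galoisHull M θ) A).commutes,
      evalHat_left, twHom_apply]
  | add p q hp hq =>
    obtain ⟨F, hF⟩ := hp d
    obtain ⟨E, hE⟩ := hq d
    exact ⟨F + E, fun A Φ => by rw [map_add, hF, hE, map_add, map_add]⟩
  | mul_X p i hp =>
    let r := Coalgebra.Repr.arbitrary C d
    choose F hF using hp
    refine ⟨∑ j ∈ r.index, F (r.left j) * hasseSeries i.1 (θ.hom (M.act (r.right j) i.2)),
      fun A Φ => ?_⟩
    rw [map_mul, evalHat_mul_eq_sum θ r.index (hullEval M θ d) (fun j => hullEval M θ (r.left j))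
      (fun j => hullEval M θ (r.right j)) (hullEval_mul M θ r), map_sum]
    refine Finset.sum_congr rfl fun j _ => ?_
    rw [map_mul, hF, hatPres_X Φ i.1 i.2, (isEvaluation_evalHat M θ (r.right j)).hatOp,
      evalHat_shift, Gamma.eval_hasseSeries, twHom_apply]

end Equations

section LieRitt

open CategoryTheory

variable {C D k : Type*} {L : Type w} [CommRing C] [Ring D] [Bialgebra C D] [Coalgebra.IsCocomm C D]
  [CommRing k] [IsArtinianRing k] [IsReduced k] [CommRing L] [IsArtinianRing L] [IsReduced L]
  [Algebra C k] [Algebra C L] [Algebra k L] [IsScalarTower C k L] {n : ℕ}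
  {M : ModuleAlgebra C D L} {θ : IterativeDerivation k L n} {u : Fin n → L}

/-- The ideal of the iterative differential equations that all transformations `Φ` coming from
automorphisms satisfy. -/
def equationIdeal (M : ModuleAlgebra C D L) (hθ : θ.IsAssociated u) : Ideal (DiffPowerSeries n L) :=
  ⨅ (A : CommAlgCat.{v} L) (φ : UmeGroup M θ A), RingHom.ker ((gammaOfAut hθ φ).eval L)

/-- A transformation that satisfies all equations satisfied by automorphisms is compatible, as each relation
between the generators of `𝓛` is equivalent to such equations. -/
theorem isLieRittFunctor_ume (hL : HasResidueExtensions k L n) (hu : IsResidueBasis k u)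
    (hθ : θ.IsAssociated u)
    (hk : ∀ (d : D) (a : k), ∃ b : k, M.act d (algebraMap k L a) = algebraMap k L b) :
    IsLieRittFunctor n (Ume.{v} M θ) := by
  have := IsArtinianRing.isSemisimpleRing_of_isReduced L
  let η : ∀ A : CommAlgCat.{v} L, UmeGroup M θ A →* Gamma n A := fun A =>
    { toFun := gammaOfAut hθ
      map_one' := gammaOfAut_one hθ
      map_mul' := gammaOfAut_mul hL hu hθ }
  refine ⟨equationIdeal.{v} M hθ, η, fun A => gammaOfAut_injective hL hu hθ, fun A => ?_,
    fun A B f φ => gammaOfAut_umeMap hθ f.hom φ⟩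
  refine Set.Subset.antisymm ?_ fun Φ hΦ => ?_
  · rintro _ ⟨φ, rfl⟩ F hF
    exact RingHom.mem_ker.1 (Ideal.mem_iInf.1 (Ideal.mem_iInf.1 hF A) φ)
  · have h : Φ.IsCompatible M θ := fun p hp => by
      refine hat_ext_of_evalHat M θ fun d => ?_
      obtain ⟨F, hF⟩ := exists_eval_eq_evalHat_hatPres.{v} M θ p d
      rw [← hF, map_zero]
      refine hΦ F (Ideal.mem_iInf.2 fun B => Ideal.mem_iInf.2 fun φ => RingHom.mem_ker.2 ?_)
      rw [hF, isCompatible_gammaOfAut hL hu hθ φ p hp, map_zero]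
    exact h.exists_aut hθ hk

end LieRitt

end
end UmemuraGalois

theorem mainTheorem1 {C : Type*} [Field C] {G : Type*} [Monoid G]
    {H : Type*} [Ring H] [HopfAlgebra C H] [Coalgebra.IsCocomm C H]
    [MulSemiringAction G H] [SMulCommClass G C H] [UmemuraGalois.BialgebraAction C G H]
    (hH : UmemuraGalois.IsBirkhoffWitt C H)
    {L : Type*} [CommRing L] [Algebra C L] [IsArtinianRing L]
    (M : UmemuraGalois.ModuleAlgebra C (SkewMonoidAlgebra H G) L) (hL : M.IsSimple)
    (hG : ∀ g : G, Function.Injective (M.act (SkewMonoidAlgebra.single g 1)))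
    (K : Subalgebra C L) [IsArtinianRing K] (hK : ∀ d, ∀ a ∈ K, M.act d a ∈ K)
    (hKs : (M.restrict K hK).IsSimple)
    (n : ℕ) (hLK : UmemuraGalois.HasResidueExtensions K L n) :
    (∃ u : Fin n → L, UmemuraGalois.IsResidueBasis K u) ∧
    ∀ u : Fin n → L, UmemuraGalois.IsResidueBasis K u →
      (∃! θ : UmemuraGalois.IterativeDerivation K L n, θ.IsAssociated u) ∧
      ∀ θ : UmemuraGalois.IterativeDerivation K L n, θ.IsAssociated u →
        UmemuraGalois.IsLieRittFunctor n (UmemuraGalois.Ume.{v} M θ) := by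
  have : IsReduced L := hL.isReduced M hH
  have : IsReduced K := hKs.isReduced (M.restrict K hK) hH
  refine ⟨UmemuraGalois.exists_isResidueBasis hLK, fun u hu =>
    ⟨UmemuraGalois.existsUnique_isAssociated hLK hu, fun θ hθ => ?_⟩⟩
  exact UmemuraGalois.isLieRittFunctor_ume hLK hu hθ fun d a => ⟨⟨M.act d a, hK d a a.2⟩, rfl⟩
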